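/- \textbf{Setting.} Let $\delta>0$, $\zeta\in(0,1)$ with $\delta+\zeta>1$, let $d=d_1+d_2$, $\beta\in\mathbb R^{d}$, let $\Sigma\in\mathbb R^{d\times d}$ be symmetric positive definite, and let $\gamma_0>0$. For $\gamma\in(0,\gamma_0)$ put $m(\gamma)=\lfloor\gamma^{-\delta}\rfloor$ (number of firms), $T(\gamma)=\lfloor\gamma^{-\zeta}\rfloor$ (number of periods) and $\alpha(\gamma)=\log(1/\gamma)$. For each $\gamma$ the following is given on a probability space (which may depend on $\gamma$). \emph{Covariates.} $V_{i,t}=(Y_t,X_{i,t})\in\mathbb R^{d_1}\times\mathbb R^{d_2}$, $i\le m(\gamma)$, $t\ge 0$, form a stationary (jointly) Gaussian process with $V_{i,t}\sim N(0,\Sigma)$, and there are constants $K$ and $\rho\in(0,1)$, not depending on $\gamma$, such that $\|E(V_{i,t}V_{j,t+k}^{\top})\|\le K\rho^{k}$ (operator norm) for all $i,j,t,k$. \emph{Defaults.} $D_{i,t+1}\in\{0,1\}$ indicates that firm $i$ defaults between times $t$ and $t+1$, and $\tau_i=\min\{T(\gamma)-1,\min\{t\ge 0:D_{i,t+1}=1\}\}$.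 Let $\mathcal F_t$ be the $\sigma$-algebra generated by all $V_{i,s}$, $0\le s\le t$, and $D_{i,s}$, $1\le s\le t$. For $0\le t<T(\gamma)$ the $D_{i,t+1}$, $i\le m(\gamma)$, are conditionally independent given $\mathcal F_t$, with $P(D_{i,t+1}=1\mid\mathcal F_t)=p(V_{i,t},\beta,\alpha(\gamma))\,\mathbf 1(\tau_i\ge t)$, where $p(v,b,a)=q(b^{\top}v-a)$ and $q(x)=e^{x}(1+h(x))$ for a function $h:\mathbb R\to\mathbb R$. \emph{Remainder.} There is a constant $C$ such that for every $\gamma\in(0,\gamma_0)$, $|h(\beta^{\top}V-\alpha(\gamma))|\le C\gamma e^{\beta^{\top}V}$ a.s. for $V\sim N(0,\Sigma)$. Moreover $h$ is three times differentiable and, for $k=0,1,2,3$ and all sufficiently small $\gamma>0$, the variables $\gamma^{-1}h^{(k)}(\beta^{\top}V-\alpha(\gamma))$ are integrable, with $L^1$ norms bounded uniformly in $\gamma$. \emph{Maximum likelihood estimator.} The estimator $\hat\beta_M(\gamma)$ is a random vector in $\mathbb R^d$ which, with probability tending to $1$ as $\gamma\downarrow0$, maximises over $b\in\mathbb R^{d}$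 the likelihood $$\mathcal L(b,\alpha(\gamma))=\prod_{i\le m(\gamma)}\prod_{t=0}^{\tau_i}p(V_{i,t},b,\alpha(\gamma))^{D_{i,t+1}}\bigl(1-p(V_{i,t},b,\alpha(\gamma))\bigr)^{1-D_{i,t+1}} .$$ Let $X_\gamma=\gamma^{-\frac{\delta+\zeta-1}{2}}(\hat\beta_M(\gamma)-\beta)$ and $\Gamma=(\Sigma+\Sigma\beta\beta^{\top}\Sigma)^{-1}\exp(-\tfrac12\beta^{\top}\Sigma\beta)$. \textbf{Statement.} Suppose that $(\|X_\gamma\|_2^2:0<\gamma<\gamma_0)$ is uniformly integrable, that is, $\sup_{0<\gamma<\gamma_0}E\bigl(\|X_\gamma\|_2^2\,\mathbf 1(\|X_\gamma\|_2^2>c)\bigr)\to0$ as $c\to\infty$. Then $E\|\hat\beta_M(\gamma)-\beta\|_2^2<\infty$ for every $\gamma\in(0,\gamma_0)$, and, as $\gamma\downarrow0$, $$E\bigl(\|\hat\beta_M(\gamma)-\beta\|_2^2\bigr)=\mathrm{Tr}(\Gamma)\,\gamma^{\zeta+\delta-1}+o\bigl(\gamma^{\zeta+\delta-1}\bigr).$$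 -/

import Mathlib

open MeasureTheory ProbabilityTheory Filter Topology Matrix

noncomputable section

namespace RareDefault

/-- The space `ℝ^{d₁+d₂}` of covariate vectors `(y, x)` and of parameters `(θ, η)`. -/
abbrev Cov (d₁ d₂ : ℕ) : Type := EuclideanSpace ℝ (Fin d₁ ⊕ Fin d₂)

/-- The covariate vector `V = (Y, X)` formed from the common and the firm-specific part. -/
def joinCov {d₁ d₂ : ℕ} (y : EuclideanSpace ℝ (Fin d₁)) (x : EuclideanSpace ℝ (Fin d₂)) :
    Cov d₁ d₂ :=
  WithLp.toLp 2 (Sum.elim (fun k => y k) (fun k => x k))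

/-- The number of firms `m(γ) = γ^{-δ}` (integer part). -/
def numFirms (δ γ : ℝ) : ℕ := ⌊γ ^ (-δ)⌋₊

/-- The number of periods `T(γ) = γ^{-ζ}` (integer part). -/
def numPeriods (ζ γ : ℝ) : ℕ := ⌊γ ^ (-ζ)⌋₊

/-- The (known) intercept `α(γ) = log (1/γ)`. -/
def alpha (γ : ℝ) : ℝ := Real.log (1 / γ)

/-- The link function `q(x) = e^x (1 + h(x))`. -/
def link (h : ℝ → ℝ) (x : ℝ) : ℝ := Real.exp x * (1 + h x)

/-- Conditional default probability `p(v, b, a) = q(bᵀ v - a)`. -/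
def defaultProb {d₁ d₂ : ℕ} (h : ℝ → ℝ) (v b : Cov d₁ d₂) (a : ℝ) : ℝ :=
  link h (inner ℝ b v - a)

section Sample

variable {Ω : Type*} {m d₁ d₂ : ℕ}

/-- `τ_i = min {T - 1, min {t ≥ 0 : D_{i,t+1} = 1}}`, as the least `t` for which either
`D_{i,t+1} = 1` or `t = T - 1`. Here `D i t` is the indicator that firm `i`
defaults between times `t - 1` and `t` (for `t ≥ 1`; the value `D i 0` is never used). -/
def lastTime (T : ℕ) (D : Fin m → ℕ → Ω → ℝ) (i : Fin m) (ω : Ω) : ℕ :=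
  sInf {t : ℕ | D i (t + 1) ω = 1 ∨ t = T - 1}

/-- The likelihood
`L(b, a) = ∏_{i ≤ m} ∏_{t = 0}^{τ_i} p(V_{i,t},b,a)^{D_{i,t+1}} (1 - p(V_{i,t},b,a))^{1 - D_{i,t+1}}`
of the observed default data. -/
def likelihood (T : ℕ) (h : ℝ → ℝ) (V : Fin m → ℕ → Ω → Cov d₁ d₂) (D : Fin m → ℕ → Ω → ℝ)
    (b : Cov d₁ d₂) (a : ℝ) (ω : Ω) : ℝ :=
  ∏ i : Fin m, ∏ t ∈ Finset.range (lastTime T D i ω + 1),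
    (defaultProb h (V i t ω) b a ^ D i (t + 1) ω
      * (1 - defaultProb h (V i t ω) b a) ^ (1 - D i (t + 1) ω))

/-- `𝓕_t`, the σ-algebra generated by `V_{i,s}` and `D_{i,s}` for all firms `i` and `s ≤ t`. -/
@[reducible] def history (V : Fin m → ℕ → Ω → Cov d₁ d₂) (D : Fin m → ℕ → Ω → ℝ) (t : ℕ) :
    MeasurableSpace Ω :=
  (⨆ i : Fin m, ⨆ s ∈ Finset.Icc 0 t, MeasurableSpace.comap (V i s) inferInstance) ⊔
    (⨆ i : Fin m, ⨆ s ∈ Finset.Icc 1 t, MeasurableSpace.comap (D i s) inferInstance)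

/-- The matrix `E(Z Wᵀ)`. -/
def crossMoment [MeasurableSpace Ω] (P : Measure Ω) (Z W : Ω → Cov d₁ d₂) :
    Matrix (Fin d₁ ⊕ Fin d₂) (Fin d₁ ⊕ Fin d₂) ℝ :=
  Matrix.of fun k l => ∫ ω, Z ω k * W ω l ∂P

/-- The covariates `V_{i,t} = (Y_t, X_{i,t})`, `i ≤ m`, `t ≥ 0`, form a stationary Gaussian process
with `V_{i,t} ∼ N(0, S)` and `‖E(V_{i,t} V_{j,t+k}ᵀ)‖ ≤ K ρ^k` in operator norm, for all
`i, j, t, k`. -/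
structure IsCovariateProcess [MeasurableSpace Ω] (P : Measure Ω)
    (S : Matrix (Fin d₁ ⊕ Fin d₂) (Fin d₁ ⊕ Fin d₂) ℝ) (K ρ : ℝ)
    (Y : ℕ → Ω → EuclideanSpace ℝ (Fin d₁)) (X : Fin m → ℕ → Ω → EuclideanSpace ℝ (Fin d₂))
    (V : Fin m → ℕ → Ω → Cov d₁ d₂) : Prop where
  measurable_common : ∀ t, Measurable (Y t)
  measurable_specific : ∀ i t, Measurable (X i t)
  eq_join : ∀ i t ω, V i t ω = joinCov (Y t ω) (X i t ω)
  gaussian : IsGaussianProcess (fun it : Fin m × ℕ => V it.1 it.2) P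
  stationary : ∀ k : ℕ,
    P.map (fun ω (it : Fin m × ℕ) => V it.1 (it.2 + k) ω)
      = P.map (fun ω (it : Fin m × ℕ) => V it.1 it.2 ω)
  marginal : ∀ i t, HasLaw (V i t) (multivariateGaussian 0 S) P
  short_range : ∀ i j t k,
    ‖Matrix.toEuclideanCLM (𝕜 := ℝ) (crossMoment P (V i t) (V j (t + k)))‖ ≤ K * ρ ^ k

/-- `D i (t+1)` is the `{0,1}`-valued indicator that firm `i` defaults between `t` and `t + 1`.
Given the history up to `t`, the firms surviving at time `t` default independently of each other,
firm `i` with probability `p(V_{i,t})`, and the others do not default: the conditional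
expectation of `∏_{i ∈ A} D_{i,t+1}` is `∏_{i ∈ A} p(V_{i,t}) 𝟙(τ_i ≥ t)` for each set `A` of firms
(for `A = {i}` this is the conditional default probability of firm `i`). -/
structure IsDefaultProcess [MeasurableSpace Ω] (P : Measure Ω) (T : ℕ)
    (p : Cov d₁ d₂ → ℝ) (V : Fin m → ℕ → Ω → Cov d₁ d₂) (D : Fin m → ℕ → Ω → ℝ) : Prop where
  measurable : ∀ i t, Measurable (D i t)
  zero_or_one : ∀ i t ω, D i t ω = 0 ∨ D i t ω = 1
  cond_prob : ∀ t < T, ∀ A : Finset (Fin m),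
    P[fun ω => ∏ i ∈ A, D i (t + 1) ω | history V D t] =ᵐ[P]
      fun ω => ∏ i ∈ A, Set.indicator {ω | t ≤ lastTime T D i ω} (fun ω => p (V i t ω)) ω

end Sample

/-- `Γ = (Σ + Σ β βᵀ Σ)⁻¹ exp (- βᵀ Σ β / 2)`. -/
def limitCov {d₁ d₂ : ℕ} (S : Matrix (Fin d₁ ⊕ Fin d₂) (Fin d₁ ⊕ Fin d₂) ℝ) (β : Cov d₁ d₂) :
    Matrix (Fin d₁ ⊕ Fin d₂) (Fin d₁ ⊕ Fin d₂) ℝ :=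
  Real.exp (-(1 / 2) * (WithLp.ofLp β ⬝ᵥ S *ᵥ WithLp.ofLp β)) •
    (S + S * Matrix.vecMulVec (WithLp.ofLp β) (WithLp.ofLp β) * S)⁻¹

/-- Regularity of `H(γ, V) = h(βᵀ V - α(γ))` under the stationary law `ν` of the covariates: `h` is
three times differentiable, and for all small `γ` the functions `γ⁻¹ h^{(k)}(βᵀ V - α(γ))`, `k ≤ 3`,
are integrable, with a bound on their `L¹` norms that does not depend on `γ`. -/
def RegularRemainder {d₁ d₂ : ℕ} (ν : Measure (Cov d₁ d₂)) (β : Cov d₁ d₂) (h : ℝ → ℝ) : Prop :=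
  (∀ k < 3, Differentiable ℝ (iteratedDeriv k h)) ∧
  ∃ M : ℝ, ∀ᶠ γ in 𝓝[>] (0 : ℝ), ∀ k ≤ 3,
    Integrable (fun v => γ⁻¹ * iteratedDeriv k h (inner ℝ β v - alpha γ)) ν ∧
    ∫ v, |γ⁻¹ * iteratedDeriv k h (inner ℝ β v - alpha γ)| ∂ν ≤ M

/-- Uniform integrability of a family of nonnegative variables `Z γ`, `γ ∈ I`, each on its
own probability space: `sup_γ E(Z_γ 𝟙(Z_γ > c)) → 0` as `c → ∞`. -/
def UnifIntegrableFamily {Ω : ℝ → Type*} [∀ γ, MeasurableSpace (Ω γ)]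
    (P : ∀ γ, Measure (Ω γ)) (I : Set ℝ) (Z : ∀ γ, Ω γ → ℝ) : Prop :=
  Tendsto (fun c : ℝ => ⨆ γ ∈ I,
    ∫⁻ ω, Set.indicator {ω | c < Z γ ω} (fun ω => ENNReal.ofReal (Z γ ω)) ω ∂(P γ))
    atTop (𝓝 0)

end RareDefault

end

/-! Uniform integrability makes a central limit theorem unnecessary: only second moments have to
converge, and martingale orthogonality computes them. Write ε = γ^((δ+ζ-1)/2) and u = X_γ, so that
the estimator is β + ε u. The scale is right because ε² γ m(γ) T(γ) → 1 (`tendsto_normalisation`):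
there are of order γ m T defaults, each carrying information of order one.

At a maximiser the score vanishes in every direction c (`TailBound.score_eq_zero`). Subtracting ε
times this equation from the score at β, and expanding to first order, shows that the score at β in
direction c is close to ε² γ ∑ (c·V)(u·V) exp(β·V) (`IsCutoff.abs_scoreSum_sub_le`). By a law of
large numbers the coefficient of u tends to cᵀ Γ⁻¹, since Γ⁻¹ = exp(βᵀΣβ/2)(Σ + Σββᵀ Σ) is the
exponentially tilted second moment of V. For c the k-th row of Γ this says that u_k is close in
probability to a truncated score at the true parameter, `limitScore`
(`eventually_measure_sub_limitScore_le`).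

That score is a sum of compensated default indicators. When the firms of a period are revealed one
after the other, its terms become martingale differences (`IsDefaultProcess.condExp_blockHistory`).
Hence its second moment is the sum of the expected conditional variances, which to leading order is
cᵀ Γ⁻¹ c = Γ_kk, and its fourth moment stays bounded (`limitScore_moments`). Closeness in
probability, the bounded fourth moment and the uniform integrability of ‖u‖² together give E u_k² →
Γ_kk (`abs_integral_sq_sub_le`, `tendsto_integral_coord_sq`). Summing over k gives the trace.

Three technical points support this. The assumptions on h are bounds in L¹, and a one-dimensional
Sobolev inequality turns them into pointwise bounds h, h', h'' = O(e^x) at -∞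
(`RegularRemainder.exists_tailBound`). Covariates are truncated at a radius of order log(1/γ):
inside it default probabilities are O(√γ), and outside it the Gaussian mass is smaller than any
power of γ, hence negligible against m T. The law of large numbers is proved for exponentials of
linear functionals, whose covariances are explicit; quadratic factors come from second differences
in the exponent (`UniformLLN.inner_sq`). Finally ζ < 1 makes early default of a given firm
improbable (`tendsto_lossBound`), so sums over observed periods may be replaced by sums over all
periods. -/

noncomputable section

namespace RareDefault

open scoped NNReal ENNReal

/-! ### Pointwise tail bounds for the remainder, from its L¹ bounds -/

/-- Lebesgue measure on `(-1, 0]` is dominated by a multiple of a nondegenerate Gaussian. -/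
lemma exists_restrict_le_smul_gaussianReal {v : ℝ≥0} (hv : v ≠ 0) :
    ∃ c : ℝ≥0, (volume : Measure ℝ).restrict (Set.Ioc (-1) 0) ≤ c • gaussianReal 0 v := by
  have hpos : 0 < gaussianPDFReal 0 v 1 := gaussianPDFReal_pos 0 v 1 hv
  -- On (-1, 0] one has y² ≤ 1, so the density there is at least its value at 1.
  refine ⟨(gaussianPDFReal 0 v 1).toNNReal⁻¹, ?_⟩
  have key : ∀ y ∈ Set.Ioc (-1 : ℝ) 0, gaussianPDFReal 0 v 1 ≤ gaussianPDFReal 0 v y := by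
    intro y hy
    unfold gaussianPDFReal
    gcongr ?_ * Real.exp (-?_ / _)
    have : y ^ 2 ≤ 1 := by nlinarith [hy.1, hy.2]
    simpa using this
  refine Measure.le_iff.2 fun s hs => ?_
  rw [Measure.restrict_apply hs, Measure.smul_apply, gaussianReal_apply 0 hv]
  have h1 : ∫⁻ _ in s ∩ Set.Ioc (-1) 0, ENNReal.ofReal (gaussianPDFReal 0 v 1)
      ≤ ∫⁻ x in s, gaussianPDF 0 v x := by
    refine (setLIntegral_mono' (hs.inter measurableSet_Ioc) fun y hy => ?_).trans
      (lintegral_mono_set Set.inter_subset_left)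
    exact ENNReal.ofReal_le_ofReal (key y hy.2)
  rw [lintegral_const, Measure.restrict_apply_univ] at h1
  rw [ENNReal.smul_def, smul_eq_mul, ENNReal.coe_inv (by simpa using hpos)]
  change _ ≤ (ENNReal.ofReal _)⁻¹ * _
  rw [← ENNReal.div_eq_inv_mul, ENNReal.le_div_iff_mul_le (by simp [hpos]) (by simp), mul_comm]
  exact h1

/-- One-dimensional Sobolev inequality on the unit interval `[x - 1, x]`. -/
lemma abs_le_integral_abs_add_integral_abs_deriv {f : ℝ → ℝ} (hf : Differentiable ℝ f) (x : ℝ)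
    (hf' : IntegrableOn (fun y => deriv f (y + x)) (Set.Ioc (-1) 0)) :
    |f x| ≤ (∫ y in Set.Ioc (-1 : ℝ) 0, |f (y + x)|)
      + ∫ y in Set.Ioc (-1 : ℝ) 0, |deriv f (y + x)| := by
  have hfc : Continuous fun y => |f (y + x)| := by
    have := hf.continuous; fun_prop
  have hI : IntegrableOn (fun y => |f (y + x)|) (Set.Ioc (-1) 0) :=
    (hfc.integrableOn_Icc (a := -1) (b := 0)).mono_set Set.Ioc_subset_Icc_self
  -- The fundamental theorem of calculus on [y, 0] compares f at x with f at y + x; averaging over y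
  -- in an interval of length one then gives the claim.
  have hpt : ∀ y ∈ Set.Ioc (-1 : ℝ) 0,
      |f x| - (∫ y in Set.Ioc (-1 : ℝ) 0, |deriv f (y + x)|) ≤ |f (y + x)| := by
    intro y hy
    have hsub : Set.Ioc y 0 ⊆ Set.Ioc (-1) 0 := Set.Ioc_subset_Ioc_left hy.1.le
    have hint : ∫ s in y..0, deriv f (s + x) = f (0 + x) - f (y + x) := by
      refine intervalIntegral.integral_eq_sub_of_hasDerivAt (f := fun s => f (s + x)) ?_ ?_
      · intro s _
        exact (hf (s + x)).hasDerivAt.comp_add_const s x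
      · rw [intervalIntegrable_iff_integrableOn_Ioc_of_le hy.2]
        exact hf'.mono_set hsub
    have h2 : |∫ s in y..0, deriv f (s + x)| ≤ ∫ y in Set.Ioc (-1 : ℝ) 0, |deriv f (y + x)| := by
      rw [intervalIntegral.integral_of_le hy.2]
      refine abs_integral_le_integral_abs.trans ?_
      exact setIntegral_mono_set hf'.abs (ae_of_all _ fun _ => abs_nonneg _) hsub.eventuallyLE
    rw [hint, zero_add] at h2
    have := abs_sub_abs_le_abs_sub (f x) (f (y + x))
    linarith
  have := setIntegral_mono_on (integrableOn_const (by simp)) hI measurableSet_Ioc hpt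
  simp at this
  linarith

/-- Putting γ = e^x turns y - α(γ) into y + x, so the hypotheses bound the Gaussian L¹ norms of the
translates of f and f' by M e^x. On the window (-1, 0] the Gaussian dominates Lebesgue measure, and
the Sobolev inequality bounds f at the single point x. -/
lemma eventually_abs_le_exp_of_gaussian {v : ℝ≥0} (hv : v ≠ 0) {f : ℝ → ℝ}
    (hf : Differentiable ℝ f) {M : ℝ}
    (h0 : ∀ᶠ γ in 𝓝[>] (0 : ℝ), Integrable (fun y => γ⁻¹ * f (y - alpha γ)) (gaussianReal 0 v) ∧
      ∫ y, |γ⁻¹ * f (y - alpha γ)| ∂(gaussianReal 0 v) ≤ M)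
    (h1 : ∀ᶠ γ in 𝓝[>] (0 : ℝ),
      Integrable (fun y => γ⁻¹ * deriv f (y - alpha γ)) (gaussianReal 0 v) ∧
      ∫ y, |γ⁻¹ * deriv f (y - alpha γ)| ∂(gaussianReal 0 v) ≤ M) :
    ∃ C : ℝ, ∀ᶠ x in atBot, |f x| ≤ C * Real.exp x := by
  obtain ⟨c, hc⟩ := exists_restrict_le_smul_gaussianReal hv
  refine ⟨c * M + c * M, ?_⟩
  filter_upwards [Real.tendsto_exp_atBot_nhdsGT.eventually h0,
    Real.tendsto_exp_atBot_nhdsGT.eventually h1] with x h0 h1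
  have hsimp : ∀ y, y - alpha (Real.exp x) = y + x := by
    intro y; simp [alpha]
  simp only [hsimp] at h0 h1
  have aux : ∀ g : ℝ → ℝ, Integrable (fun y => (Real.exp x)⁻¹ * g (y + x)) (gaussianReal 0 v) ∧
      ∫ y, |(Real.exp x)⁻¹ * g (y + x)| ∂(gaussianReal 0 v) ≤ M →
      IntegrableOn (fun y => g (y + x)) (Set.Ioc (-1) 0) ∧
      ∫ y in Set.Ioc (-1 : ℝ) 0, |g (y + x)| ≤ c * M * Real.exp x := by
    rintro g ⟨hg1, hg2⟩
    have hg3 : Integrable (fun y => g (y + x)) (gaussianReal 0 v) := by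
      refine (hg1.const_mul (Real.exp x)).congr (ae_of_all _ fun y => ?_)
      simp [Real.exp_ne_zero]
    have hg4 : Integrable (fun y => g (y + x)) (c • gaussianReal 0 v) :=
      hg3.smul_measure_nnreal
    refine ⟨hg4.mono_measure hc, ?_⟩
    refine (integral_mono_measure hc (ae_of_all _ fun _ => abs_nonneg _) hg4.abs).trans ?_
    rw [integral_smul_nnreal_measure]
    simp only [abs_mul, abs_inv, Real.abs_exp, integral_const_mul] at hg2
    rw [NNReal.smul_def, smul_eq_mul, mul_assoc]
    gcongr
    rw [inv_mul_le_iff₀ (Real.exp_pos x)] at hg2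
    linarith
  have := abs_le_integral_abs_add_integral_abs_deriv hf x (aux _ h1).1
  linarith [(aux _ h0).2, (aux _ h1).2]

/-- The remainder and its first two derivatives are `O(e^x)` on a left half-line. -/
structure TailBound (h : ℝ → ℝ) (M L : ℝ) : Prop where
  diff : Differentiable ℝ h
  diff_deriv : Differentiable ℝ (deriv h)
  small : M * Real.exp L ≤ 1 / 8
  exp_small : Real.exp L ≤ 1 / 8
  nonneg : 0 ≤ M
  bound : ∀ x ≤ L, |h x| ≤ M * Real.exp x
  bound_deriv : ∀ x ≤ L, |deriv h x| ≤ M * Real.exp x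
  bound_deriv_deriv : ∀ x ≤ L, |deriv (deriv h) x| ≤ M * Real.exp x

/-- Linear functionals of a centred Gaussian vector. -/
lemma map_inner_multivariateGaussian {ι : Type*} [Fintype ι] [DecidableEq ι] {S : Matrix ι ι ℝ}
    (hS : S.PosSemidef) (a : EuclideanSpace ℝ ι) :
    (multivariateGaussian 0 S).map (fun v => inner ℝ a v) =
      gaussianReal 0 (a ⬝ᵥ S *ᵥ a).toNNReal := by
  have := IsGaussian.map_eq_gaussianReal (μ := multivariateGaussian (0 : EuclideanSpace ℝ ι) S)
    (innerSL ℝ a)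
  have hm : ∫ v, inner ℝ a v ∂(multivariateGaussian (0 : EuclideanSpace ℝ ι) S) = 0 := by
    rw [integral_inner IsGaussian.integrable_fun_id]; simp
  have hvar : Var[fun v => inner ℝ a v; multivariateGaussian (0 : EuclideanSpace ℝ ι) S]
      = a ⬝ᵥ S *ᵥ a := by
    rw [← covarianceBilin_multivariateGaussian (μ := (0 : EuclideanSpace ℝ ι)) hS a a,
      covarianceBilin_self IsGaussian.memLp_two_id]
  simp only [innerSL_apply_apply] at this
  rw [← hvar]
  convert! this using 2
  exact hm.symm

/-- A bound on the k-th derivative costs control of the (k+1)-st, hence k < 3 although derivatives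
up to order 3 are controlled. -/
lemma RegularRemainder.exists_eventually_le {d₁ d₂ : ℕ}
    {S : Matrix (Fin d₁ ⊕ Fin d₂) (Fin d₁ ⊕ Fin d₂) ℝ} (hS : S.PosDef) {β : Cov d₁ d₂} {h : ℝ → ℝ}
    (hreg : RegularRemainder (multivariateGaussian 0 S) β h) {k : ℕ} (hk : k < 3) :
    ∃ C : ℝ, ∀ᶠ x in atBot, |iteratedDeriv k h x| ≤ C * Real.exp x := by
  obtain ⟨hd, M, hM⟩ := hreg
  -- For β = 0 the functional is constant and the L¹ bound is already pointwise. Otherwise βᵀV is a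
  -- nondegenerate real Gaussian and the one-dimensional lemma applies to its law.
  by_cases hβ : β = 0
  · refine ⟨M, ?_⟩
    filter_upwards [Real.tendsto_exp_atBot_nhdsGT.eventually hM] with x hx
    have := (hx k (by omega)).2
    simp only [hβ, inner_zero_left, alpha, one_div, ← Real.exp_neg, Real.log_exp, integral_const,
      probReal_univ, smul_eq_mul, one_mul, zero_sub, neg_neg, abs_mul, Real.abs_exp] at this
    rw [Real.exp_neg, inv_mul_le_iff₀ (Real.exp_pos x)] at this
    linarith
  · have hmap := map_inner_multivariateGaussian hS.posSemidef β
    have hv : (β ⬝ᵥ S *ᵥ β).toNNReal ≠ 0 := by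
      have := hS.dotProduct_mulVec_pos (x := WithLp.ofLp β) (by simpa using hβ)
      simp at this
      simpa using this
    have hmeas : ∀ j < 4, ∀ γ : ℝ, Measurable (fun y => γ⁻¹ * iteratedDeriv j h (y - alpha γ)) := by
      intro j hj γ
      have : Measurable (iteratedDeriv j h) := by
        -- The third derivative need not be continuous; it is measurable because it is a derivative.
        rcases Nat.lt_succ_iff_lt_or_eq.1 hj with h3 | rfl
        · exact (hd j h3).continuous.measurable
        · rw [iteratedDeriv_succ]; exact measurable_deriv _
      fun_prop
    have key : ∀ j < 4, ∀ᶠ γ in 𝓝[>] (0 : ℝ), Integrable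
        (fun y => γ⁻¹ * iteratedDeriv j h (y - alpha γ)) (gaussianReal 0 (β ⬝ᵥ S *ᵥ β).toNNReal) ∧
        ∫ y, |γ⁻¹ * iteratedDeriv j h (y - alpha γ)| ∂(gaussianReal 0 (β ⬝ᵥ S *ᵥ β).toNNReal)
          ≤ M := by
      intro j hj
      filter_upwards [hM] with γ hγ
      have hin : AEMeasurable (fun v : Cov d₁ d₂ => inner ℝ β v) (multivariateGaussian 0 S) := by
        fun_prop
      rw [← hmap, integrable_map_measure (hmeas j hj γ).aestronglyMeasurable hin,
        integral_map hin (hmeas j hj γ).abs.aestronglyMeasurable]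
      exact hγ j (by omega)
    refine eventually_abs_le_exp_of_gaussian hv (hd k hk) (M := M) (key k (by omega)) ?_
    rw [← iteratedDeriv_succ]
    exact key (k + 1) (by omega)

lemma RegularRemainder.exists_tailBound {d₁ d₂ : ℕ}
    {S : Matrix (Fin d₁ ⊕ Fin d₂) (Fin d₁ ⊕ Fin d₂) ℝ} (hS : S.PosDef) {β : Cov d₁ d₂} {h : ℝ → ℝ}
    (hreg : RegularRemainder (multivariateGaussian 0 S) β h) : ∃ M L, TailBound h M L := by
  obtain ⟨C0, h0⟩ := hreg.exists_eventually_le hS (k := 0) (by norm_num)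
  obtain ⟨C1, h1⟩ := hreg.exists_eventually_le hS (k := 1) (by norm_num)
  obtain ⟨C2, h2⟩ := hreg.exists_eventually_le hS (k := 2) (by norm_num)
  have d0 := hreg.1 0 (by norm_num)
  have d1 := hreg.1 1 (by norm_num)
  rw [iteratedDeriv_zero] at d0
  rw [iteratedDeriv_one] at d1
  set M := |C0| + |C1| + |C2| with hM
  have hMn : 0 ≤ M := by positivity
  have hs : ∀ᶠ x in atBot, M * Real.exp x < 1 / 8 := by
    have := Real.tendsto_exp_atBot.const_mul M
    rw [mul_zero] at this
    exact this.eventually_lt_const (by norm_num)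
  have he : ∀ᶠ x in atBot, Real.exp x < 1 / 8 :=
    Real.tendsto_exp_atBot.eventually_lt_const (by norm_num)
  obtain ⟨L, hL⟩ := eventually_atBot.1
    (h0.and (h1.and (h2.and (hs.and he))))
  have hC0 : C0 ≤ M := by linarith [le_abs_self C0, abs_nonneg C1, abs_nonneg C2]
  have hC1 : C1 ≤ M := by linarith [le_abs_self C1, abs_nonneg C0, abs_nonneg C2]
  have hC2 : C2 ≤ M := by linarith [le_abs_self C2, abs_nonneg C0, abs_nonneg C1]
  refine ⟨M, L, d0, d1, (hL L le_rfl).2.2.2.1.le,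
    (hL L le_rfl).2.2.2.2.le, hMn, fun x hx => ?_, fun x hx => ?_, fun x hx => ?_⟩
  · have := (hL x hx).1
    rw [iteratedDeriv_zero] at this
    exact this.trans (mul_le_mul_of_nonneg_right hC0 (Real.exp_pos x).le)
  · have := (hL x hx).2.1
    rw [iteratedDeriv_one] at this
    exact this.trans (mul_le_mul_of_nonneg_right hC1 (Real.exp_pos x).le)
  · have := (hL x hx).2.2.1
    rw [iteratedDeriv_succ, iteratedDeriv_one] at this
    exact this.trans (mul_le_mul_of_nonneg_right hC2 (Real.exp_pos x).le)

/-! ### Expansion of the link and of the score weight near -∞ -/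

/-- The weight `q' / (q (1 - q))` of an observation in the score. -/
def scoreWeight (h : ℝ → ℝ) (x : ℝ) : ℝ := (1 + deriv h x * (1 + h x)⁻¹) * (1 - link h x)⁻¹

/-- Increments over steps of length at most one of a function with derivative `O(e^{cx})`. -/
lemma abs_sub_le_of_deriv_bound {f : ℝ → ℝ} {L c C x y : ℝ} (hc : 0 ≤ c)
    (hC : 0 ≤ C) (hf : ∀ z ≤ L, ∃ f', HasDerivAt f f' z ∧ |f'| ≤ C * Real.exp (c * z))
    (hx : x ≤ L) (hy : y ≤ L) (hxy : y ≤ x + 1) :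
    |f y - f x| ≤ C * Real.exp (c * x + c) * |y - x| := by
  choose! f' hf' hb using hf
  -- The half-line below min L (x + 1) is convex, contains x and y, and on it exp (c z) is at most
  -- exp (c x + c).
  refine Convex.norm_image_sub_le_of_norm_hasDerivWithin_le (s := Set.Iic (min L (x + 1)))
    (f' := f') (fun z hz => (hf' z (le_min_iff.1 (Set.mem_Iic.1 hz)).1).hasDerivWithinAt)
    (fun z hz => (hb z (le_min_iff.1 (Set.mem_Iic.1 hz)).1).trans ?_) (convex_Iic _)
    (Set.mem_Iic.2 (le_min hx (by linarith))) (Set.mem_Iic.2 (le_min hy hxy))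
  have := (le_min_iff.1 (Set.mem_Iic.1 hz)).2
  gcongr
  nlinarith

namespace TailBound

variable {h : ℝ → ℝ} {M L : ℝ} (H : TailBound h M L)
include H

lemma mul_exp_le {x : ℝ} (hx : x ≤ L) : M * Real.exp x ≤ 1 / 8 :=
  (mul_le_mul_of_nonneg_left (Real.exp_le_exp.2 hx) H.nonneg).trans H.small

lemma exp_le {x : ℝ} (hx : x ≤ L) : Real.exp x ≤ 1 / 8 := (Real.exp_le_exp.2 hx).trans H.exp_small

lemma link_pos {x : ℝ} (hx : x ≤ L) : 0 < link h x := by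
  have := abs_le.1 ((H.bound x hx).trans (H.mul_exp_le hx))
  exact mul_pos (Real.exp_pos x) (by linarith [this.1])

lemma link_le {x : ℝ} (hx : x ≤ L) : link h x ≤ 2 * Real.exp x := by
  have := abs_le.1 ((H.bound x hx).trans (H.mul_exp_le hx))
  unfold link
  nlinarith [Real.exp_pos x, this.2]

lemma link_le_quarter {x : ℝ} (hx : x ≤ L) : link h x ≤ 1 / 4 := by
  linarith [H.link_le hx, H.exp_le hx]

lemma abs_link_le {x : ℝ} (hx : x ≤ L) : |link h x| ≤ 2 * Real.exp x := by
  rw [abs_of_pos (H.link_pos hx)]; exact H.link_le hx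

lemma one_add_pos {x : ℝ} (hx : x ≤ L) : 7 / 8 ≤ 1 + h x := by
  have := abs_le.1 ((H.bound x hx).trans (H.mul_exp_le hx))
  linarith [this.1]

lemma abs_inv_one_add_le {x : ℝ} (hx : x ≤ L) : |(1 + h x)⁻¹| ≤ 2 := by
  have := H.one_add_pos hx
  rw [abs_of_pos (by positivity)]
  exact inv_le_of_inv_le₀ (by norm_num) (by linarith)

lemma abs_inv_one_sub_link_le {x : ℝ} (hx : x ≤ L) : |(1 - link h x)⁻¹| ≤ 2 := by
  have := H.link_le_quarter hx
  rw [abs_of_pos (inv_pos.2 (by linarith))]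
  exact inv_le_of_inv_le₀ (by norm_num) (by linarith)

lemma hasDerivAt_link (x : ℝ) :
    HasDerivAt (link h) (Real.exp x * (1 + h x) + Real.exp x * deriv h x) x := by
  have := (Real.hasDerivAt_exp x).mul ((H.diff x).hasDerivAt.const_add 1)
  exact this

lemma scoreWeight_sub_one {x : ℝ} (hx : x ≤ L) :
    scoreWeight h x - 1 = (deriv h x * (1 + h x)⁻¹ + link h x) * (1 - link h x)⁻¹ := by
  have := H.link_le_quarter hx
  have : 1 - link h x ≠ 0 := by linarith
  unfold scoreWeight
  field_simp
  ring

lemma abs_scoreWeight_sub_one_le {x : ℝ} (hx : x ≤ L) :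
    |scoreWeight h x - 1| ≤ 4 * (M + 1) * Real.exp x := by
  rw [H.scoreWeight_sub_one hx, abs_mul]
  have h1 : |deriv h x * (1 + h x)⁻¹ + link h x| ≤ M * Real.exp x * 2 + 2 * Real.exp x := by
    refine (abs_add_le _ _).trans (add_le_add ?_ (H.abs_link_le hx))
    rw [abs_mul]
    exact mul_le_mul (H.bound_deriv x hx) (H.abs_inv_one_add_le hx) (abs_nonneg _)
      (mul_nonneg H.nonneg (Real.exp_pos x).le)
  have := H.nonneg
  calc _ ≤ (M * Real.exp x * 2 + 2 * Real.exp x) * 2 :=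
        mul_le_mul h1 (H.abs_inv_one_sub_link_le hx) (abs_nonneg _) (by positivity)
    _ = _ := by ring

lemma abs_scoreWeight_le {x : ℝ} (hx : x ≤ L) : |scoreWeight h x| ≤ 2 := by
  have h0 := H.link_le_quarter hx
  have h0' := H.link_pos hx
  have h1 : |deriv h x * (1 + h x)⁻¹| ≤ 1 / 8 * 2 := by
    rw [abs_mul]
    exact mul_le_mul ((H.bound_deriv x hx).trans (H.mul_exp_le hx)) (H.abs_inv_one_add_le hx)
      (abs_nonneg _) (by norm_num)
  have h2 := abs_le.1 h1
  unfold scoreWeight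
  rw [← div_eq_mul_inv, abs_div, abs_of_pos (by linarith : 0 < 1 - link h x),
    div_le_iff₀ (by linarith), abs_le]
  constructor <;> linarith

/-- This is where the second derivative of h enters. Every term of the derivative contains a factor
h'', h' or q', each of which is O(e^x). -/
lemma hasDerivAt_scoreWeight {x : ℝ} (hx : x ≤ L) :
    ∃ r', HasDerivAt (scoreWeight h) r' x ∧ |r'| ≤ 10 * (M + 1) * Real.exp x := by
  have h1 := H.one_add_pos hx
  have h2 := H.link_le_quarter hx
  have hMn := H.nonneg
  have dA := ((H.diff x).hasDerivAt.const_add 1).inv (by linarith : 1 + h x ≠ 0)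
  have dB := ((H.hasDerivAt_link x).const_sub 1).inv (by linarith : 1 - link h x ≠ 0)
  refine ⟨_, (((H.diff_deriv x).hasDerivAt.mul dA).const_add 1).mul dB, ?_⟩
  set A := (1 + h x)⁻¹
  set B := (1 - link h x)⁻¹
  set E := Real.exp x
  have hE : 0 < E := Real.exp_pos x
  have hA : |A| ≤ 2 := H.abs_inv_one_add_le hx
  have hB : |B| ≤ 2 := H.abs_inv_one_sub_link_le hx
  have hd := H.bound_deriv x hx
  have hdd := H.bound_deriv_deriv x hx
  have hME := H.mul_exp_le hx
  have e1 : -deriv h x / (1 + h x) ^ 2 = -(deriv h x * (A * A)) := by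
    simp only [A]; field_simp
  have e2 : -(-(E * (1 + h x) + E * deriv h x)) / (1 - link h x) ^ 2
      = (E * (1 + h x) + E * deriv h x) * (B * B) := by
    simp only [B]; field_simp
  have hAA : |A * A| ≤ 2 * 2 := by rw [abs_mul]; gcongr
  have hBB : |B * B| ≤ 2 * 2 := by rw [abs_mul]; gcongr
  have t1 : |deriv (deriv h) x * A| ≤ M * E * 2 := by rw [abs_mul]; gcongr
  have t2 : |deriv h x * (-(deriv h x * (A * A)))| ≤ M * E * (1 / 8 * (2 * 2)) := by
    rw [abs_mul, abs_neg, abs_mul]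
    gcongr
    exact hd.trans hME
  have t3 : |1 + deriv h x * A| ≤ 1 + 1 / 8 * 2 := by
    refine (abs_add_le _ _).trans ?_
    rw [abs_one, abs_mul]
    gcongr
    exact hd.trans hME
  have t4 : |E * (1 + h x) + E * deriv h x| ≤ 2 * E := by
    have a1 := abs_le.1 ((H.bound x hx).trans hME)
    have a2 := abs_le.1 (hd.trans hME)
    rw [abs_le]
    constructor <;> nlinarith
  simp only [Pi.mul_apply, Pi.inv_apply]
  change |(deriv (deriv h) x * A + deriv h x * (-deriv h x / (1 + h x) ^ 2)) * B
    + (1 + deriv h x * A) * (-(-(E * (1 + h x) + E * deriv h x)) / (1 - link h x) ^ 2)| ≤ _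
  rw [e1, e2]
  calc _ ≤ (M * E * 2 + M * E * (1 / 8 * (2 * 2))) * 2
        + (1 + 1 / 8 * 2) * (2 * E * (2 * 2)) := by
        refine (abs_add_le _ _).trans (add_le_add ?_ ?_)
        · rw [abs_mul]
          gcongr
          exact (abs_add_le _ _).trans (add_le_add t1 t2)
        · rw [abs_mul, abs_mul]
          gcongr
    _ ≤ _ := by nlinarith [mul_nonneg hMn hE.le]

/-- Mean value theorem; the factor e lost by allowing points up to x + 1 is absorbed by 10 · e ≤ 30.
-/
lemma abs_scoreWeight_sub_le {x y : ℝ} (hx : x ≤ L) (hy : y ≤ L) (hxy : |y - x| ≤ 1) :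
    |scoreWeight h y - scoreWeight h x| ≤ 30 * (M + 1) * Real.exp x * |y - x| := by
  have hMn := H.nonneg
  have := abs_sub_le_of_deriv_bound (f := scoreWeight h) (c := 1) (C := 10 * (M + 1)) zero_le_one
    (by positivity) (fun z hz => by simpa using H.hasDerivAt_scoreWeight hz) hx hy
    (by linarith [(abs_le.1 hxy).2])
  refine this.trans ?_
  gcongr ?_ * _
  rw [one_mul, Real.exp_add]
  have := Real.exp_one_lt_d9
  nlinarith [mul_pos (by linarith : 0 < M + 1) (Real.exp_pos x)]

/-- The product of link and weight is q'/(1 - q), whose leading term is e^x; after subtracting it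
only second-order terms e^(2x) are left in the derivative. -/
lemma hasDerivAt_link_mul_scoreWeight {x : ℝ} (hx : x ≤ L) :
    ∃ f', HasDerivAt (fun z => link h z * scoreWeight h z - Real.exp z) f' x ∧
      |f'| ≤ 30 * (M + 1) * Real.exp (2 * x) := by
  obtain ⟨r', hr, hb⟩ := H.hasDerivAt_scoreWeight hx
  refine ⟨_, ((H.hasDerivAt_link x).mul hr).sub (Real.hasDerivAt_exp x), ?_⟩
  have hMn := H.nonneg
  have hme := H.mul_exp_le hx
  have hd := H.bound_deriv x hx
  have hh := H.bound x hx
  have hr1 := H.abs_scoreWeight_sub_one_le hx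
  have hq := H.abs_link_le hx
  rw [two_mul, Real.exp_add]
  set E := Real.exp x
  have hE : 0 < E := Real.exp_pos x
  have e : (E * (1 + h x) + E * deriv h x) * scoreWeight h x + link h x * r' - E
      = E * (h x + deriv h x) + E * (1 + (h x + deriv h x)) * (scoreWeight h x - 1)
        + link h x * r' := by ring
  have s1 : |h x + deriv h x| ≤ 2 * (M * E) := (abs_add_le _ _).trans (by linarith)
  have s2 : |1 + (h x + deriv h x)| ≤ 2 := by
    refine (abs_add_le _ _).trans ?_
    rw [abs_one]; linarith
  rw [e]
  calc _ ≤ E * (2 * (M * E)) + E * 2 * (4 * (M + 1) * E) + 2 * E * (10 * (M + 1) * E) := by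
        refine (abs_add_le _ _).trans (add_le_add ((abs_add_le _ _).trans (add_le_add ?_ ?_)) ?_)
        · rw [abs_mul, abs_of_pos hE]; gcongr
        · rw [abs_mul, abs_mul, abs_of_pos hE]; gcongr
        · rw [abs_mul]; gcongr
    _ ≤ _ := by nlinarith [mul_nonneg hMn (mul_pos hE hE).le, mul_pos hE hE]

/-- The compensator part of the score has derivative e^x to leading order, which produces the
Hessian density. The error has a quadratic Taylor part from the exponential and a part of relative
size e^x from the remainder; 270 = 30 · 9 with e² < 9. -/
lemma abs_link_mul_scoreWeight_sub_le {x y : ℝ} (hx : x ≤ L) (hy : y ≤ L) (hxy : |y - x| ≤ 1) :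
    |link h y * scoreWeight h y - link h x * scoreWeight h x - Real.exp x * (y - x)|
      ≤ 270 * (M + 1) * Real.exp x * |y - x| * (|y - x| + Real.exp x) := by
  have hMn := H.nonneg
  have h1 := abs_sub_le_of_deriv_bound (f := fun z => link h z * scoreWeight h z - Real.exp z)
    (c := 2) (C := 30 * (M + 1)) (by norm_num)
    (by positivity) (fun z hz => H.hasDerivAt_link_mul_scoreWeight hz) hx hy
    (by linarith [(abs_le.1 hxy).2])
  have h2 := Real.abs_exp_sub_one_sub_id_le hxy
  have h3 : |Real.exp y - Real.exp x - Real.exp x * (y - x)| ≤ Real.exp x * |y - x| ^ 2 := by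
    have : Real.exp y - Real.exp x - Real.exp x * (y - x)
        = Real.exp x * (Real.exp (y - x) - 1 - (y - x)) := by
      rw [Real.exp_sub]; field_simp
    rw [this, abs_mul, Real.abs_exp, sq_abs]
    gcongr
  have h4 : Real.exp (2 * x + 2) ≤ 9 * (Real.exp x * Real.exp x) := by
    have : Real.exp (2 * x + 2) = (Real.exp 1 * Real.exp 1) * (Real.exp x * Real.exp x) := by
      simp only [← Real.exp_add]; ring_nf
    rw [this]
    gcongr
    nlinarith [Real.exp_one_lt_d9, Real.exp_pos 1]
  have e : link h y * scoreWeight h y - link h x * scoreWeight h x - Real.exp x * (y - x)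
      = (link h y * scoreWeight h y - Real.exp y - (link h x * scoreWeight h x - Real.exp x))
        + (Real.exp y - Real.exp x - Real.exp x * (y - x)) := by ring
  rw [e]
  calc _ ≤ 30 * (M + 1) * (9 * (Real.exp x * Real.exp x)) * |y - x|
        + Real.exp x * |y - x| ^ 2 :=
        (abs_add_le _ _).trans (add_le_add (h1.trans (by gcongr)) h3)
    _ ≤ _ := by
        have : 0 ≤ Real.exp x * |y - x| ^ 2 := by positivity
        nlinarith [mul_nonneg hMn this]

/-- The conditional variance of a score term and the Hessian share the leading density e^x. This
information identity is why the limit is the inverse information matrix itself. -/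
lemma abs_variance_weight_sub_le {x : ℝ} (hx : x ≤ L) :
    |scoreWeight h x ^ 2 * (link h x * (1 - link h x)) - Real.exp x|
      ≤ 45 * (M + 1) * Real.exp x ^ 2 := by
  have hMn := H.nonneg
  have hh := H.bound x hx
  have hr1 := H.abs_scoreWeight_sub_one_le hx
  have hr := H.abs_scoreWeight_le hx
  have hq := H.abs_link_le hx
  have hq0 := H.link_pos hx
  have e : scoreWeight h x ^ 2 * (link h x * (1 - link h x)) - Real.exp x
      = Real.exp x * h x + link h x * ((scoreWeight h x - 1) * (scoreWeight h x + 1)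
        - scoreWeight h x ^ 2 * link h x) := by
    unfold link; ring
  set E := Real.exp x
  have hE : 0 < E := Real.exp_pos x
  have s1 : |scoreWeight h x + 1| ≤ 3 := (abs_add_le _ _).trans (by rw [abs_one]; linarith)
  rw [e]
  calc _ ≤ E * (M * E) + 2 * E * (4 * (M + 1) * E * 3 + 2 ^ 2 * (2 * E)) := by
        refine (abs_add_le _ _).trans (add_le_add ?_ ?_)
        · rw [abs_mul, abs_of_pos hE]; gcongr
        · rw [abs_mul]
          gcongr
          refine (abs_sub _ _).trans (add_le_add ?_ ?_)
          · rw [abs_mul]; gcongr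
          · rw [abs_mul, abs_pow]; gcongr
    _ ≤ _ := by nlinarith [mul_nonneg hMn (mul_pos hE hE).le, mul_pos hE hE]

/-- The derivative of the likelihood of one observation. -/
lemma hasDerivAt_bernoulli {x D : ℝ} (hx : x ≤ L) (hD : D = 0 ∨ D = 1) :
    0 < link h x ^ D * (1 - link h x) ^ (1 - D) ∧
    HasDerivAt (fun y => link h y ^ D * (1 - link h y) ^ (1 - D))
      ((D - link h x) * scoreWeight h x * (link h x ^ D * (1 - link h x) ^ (1 - D))) x := by
  have h1 := H.one_add_pos hx
  have h2 := H.link_le_quarter hx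
  have h3 := H.link_pos hx
  have hne : 1 - link h x ≠ 0 := by linarith
  have hne' : 1 + h x ≠ 0 := by linarith
  have hq : link h x * (1 + deriv h x * (1 + h x)⁻¹)
      = Real.exp x * (1 + h x) + Real.exp x * deriv h x := by
    unfold link; field_simp
  rcases hD with rfl | rfl
  · simp only [Real.rpow_zero, sub_zero, Real.rpow_one, one_mul, zero_sub]
    refine ⟨by linarith, ?_⟩
    convert! (H.hasDerivAt_link x).const_sub 1 using 1
    rw [← hq]
    unfold scoreWeight
    field_simp
  · simp only [Real.rpow_zero, sub_self, Real.rpow_one, mul_one]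
    refine ⟨h3, ?_⟩
    convert! H.hasDerivAt_link x using 1
    rw [← hq]
    unfold scoreWeight
    field_simp

end TailBound

/-! ### The score equation -/

/-- Logarithmic differentiation of a finite product. -/
lemma hasDerivAt_prod_of_logDeriv {ι : Type*} (s : Finset ι) {F : ι → ℝ → ℝ} {l : ι → ℝ} {x : ℝ}
    (hF : ∀ j ∈ s, 0 < F j x ∧ HasDerivAt (F j) (l j * F j x) x) :
    0 < ∏ j ∈ s, F j x ∧
    HasDerivAt (fun y => ∏ j ∈ s, F j y) ((∑ j ∈ s, l j) * ∏ j ∈ s, F j x) x := by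
  classical
  induction s using Finset.induction_on with
  | empty => simpa using hasDerivAt_const x (1 : ℝ)
  | insert a s ha ih =>
    obtain ⟨p, d⟩ := ih fun j hj => hF j (Finset.mem_insert_of_mem hj)
    obtain ⟨p', d'⟩ := hF a (Finset.mem_insert_self a s)
    simp only [Finset.prod_insert ha, Finset.sum_insert ha]
    refine ⟨mul_pos p' p, ?_⟩
    convert! d'.mul d using 1
    ring

/-- First-order condition for a maximiser of the likelihood. -/
lemma TailBound.score_eq_zero {h : ℝ → ℝ} {M L : ℝ} (H : TailBound h M L) {Ω : Type*}
    {m d₁ d₂ T : ℕ} {V : Fin m → ℕ → Ω → Cov d₁ d₂} {D : Fin m → ℕ → Ω → ℝ}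
    (hD : ∀ i t ω, D i t ω = 0 ∨ D i t ω = 1) {a : ℝ} {ω : Ω} {b : Cov d₁ d₂}
    (hmax : ∀ b', likelihood T h V D b' a ω ≤ likelihood T h V D b a ω)
    (hb : ∀ i, ∀ t ∈ Finset.range (lastTime T D i ω + 1), inner ℝ b (V i t ω) - a ≤ L)
    (e : Cov d₁ d₂) :
    ∑ i, ∑ t ∈ Finset.range (lastTime T D i ω + 1),
      (D i (t + 1) ω - link h (inner ℝ b (V i t ω) - a))
        * scoreWeight h (inner ℝ b (V i t ω) - a) * inner ℝ e (V i t ω) = 0 := by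
  set G : Fin m → ℕ → ℝ → ℝ := fun i t s =>
    link h (inner ℝ (b + s • e) (V i t ω) - a) ^ D i (t + 1) ω
      * (1 - link h (inner ℝ (b + s • e) (V i t ω) - a)) ^ (1 - D i (t + 1) ω) with hG
  have hin : ∀ i t (s : ℝ), inner ℝ (b + s • e) (V i t ω) - a
      = inner ℝ b (V i t ω) - a + s * inner ℝ e (V i t ω) := by
    intro i t s; rw [inner_add_left, real_inner_smul_left]; ring
  have hone : ∀ i, ∀ t ∈ Finset.range (lastTime T D i ω + 1), 0 < G i t 0 ∧
      HasDerivAt (G i t) ((D i (t + 1) ω - link h (inner ℝ b (V i t ω) - a))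
        * scoreWeight h (inner ℝ b (V i t ω) - a) * inner ℝ e (V i t ω) * G i t 0) 0 := by
    intro i t ht
    obtain ⟨p, d⟩ := H.hasDerivAt_bernoulli (hb i t ht) (hD i (t + 1) ω)
    simp only [hG, hin, zero_mul, add_zero]
    refine ⟨p, ?_⟩
    have hlin : HasDerivAt (fun s : ℝ => inner ℝ b (V i t ω) - a + s * inner ℝ e (V i t ω))
        (inner ℝ e (V i t ω)) 0 := by
      simpa using ((hasDerivAt_id (0 : ℝ)).mul_const (inner ℝ e (V i t ω))).const_add
        (inner ℝ b (V i t ω) - a)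
    have d0 := d
    rw [show inner ℝ b (V i t ω) - a = inner ℝ b (V i t ω) - a + 0 * inner ℝ e (V i t ω) by
      ring] at d0
    have := HasDerivAt.comp (0 : ℝ) d0 hlin
    convert! this using 1
    simp only [zero_mul, add_zero]
    ring
  have htot := hasDerivAt_prod_of_logDeriv Finset.univ
    (F := fun i s => ∏ t ∈ Finset.range (lastTime T D i ω + 1), G i t s)
    fun i _ => hasDerivAt_prod_of_logDeriv _ (hone i)
  -- Restricted to the line through b in direction e, the likelihood is maximal at 0; being positive
  -- there, its logarithmic derivative vanishes.
  have hloc : IsLocalMax (fun s => ∏ i, ∏ t ∈ Finset.range (lastTime T D i ω + 1), G i t s) 0 := by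
    refine Eventually.of_forall fun s => ?_
    have := hmax (b + s • e)
    simpa [likelihood, hG, defaultProb] using this
  have := hloc.hasDerivAt_eq_zero htot.2
  rcases mul_eq_zero.1 this with h0 | h0
  · exact h0
  · exact absurd h0 htot.1.ne'

/-! ### Defaults revealed one firm at a time -/

section DefaultProcess

variable {Ω : Type*} {m d₁ d₂ T : ℕ}

lemma lastTime_mem {D : Fin m → ℕ → Ω → ℝ} (i : Fin m) (ω : Ω) :
    D i (lastTime T D i ω + 1) ω = 1 ∨ lastTime T D i ω = T - 1 :=
  Nat.sInf_mem (s := {t : ℕ | D i (t + 1) ω = 1 ∨ t = T - 1}) ⟨T - 1, Or.inr rfl⟩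

lemma lastTime_le {D : Fin m → ℕ → Ω → ℝ} (i : Fin m) (ω : Ω) : lastTime T D i ω ≤ T - 1 :=
  Nat.sInf_le (Or.inr rfl)

/-- For t ≤ T - 1 the artificial end point T - 1 in the infimum never decides the comparison, so
only earlier defaults matter. -/
lemma le_lastTime_iff {D : Fin m → ℕ → Ω → ℝ} {i : Fin m} {ω : Ω} {t : ℕ} (ht : t < T) :
    t ≤ lastTime T D i ω ↔ ∀ s < t, D i (s + 1) ω ≠ 1 := by
  constructor
  · intro h s hs hD
    have : lastTime T D i ω ≤ s := Nat.sInf_le (Or.inl hD)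
    omega
  · intro h
    by_contra! hlt
    rcases lastTime_mem (T := T) (D := D) i ω with h1 | h1
    · exact h _ hlt h1
    · omega

lemma range_lastTime_subset (hT : 0 < T) {D : Fin m → ℕ → Ω → ℝ} (i : Fin m) (ω : Ω) :
    Finset.range (lastTime T D i ω + 1) ⊆ Finset.range T := by
  have := lastTime_le (T := T) (D := D) i ω
  intro t ht
  simp only [Finset.mem_range] at *
  omega

/-- The history up to `t` together with the defaults of the firms in `J` between `t` and `t + 1`. -/
@[reducible] def blockHistory (V : Fin m → ℕ → Ω → Cov d₁ d₂) (D : Fin m → ℕ → Ω → ℝ) (t : ℕ)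
    (J : Finset (Fin m)) : MeasurableSpace Ω :=
  MeasurableSpace.generateFrom {s | ∃ A, MeasurableSet[history V D t] A ∧ ∃ J' ⊆ J,
    s = A ∩ {ω | ∀ j ∈ J', D j (t + 1) ω = 1}}

variable {V : Fin m → ℕ → Ω → Cov d₁ d₂} {D : Fin m → ℕ → Ω → ℝ}

/-- Intersections correspond to unions of the sets of defaulting firms. The generators are exactly
the events on which the product formula for conditional defaults can be tested. -/
lemma isPiSystem_blockHistory (t : ℕ) (J : Finset (Fin m)) :
    IsPiSystem {s | ∃ A, MeasurableSet[history V D t] A ∧ ∃ J' ⊆ J,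
      s = A ∩ {ω | ∀ j ∈ J', D j (t + 1) ω = 1}} := by
  classical
  rintro _ ⟨A, hA, J₁, h₁, rfl⟩ _ ⟨B, hB, J₂, h₂, rfl⟩ _
  refine ⟨A ∩ B, MeasurableSet.inter hA hB, J₁ ∪ J₂, Finset.union_subset h₁ h₂, ?_⟩
  ext ω
  simp only [Set.mem_inter_iff, Set.mem_ofPred_eq, Finset.mem_union]
  constructor
  · rintro ⟨⟨a, b⟩, c, d⟩
    exact ⟨⟨a, c⟩, fun j hj => hj.elim (b j) (d j)⟩
  · rintro ⟨⟨a, c⟩, b⟩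
    exact ⟨⟨a, fun j hj => b j (Or.inl hj)⟩, c, fun j hj => b j (Or.inr hj)⟩

lemma measurable_history_cov {t s : ℕ} (hs : s ≤ t) (i : Fin m) :
    Measurable[history V D t] (V i s) := by
  refine Measurable.mono (comap_measurable (V i s)) ?_ le_rfl
  exact le_sup_of_le_left <| le_iSup_of_le i <| le_iSup₂_of_le s (by simpa using hs) le_rfl

lemma measurable_history_default {t s : ℕ} (h1 : 1 ≤ s) (hs : s ≤ t) (i : Fin m) :
    Measurable[history V D t] (D i s) := by
  refine Measurable.mono (comap_measurable (D i s)) ?_ le_rfl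
  exact le_sup_of_le_right <| le_iSup_of_le i <| le_iSup₂_of_le s
    (by simpa using ⟨h1, hs⟩) le_rfl

lemma history_mono {s t : ℕ} (hst : s ≤ t) : history V D s ≤ history V D t := by
  refine sup_le (iSup_le fun i => iSup₂_le fun r hr => ?_) (iSup_le fun i => iSup₂_le fun r hr => ?_)
  · exact Measurable.comap_le (measurable_history_cov ((Finset.mem_Icc.1 hr).2.trans hst) i)
  · exact Measurable.comap_le (measurable_history_default (Finset.mem_Icc.1 hr).1
      ((Finset.mem_Icc.1 hr).2.trans hst) i)

lemma history_le [mΩ : MeasurableSpace Ω] (hV : ∀ i t, Measurable (V i t))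
    (hD : ∀ i t, Measurable (D i t)) (t : ℕ) : history V D t ≤ mΩ :=
  sup_le (iSup_le fun i => iSup₂_le fun r _ => (hV i r).comap_le)
    (iSup_le fun i => iSup₂_le fun r _ => (hD i r).comap_le)

lemma measurableSet_history_survive {t : ℕ} (ht : t < T) (i : Fin m) :
    MeasurableSet[history V D t] {ω | t ≤ lastTime T D i ω} := by
  have : {ω | t ≤ lastTime T D i ω} = ⋂ s ∈ Finset.range t, {ω | D i (s + 1) ω ≠ 1} := by
    ext ω; simp [le_lastTime_iff ht]
  rw [this]
  refine Finset.measurableSet_biInter _ fun s hs => ?_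
  have := measurable_history_default (V := V) (D := D) (t := t) (s := s + 1) (by omega)
    (by simpa using hs) i
  exact this (measurableSet_singleton (1 : ℝ)).compl

lemma history_le_blockHistory (t : ℕ) (J : Finset (Fin m)) :
    history V D t ≤ blockHistory V D t J := fun A hA =>
  MeasurableSpace.measurableSet_generateFrom ⟨A, hA, ∅, by simp, by simp⟩

lemma blockHistory_le (t : ℕ) (J : Finset (Fin m)) :
    blockHistory V D t J ≤ history V D (t + 1) := by
  refine MeasurableSpace.generateFrom_le ?_
  rintro _ ⟨A, hA, J₁, -, rfl⟩
  refine MeasurableSet.inter (history_mono (Nat.le_succ t) _ hA) ?_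
  have : {ω | ∀ j ∈ J₁, D j (t + 1) ω = 1} = ⋂ j ∈ J₁, {ω | D j (t + 1) ω = 1} := by ext; simp
  rw [this]
  refine Finset.measurableSet_biInter _ fun j _ => ?_
  exact measurable_history_default (V := V) (by omega) le_rfl j (measurableSet_singleton (1 : ℝ))

lemma measurable_blockHistory_default (h01 : ∀ i t ω, D i t ω = 0 ∨ D i t ω = 1) (t : ℕ)
    {J : Finset (Fin m)} {j : Fin m} (hj : j ∈ J) :
    Measurable[blockHistory V D t J] (D j (t + 1)) := by
  classical
  have hs : MeasurableSet[blockHistory V D t J] {ω | D j (t + 1) ω = 1} :=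
    MeasurableSpace.measurableSet_generateFrom
      ⟨Set.univ, MeasurableSet.univ, {j}, by simpa using hj, by ext; simp⟩
  have : D j (t + 1) = Set.indicator {ω | D j (t + 1) ω = 1} (fun _ => (1 : ℝ)) := by
    ext ω
    by_cases h : D j (t + 1) ω = 1
    · simp [Set.indicator, h]
    · simp only [Set.indicator, Set.mem_ofPred_eq, h, if_false]
      exact (h01 j (t + 1) ω).resolve_right h
  rw [this]
  exact Measurable.indicator (m := blockHistory V D t J) measurable_const hs

lemma prod_default_eq_indicator (h01 : ∀ i t ω, D i t ω = 0 ∨ D i t ω = 1) (t : ℕ)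
    (J : Finset (Fin m)) (ω : Ω) :
    ∏ j ∈ J, D j (t + 1) ω
      = Set.indicator {ω | ∀ j ∈ J, D j (t + 1) ω = 1} (fun _ => (1 : ℝ)) ω := by
  by_cases h : ∀ j ∈ J, D j (t + 1) ω = 1
  · rw [Set.indicator_of_mem (by exact h), Finset.prod_eq_one h]
  · rw [Set.indicator_of_notMem (by exact h)]
    push Not at h
    obtain ⟨j, hj, hne⟩ := h
    exact Finset.prod_eq_zero hj ((h01 j (t + 1) ω).resolve_right hne)

variable [mΩ : MeasurableSpace Ω] {P : Measure Ω} [IsProbabilityMeasure P] {p : Cov d₁ d₂ → ℝ}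

/-- Conditional default probability of firm `i`: `p(V_{i,t})` on survival, zero otherwise. -/
def hazard (T : ℕ) (p : Cov d₁ d₂ → ℝ) (V : Fin m → ℕ → Ω → Cov d₁ d₂) (D : Fin m → ℕ → Ω → ℝ)
    (i : Fin m) (t : ℕ) (ω : Ω) : ℝ :=
  Set.indicator {ω | t ≤ lastTime T D i ω} (fun ω => p (V i t ω)) ω

omit mΩ in
lemma measurable_hazard (hp : Measurable p) {t : ℕ} (ht : t < T) (i : Fin m) :
    Measurable[history V D t] (hazard T p V D i t) :=
  Measurable.indicator (m := history V D t)
    (hp.comp (measurable_history_cov le_rfl i)) (measurableSet_history_survive ht i)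

namespace IsDefaultProcess

omit [IsProbabilityMeasure P] in
lemma abs_le_one (hD : IsDefaultProcess P T p V D) (i : Fin m) (t : ℕ) (ω : Ω) :
    |D i t ω| ≤ 1 := by
  rcases hD.zero_or_one i t ω with h | h <;> simp [h]

lemma integrable (hD : IsDefaultProcess P T p V D) (i : Fin m) (t : ℕ) :
    Integrable (D i t) P :=
  Integrable.of_bound (hD.measurable i t).aestronglyMeasurable 1
    (ae_of_all _ fun ω => hD.abs_le_one i t ω)

omit [IsProbabilityMeasure P] in
lemma condExp_history (hD : IsDefaultProcess P T p V D) {t : ℕ} (ht : t < T) (i : Fin m) :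
    P[D i (t + 1) | history V D t] =ᵐ[P] hazard T p V D i t := by
  have := hD.cond_prob t ht {i}
  simp only [Finset.prod_singleton] at this
  exact this

omit [IsProbabilityMeasure P] in
lemma integrable_hazard (hD : IsDefaultProcess P T p V D) {t : ℕ} (ht : t < T) (i : Fin m) :
    Integrable (hazard T p V D i t) P :=
  integrable_condExp.congr (hD.condExp_history ht i)

variable (hV : ∀ i t, Measurable (V i t)) (hp : Measurable p)
include hV hp

/-- Conditional independence in sequential form: knowing which other firms default in the same
period does not change the hazard of firm i. It suffices to compare integrals over the generating
π-system, where the product formula is used for J' and for J' together with i; Dynkin's theorem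
extends the equality. -/
lemma condExp_blockHistory (hD : IsDefaultProcess P T p V D) {t : ℕ} (ht : t < T)
    {J : Finset (Fin m)} {i : Fin m} (hi : i ∉ J) :
    P[D i (t + 1) | blockHistory V D t J] =ᵐ[P] hazard T p V D i t := by
  classical
  have hF := history_le hV hD.measurable t
  have hB : blockHistory V D t J ≤ mΩ :=
    (blockHistory_le t J).trans (history_le hV hD.measurable (t + 1))
  have hgi := hD.integrable_hazard ht i
  have hDi := hD.integrable i (t + 1)
  have hgm := measurable_hazard (V := V) (D := D) hp ht i
  have basic : ∀ s, (∃ A, MeasurableSet[history V D t] A ∧ ∃ J' ⊆ J,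
      s = A ∩ {ω | ∀ j ∈ J', D j (t + 1) ω = 1}) →
      ∫ ω in s, hazard T p V D i t ω ∂P = ∫ ω in s, D i (t + 1) ω ∂P := by
    rintro _ ⟨A, hA, J', hJ', rfl⟩
    have hiJ : i ∉ J' := fun h => hi (hJ' h)
    have hms : MeasurableSet {ω | ∀ j ∈ J', D j (t + 1) ω = 1} := by
      have : {ω | ∀ j ∈ J', D j (t + 1) ω = 1} = ⋂ j ∈ J', {ω | D j (t + 1) ω = 1} := by
        ext; simp
      rw [this]
      exact Finset.measurableSet_biInter _ fun j _ =>
        hD.measurable j _ (measurableSet_singleton (1 : ℝ))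
    have red : ∀ f : Ω → ℝ, ∫ ω in A ∩ {ω | ∀ j ∈ J', D j (t + 1) ω = 1}, f ω ∂P
        = ∫ ω in A, (∏ j ∈ J', D j (t + 1) ω) * f ω ∂P := by
      intro f
      rw [Set.inter_comm, ← Measure.restrict_restrict hms, ← integral_indicator hms]
      refine integral_congr_ae (ae_of_all _ fun ω => ?_)
      simp only [prod_default_eq_indicator hD.zero_or_one]
      by_cases h : ω ∈ {ω | ∀ j ∈ J', D j (t + 1) ω = 1}
      · simp only [Set.indicator_of_mem h, one_mul]
      · simp only [Set.indicator_of_notMem h, zero_mul]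
    have hprodm : ∀ I : Finset (Fin m), Measurable fun ω => ∏ j ∈ I, D j (t + 1) ω := fun I =>
      Finset.measurable_prod _ fun j _ => hD.measurable j _
    have hprodb : ∀ (I : Finset (Fin m)) ω, ‖∏ j ∈ I, D j (t + 1) ω‖ ≤ 1 := by
      intro I ω
      rw [prod_default_eq_indicator hD.zero_or_one]
      by_cases h : ω ∈ {ω | ∀ j ∈ I, D j (t + 1) ω = 1}
      · simp only [Set.indicator_of_mem h]; simp
      · simp only [Set.indicator_of_notMem h]; simp
    have hprodi : ∀ I : Finset (Fin m), Integrable (fun ω => ∏ j ∈ I, D j (t + 1) ω) P :=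
      fun I => Integrable.of_bound (hprodm I).aestronglyMeasurable 1 (ae_of_all _ (hprodb I))
    have hfg : Integrable ((fun ω => ∏ j ∈ J', D j (t + 1) ω) * hazard T p V D i t) P :=
      hgi.bdd_mul (hprodm J').aestronglyMeasurable (ae_of_all _ (hprodb J'))
    have e1 := condExp_mul_of_stronglyMeasurable_right (m := history V D t) (μ := P)
      hgm.stronglyMeasurable hfg (hprodi J')
    have c1 := hD.cond_prob t ht J'
    have c2 := hD.cond_prob t ht (insert i J')
    rw [red, red]
    -- The hazard of firm i is known at time t and comes out of the conditional expectation; the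
    -- product formula for J' does the rest.
    have i1 : ∫ ω in A, (∏ j ∈ J', D j (t + 1) ω) * hazard T p V D i t ω ∂P
        = ∫ ω in A, (∏ j ∈ J', hazard T p V D j t ω) * hazard T p V D i t ω ∂P := by
      refine (setIntegral_condExp hF hfg hA).symm.trans ?_
      refine integral_congr_ae (ae_restrict_of_ae ?_)
      filter_upwards [e1, c1] with ω h1 h2
      rw [h1, Pi.mul_apply, h2]
      rfl
    -- Here the product formula is applied to J' enlarged by i, which gives the same right-hand side
    -- because i is not in J'.
    have i2 : ∫ ω in A, (∏ j ∈ J', D j (t + 1) ω) * D i (t + 1) ω ∂P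
        = ∫ ω in A, (∏ j ∈ J', hazard T p V D j t ω) * hazard T p V D i t ω ∂P := by
      have : ∀ ω, (∏ j ∈ J', D j (t + 1) ω) * D i (t + 1) ω
          = ∏ j ∈ insert i J', D j (t + 1) ω := by
        intro ω; rw [Finset.prod_insert hiJ, mul_comm]
      simp_rw [this]
      rw [← setIntegral_condExp hF (hprodi _) hA]
      refine integral_congr_ae (ae_restrict_of_ae ?_)
      filter_upwards [c2] with ω h2
      rw [h2, Finset.prod_insert hiJ, mul_comm]
      rfl
    rw [i1, i2]
  -- Equality of the total integrals is what makes the class of good sets closed under complements.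
  have htot := basic Set.univ ⟨Set.univ, MeasurableSet.univ, ∅, by simp, by simp⟩
  rw [setIntegral_univ, setIntegral_univ] at htot
  refine (ae_eq_condExp_of_forall_setIntegral_eq hB hDi (fun s _ _ => hgi.integrableOn)
    (fun s hs _ => ?_)
    ((measurable_hazard hp ht i).mono (history_le_blockHistory t J)
      le_rfl).stronglyMeasurable.aestronglyMeasurable).symm
  refine MeasurableSpace.induction_on_inter (m := blockHistory V D t J)
    (C := fun s _ => ∫ ω in s, hazard T p V D i t ω ∂P = ∫ ω in s, D i (t + 1) ω ∂P) rfl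
    (isPiSystem_blockHistory t J) (by simp) (fun s hs => basic s hs) ?_ ?_ s hs
  · intro s hs ih
    rw [setIntegral_compl (hB _ hs) hgi, setIntegral_compl (hB _ hs) hDi, htot, ih]
  · intro f hdis hf ih
    rw [integral_iUnion (fun n => hB _ (hf n)) hdis hgi.integrableOn,
      integral_iUnion (fun n => hB _ (hf n)) hdis hDi.integrableOn]
    exact tsum_congr ih

lemma integral_mul_default (hD : IsDefaultProcess P T p V D) {t : ℕ} (ht : t < T)
    {J : Finset (Fin m)} {i : Fin m} (hi : i ∉ J) {W : Ω → ℝ} {K : ℝ}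
    (hW : Measurable[blockHistory V D t J] W) (hK : ∀ ω, |W ω| ≤ K) :
    ∫ ω, W ω * D i (t + 1) ω ∂P = ∫ ω, W ω * hazard T p V D i t ω ∂P := by
  have hB : blockHistory V D t J ≤ mΩ :=
    (blockHistory_le t J).trans (history_le hV hD.measurable (t + 1))
  have hWD : Integrable (W * D i (t + 1)) P :=
    (hD.integrable i (t + 1)).bdd_mul (hW.mono hB le_rfl).aestronglyMeasurable
      (ae_of_all _ hK)
  have e := condExp_mul_of_stronglyMeasurable_left (m := blockHistory V D t J) (μ := P)
    hW.stronglyMeasurable hWD (hD.integrable i (t + 1))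
  change ∫ ω, (W * D i (t + 1)) ω ∂P = _
  rw [← integral_condExp hB]
  refine integral_congr_ae ?_
  filter_upwards [e, hD.condExp_blockHistory hV hp ht hi] with ω h1 h2
  rw [h1, Pi.mul_apply, h2]

end IsDefaultProcess
end DefaultProcess

/-! ### Second and fourth moments of sums of compensated indicators -/

section ScoreMoments

variable {Ω : Type*} {m d₁ d₂ T : ℕ} {V : Fin m → ℕ → Ω → Cov d₁ d₂} {D : Fin m → ℕ → Ω → ℝ}

/-- The indicator of `{t ≤ τ_i}`. -/
def alive (T : ℕ) (D : Fin m → ℕ → Ω → ℝ) (i : Fin m) (t : ℕ) (ω : Ω) : ℝ :=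
  Set.indicator {ω | t ≤ lastTime T D i ω} (fun _ => 1) ω

lemma alive_eq_zero_or_one (i : Fin m) (t : ℕ) (ω : Ω) : alive T D i t ω = 0 ∨ alive T D i t ω = 1 := by
  unfold alive
  by_cases h : ω ∈ {ω | t ≤ lastTime T D i ω}
  · right; simp only [Set.indicator_of_mem h]
  · left; simp only [Set.indicator_of_notMem h]

lemma alive_nonneg (i : Fin m) (t : ℕ) (ω : Ω) : 0 ≤ alive T D i t ω := by
  rcases alive_eq_zero_or_one (T := T) (D := D) i t ω with h | h <;> simp [h]

lemma alive_le_one (i : Fin m) (t : ℕ) (ω : Ω) : alive T D i t ω ≤ 1 := by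
  rcases alive_eq_zero_or_one (T := T) (D := D) i t ω with h | h <;> simp [h]

lemma hazard_eq (p : Cov d₁ d₂ → ℝ) (i : Fin m) (t : ℕ) (ω : Ω) :
    hazard T p V D i t ω = alive T D i t ω * p (V i t ω) := by
  unfold hazard alive
  by_cases h : ω ∈ {ω | t ≤ lastTime T D i ω}
  · simp only [Set.indicator_of_mem h, one_mul]
  · simp only [Set.indicator_of_notMem h, zero_mul]

lemma measurable_history_alive {t : ℕ} (ht : t < T) (i : Fin m) :
    Measurable[history V D t] (alive T D i t) :=
  Measurable.indicator (m := history V D t) measurable_const (measurableSet_history_survive ht i)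

/-- A weighted, compensated default indicator. -/
def scoreIncr (T : ℕ) (w p : Cov d₁ d₂ → ℝ) (V : Fin m → ℕ → Ω → Cov d₁ d₂)
    (D : Fin m → ℕ → Ω → ℝ) (i : Fin m) (t : ℕ) (ω : Ω) : ℝ :=
  alive T D i t ω * w (V i t ω) * (D i (t + 1) ω - p (V i t ω))

/-- The sum of the weighted, compensated default indicators over all firms and `n` periods. -/
def scoreSum (T : ℕ) (w p : Cov d₁ d₂ → ℝ) (V : Fin m → ℕ → Ω → Cov d₁ d₂)
    (D : Fin m → ℕ → Ω → ℝ) (n : ℕ) (ω : Ω) : ℝ :=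
  ∑ t ∈ Finset.range n, ∑ i, scoreIncr T w p V D i t ω

/-- The conditional variance function of a weighted default indicator. -/
def varWeight (w p : Cov d₁ d₂ → ℝ) (v : Cov d₁ d₂) : ℝ := w v ^ 2 * (p v * (1 - p v))

variable {w p : Cov d₁ d₂ → ℝ}

/-- The function p is required to be a probability only where w does not vanish: the weights used
later are truncated to a region where the link is known to lie in [0, 1]. -/
lemma varWeight_nonneg (hwp : ∀ v, w v ≠ 0 → 0 ≤ p v ∧ p v ≤ 1) (v : Cov d₁ d₂) :
    0 ≤ varWeight w p v := by
  unfold varWeight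
  by_cases h : w v = 0
  · simp [h]
  · have := hwp v h
    have h1 : 0 ≤ 1 - p v := by linarith
    have h2 := this.1
    positivity

lemma varWeight_le_one (hw : ∀ v, |w v| ≤ 1) (hwp : ∀ v, w v ≠ 0 → 0 ≤ p v ∧ p v ≤ 1)
    (v : Cov d₁ d₂) : varWeight w p v ≤ 1 := by
  unfold varWeight
  by_cases h : w v = 0
  · simp [h]
  · have := hwp v h
    have h1 : w v ^ 2 ≤ 1 := (sq_le_one_iff_abs_le_one _).2 (hw v)
    have h2 : p v * (1 - p v) ≤ 1 := by nlinarith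
    have h3 : 0 ≤ p v * (1 - p v) := mul_nonneg this.1 (by linarith)
    nlinarith [sq_nonneg (w v)]

lemma abs_scoreIncr_le (h01 : ∀ i t ω, D i t ω = 0 ∨ D i t ω = 1) (hw : ∀ v, |w v| ≤ 1)
    (hwp : ∀ v, w v ≠ 0 → 0 ≤ p v ∧ p v ≤ 1) (i : Fin m) (t : ℕ) (ω : Ω) :
    |scoreIncr T w p V D i t ω| ≤ 1 := by
  unfold scoreIncr
  by_cases h : w (V i t ω) = 0
  · simp [h]
  · obtain ⟨h0, h1⟩ := hwp _ h
    have e : |D i (t + 1) ω - p (V i t ω)| ≤ 1 := by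
      rw [abs_le]
      rcases h01 i (t + 1) ω with hd | hd <;> rw [hd] <;> constructor <;> linarith
    have a : |alive T D i t ω| ≤ 1 := by
      rw [abs_of_nonneg (alive_nonneg i t ω)]; exact alive_le_one i t ω
    rw [abs_mul, abs_mul]
    have := mul_le_one₀ a (abs_nonneg _) (hw (V i t ω))
    exact mul_le_one₀ this (abs_nonneg _) e

variable [mΩ : MeasurableSpace Ω] {P : Measure Ω} [IsProbabilityMeasure P]

/-- A bounded measurable function on a probability space is integrable. -/
lemma integrable_of_measurable_bounded {f : Ω → ℝ} (hf : Measurable f) {K : ℝ}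
    (hK : ∀ ω, |f ω| ≤ K) : Integrable f P :=
  Integrable.of_bound hf.aestronglyMeasurable K (ae_of_all _ hK)

namespace IsDefaultProcess

variable (hV : ∀ i t, Measurable (V i t)) (hp : Measurable p) (hw : Measurable w)

section

variable {J : Finset (Fin m)} {t : ℕ}

omit [IsProbabilityMeasure P] in
include hp hw in
lemma measurable_block_scoreIncr (hD : IsDefaultProcess P T p V D) (ht : t < T) {i : Fin m}
    (hi : i ∈ J) : Measurable[blockHistory V D t J] (scoreIncr T w p V D i t) := by
  have hF := history_le_blockHistory (V := V) (D := D) t J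
  have h1 := (measurable_history_alive (V := V) (D := D) ht i).mono hF le_rfl
  have h2 := (measurable_history_cov (V := V) (D := D) (le_refl t) i).mono hF le_rfl
  have h3 := measurable_blockHistory_default (V := V) hD.zero_or_one t hi
  exact Measurable.mul (h1.mul (hw.comp h2)) (h3.sub (hp.comp h2))

variable (hw1 : ∀ v, |w v| ≤ 1) (hwp : ∀ v, w v ≠ 0 → 0 ≤ p v ∧ p v ≤ 1)
include hV hp hw hw1 hwp

/-- The martingale difference property in weak form: tested against anything known from the history
and the firms in J, an increment of another firm has mean zero and its square may be replaced by the
conditional variance. -/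
lemma integral_mul_scoreIncr (hD : IsDefaultProcess P T p V D) (ht : t < T) {i : Fin m}
    (hi : i ∉ J) {W : Ω → ℝ} {K : ℝ} (hW : Measurable[blockHistory V D t J] W)
    (hK : ∀ ω, |W ω| ≤ K) :
    ∫ ω, W ω * scoreIncr T w p V D i t ω ∂P = 0 ∧
    ∫ ω, W ω * scoreIncr T w p V D i t ω ^ 2 ∂P
      = ∫ ω, W ω * (alive T D i t ω * varWeight w p (V i t ω)) ∂P := by
  have hB : blockHistory V D t J ≤ mΩ :=
    (blockHistory_le t J).trans (history_le hV hD.measurable (t + 1))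
  have hF := history_le_blockHistory (V := V) (D := D) t J
  have h1 := (measurable_history_alive (V := V) (D := D) ht i).mono hF le_rfl
  have h2 := (measurable_history_cov (V := V) (D := D) (le_refl t) i).mono hF le_rfl
  set A : Ω → ℝ := fun ω => alive T D i t ω * w (V i t ω) with hA
  have hAm : Measurable[blockHistory V D t J] A := h1.mul (hw.comp h2)
  have hpm : Measurable[blockHistory V D t J] fun ω => p (V i t ω) := hp.comp h2
  have hA1 : ∀ ω, |A ω| ≤ 1 := by
    intro ω
    rw [hA, abs_mul, abs_of_nonneg (alive_nonneg i t ω)]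
    exact mul_le_one₀ (alive_le_one i t ω) (abs_nonneg _) (hw1 _)
  have hAp : ∀ ω, A ω ≠ 0 → 0 ≤ p (V i t ω) ∧ p (V i t ω) ≤ 1 := fun ω h =>
    hwp _ (right_ne_zero_of_mul h)
  -- The survival indicator is idempotent, so the factor inside A absorbs the one inside the hazard.
  have hAg : ∀ ω, A ω * hazard T p V D i t ω = A ω * p (V i t ω) := by
    intro ω
    rw [hazard_eq, hA]
    rcases alive_eq_zero_or_one (T := T) (D := D) i t ω with h | h <;> simp [h]
  have hKn : ∀ ω, 0 ≤ K := fun ω => (abs_nonneg _).trans (hK ω)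
  have bd : ∀ {f : Ω → ℝ} (_ : Measurable[blockHistory V D t J] f) (_ : ∀ ω, |f ω| ≤ 2),
      (∫ ω, W ω * f ω * D i (t + 1) ω ∂P = ∫ ω, W ω * f ω * hazard T p V D i t ω ∂P) ∧
      Integrable (fun ω => W ω * f ω * D i (t + 1) ω) P ∧ Integrable (fun ω => W ω * f ω) P := by
    intro f hf hf2
    have hb : ∀ ω, |W ω * f ω| ≤ K * 2 := fun ω => by
      rw [abs_mul]; exact mul_le_mul (hK ω) (hf2 ω) (abs_nonneg _) (hKn ω)
    have hm : Measurable[blockHistory V D t J] fun ω => W ω * f ω := hW.mul hf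
    refine ⟨hD.integral_mul_default hV hp ht hi hm hb, ?_,
      integrable_of_measurable_bounded (hm.mono hB le_rfl) hb⟩
    refine integrable_of_measurable_bounded (K := K * 2)
      ((hm.mono hB le_rfl).mul (hD.measurable _ _)) fun ω => ?_
    rw [abs_mul]
    exact (mul_le_of_le_one_right (abs_nonneg _) (hD.abs_le_one _ _ _)).trans (hb ω)
  have hApb : ∀ ω, |A ω * p (V i t ω)| ≤ 2 := by
    intro ω
    by_cases h : A ω = 0
    · simp [h]
    · rw [abs_mul, abs_of_nonneg (hAp ω h).1]
      nlinarith [hAp ω h, hA1 ω, abs_nonneg (A ω)]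
  constructor
  · obtain ⟨e1, i1, -⟩ := bd hAm (fun ω => (hA1 ω).trans (by norm_num))
    obtain ⟨-, -, i2⟩ := bd (f := fun ω => A ω * p (V i t ω)) (hAm.mul hpm) hApb
    have : ∀ ω, W ω * scoreIncr T w p V D i t ω
        = W ω * A ω * D i (t + 1) ω - W ω * (A ω * p (V i t ω)) := by
      intro ω; simp only [scoreIncr, hA]; ring
    simp_rw [this]
    rw [integral_sub i1 i2, e1, sub_eq_zero]
    refine integral_congr_ae (ae_of_all _ fun ω => ?_)
    simp only [mul_assoc, hAg]
  · have hA2 : ∀ ω, |A ω ^ 2| ≤ 1 := fun ω => by rw [abs_pow]; exact pow_le_one₀ (abs_nonneg _) (hA1 ω)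
    obtain ⟨e1, i1, -⟩ := bd (f := fun ω => A ω ^ 2 * (1 - 2 * p (V i t ω)))
      ((hAm.pow_const 2).mul (measurable_const.sub (hpm.const_mul 2))) (fun ω => by
        by_cases h : A ω = 0
        · simp [h]
        · rw [abs_mul]
          have : |1 - 2 * p (V i t ω)| ≤ 1 := by
            rw [abs_le]; constructor <;> linarith [(hAp ω h).1, (hAp ω h).2]
          nlinarith [hA2 ω, abs_nonneg (A ω ^ 2), abs_nonneg (1 - 2 * p (V i t ω))])
    obtain ⟨-, -, i2⟩ := bd (f := fun ω => (A ω * p (V i t ω)) ^ 2)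
      ((hAm.mul hpm).pow_const 2) (fun ω => by
        by_cases h : A ω = 0
        · simp [h]
        · rw [mul_pow, abs_mul, abs_of_nonneg (sq_nonneg (p _))]
          have : p (V i t ω) ^ 2 ≤ 1 := pow_le_one₀ (hAp ω h).1 (hAp ω h).2
          nlinarith [hA2 ω, abs_nonneg (A ω ^ 2), sq_nonneg (p (V i t ω))])
    -- Since D² = D, the square of A (D - p) is affine in D, and the first-moment identity applies
    -- again.
    have : ∀ ω, W ω * scoreIncr T w p V D i t ω ^ 2
        = W ω * (A ω ^ 2 * (1 - 2 * p (V i t ω))) * D i (t + 1) ω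
          + W ω * (A ω * p (V i t ω)) ^ 2 := by
      intro ω; simp only [scoreIncr, hA]
      rcases hD.zero_or_one i (t + 1) ω with h | h <;> rw [h] <;> ring
    simp_rw [this]
    -- The function p is not bounded globally; one factor A is kept next to it so that A p is
    -- bounded.
    have i3 : Integrable (fun ω => W ω * (A ω ^ 2 * (1 - 2 * p (V i t ω)))
        * hazard T p V D i t ω) P := by
      obtain ⟨-, -, i4⟩ := bd (f := fun ω => A ω * ((1 - 2 * p (V i t ω)) * (A ω * p (V i t ω))))
        (hAm.mul ((measurable_const.sub (hpm.const_mul 2)).mul (hAm.mul hpm))) (fun ω => by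
          by_cases h : A ω = 0
          · simp [h]
          · have h1 : |1 - 2 * p (V i t ω)| ≤ 1 := by
              rw [abs_le]; constructor <;> linarith [(hAp ω h).1, (hAp ω h).2]
            rw [abs_mul (A ω), abs_mul (1 - _)]
            have h2 := hApb ω
            have h3 : |1 - 2 * p (V i t ω)| * |A ω * p (V i t ω)| ≤ 1 * 2 := by gcongr
            have h4 : |A ω| * (|1 - 2 * p (V i t ω)| * |A ω * p (V i t ω)|) ≤ 1 * (1 * 2) := by
              gcongr
              exact hA1 ω
            linarith)
      refine i4.congr (ae_of_all _ fun ω => ?_)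
      simp only [← hAg]
      ring
    rw [integral_add i1 i2, e1, ← integral_add i3 i2]
    refine integral_congr_ae (ae_of_all _ fun ω => ?_)
    have e5 : W ω * (A ω ^ 2 * (1 - 2 * p (V i t ω))) * hazard T p V D i t ω
        = W ω * (A ω * (1 - 2 * p (V i t ω))) * (A ω * hazard T p V D i t ω) := by ring
    simp only
    rw [e5, hAg]
    simp only [hA, varWeight]
    rcases alive_eq_zero_or_one (T := T) (D := D) i t ω with h | h <;> rw [h] <;> ring

omit [IsProbabilityMeasure P] hw1 hwp in
lemma measurable_scoreIncr (hD : IsDefaultProcess P T p V D) (ht : t < T) (i : Fin m) :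
    Measurable (scoreIncr T w p V D i t) :=
  (hD.measurable_block_scoreIncr hp hw (J := {i}) ht (by simp)).mono
    ((blockHistory_le t _).trans (history_le hV hD.measurable (t + 1))) le_rfl

/-- Second and fourth moments after adding one compensated indicator. -/
lemma moments_add_scoreIncr (hD : IsDefaultProcess P T p V D) (ht : t < T) {i : Fin m}
    (hi : i ∉ J) {Z : Ω → ℝ} {K : ℝ} (hZ : Measurable[blockHistory V D t J] Z)
    (hK : ∀ ω, |Z ω| ≤ K) {a : ℝ} (ha : 0 < a)
    (hvar : ∫ ω, varWeight w p (V i t ω) ^ 2 ∂P ≤ a ^ 2) :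
    ∫ ω, (Z ω + scoreIncr T w p V D i t ω) ^ 2 ∂P
      = ∫ ω, Z ω ^ 2 ∂P + ∫ ω, alive T D i t ω * varWeight w p (V i t ω) ∂P ∧
    ∫ ω, (Z ω + scoreIncr T w p V D i t ω) ^ 4 ∂P + 1
      ≤ (1 + 64 * a) * (∫ ω, Z ω ^ 4 ∂P + 1) := by
  have hB : blockHistory V D t J ≤ mΩ :=
    (blockHistory_le t J).trans (history_le hV hD.measurable (t + 1))
  have hZm : Measurable Z := hZ.mono hB le_rfl
  have hξm := hD.measurable_scoreIncr hV hp hw ht i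
  set ξ := scoreIncr T w p V D i t with hξ
  have hξ1 : ∀ ω, |ξ ω| ≤ 1 := fun ω => abs_scoreIncr_le hD.zero_or_one hw1 hwp i t ω
  set U : Ω → ℝ := fun ω => varWeight w p (V i t ω) with hU
  have hUm : Measurable U := by
    have : Measurable (varWeight w p) := by unfold varWeight; fun_prop
    exact this.comp (hV i t)
  have hU0 : ∀ ω, 0 ≤ U ω := fun ω => varWeight_nonneg hwp _
  have hU1 : ∀ ω, |U ω| ≤ 1 := fun ω => by
    rw [abs_of_nonneg (hU0 ω)]; exact varWeight_le_one hw1 hwp _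
  have ham : Measurable (alive T D i t) :=
    (measurable_history_alive (V := V) ht i).mono (history_le hV hD.measurable t) le_rfl
  have ha1 : ∀ ω, |alive T D i t ω| ≤ 1 := fun ω => by
    rw [abs_of_nonneg (alive_nonneg i t ω)]; exact alive_le_one i t ω
  have bm : ∀ {f g : Ω → ℝ} {A B : ℝ}, (∀ ω, |f ω| ≤ A) → (∀ ω, |g ω| ≤ B) →
      ∀ ω, |f ω * g ω| ≤ A * B := by
    intro f g A B hf hg ω
    rw [abs_mul]
    exact mul_le_mul (hf ω) (hg ω) (abs_nonneg _) ((abs_nonneg _).trans (hf ω))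
  have bp : ∀ (f : Ω → ℝ) (A : ℝ) (n : ℕ), (∀ ω, |f ω| ≤ A) → ∀ ω, |f ω ^ n| ≤ A ^ n := by
    intro f A n hf ω; rw [abs_pow]; exact pow_le_pow_left₀ (abs_nonneg _) (hf ω) n
  have bs : ∀ ω, |Z ω + ξ ω| ≤ K + 1 := fun ω => (abs_add_le _ _).trans (add_le_add (hK ω) (hξ1 ω))
  have iZ : ∀ n : ℕ, Integrable (fun ω => Z ω ^ n) P := fun n =>
    integrable_of_measurable_bounded (hZm.pow_const n) (bp Z K n hK)
  have iZξ : Integrable (fun ω => Z ω * ξ ω) P :=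
    integrable_of_measurable_bounded (hZm.mul hξm) (bm hK hξ1)
  have iξ2 : Integrable (fun ω => ξ ω ^ 2) P :=
    integrable_of_measurable_bounded (hξm.pow_const 2) (bp ξ 1 2 hξ1)
  constructor
  · have e1 := (hD.integral_mul_scoreIncr hV hp hw hw1 hwp ht hi hZ hK).1
    have e2 := (hD.integral_mul_scoreIncr hV hp hw hw1 hwp ht hi (W := fun _ => 1) (K := 1)
      measurable_const (by simp)).2
    simp only [one_mul] at e2
    rw [← e2]
    have : ∀ ω, (Z ω + ξ ω) ^ 2 = Z ω ^ 2 + 2 * (Z ω * ξ ω) + ξ ω ^ 2 := fun ω => by ring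
    simp_rw [this]
    have i12 : Integrable (fun ω => Z ω ^ 2 + 2 * (Z ω * ξ ω)) P := (iZ 2).add (iZξ.const_mul 2)
    rw [integral_add i12 iξ2, integral_add (iZ 2) (iZξ.const_mul 2),
      integral_const_mul, e1]
    ring
  · have hZ3 : Measurable[blockHistory V D t J] fun ω => Z ω ^ 3 := hZ.pow_const 3
    have hZ2 : Measurable[blockHistory V D t J] fun ω => 8 * Z ω ^ 2 + 3 :=
      ((hZ.pow_const 2).const_mul 8).add measurable_const
    have hZ2b : ∀ ω, |8 * Z ω ^ 2 + 3| ≤ 8 * K ^ 2 + 3 := fun ω => by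
      have := bp Z K 2 hK ω
      rw [abs_of_nonneg (sq_nonneg (Z ω))] at this
      rw [abs_of_nonneg (by positivity)]
      linarith
    have e1 := (hD.integral_mul_scoreIncr hV hp hw hw1 hwp ht hi hZ3 (bp Z K 3 hK)).1
    have e2 := (hD.integral_mul_scoreIncr hV hp hw hw1 hwp ht hi hZ2 hZ2b).2
    -- Beyond Z⁴ + 4Z³ξ the expansion leaves 6Z²ξ² + 4Zξ³ + ξ⁴. With |ξ| ≤ 1 and 2Zξ ≤ Z² + 1 this
    -- is at most (8Z² + 3)ξ².
    have hpt : ∀ ω, (Z ω + ξ ω) ^ 4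
        ≤ Z ω ^ 4 + 4 * (Z ω ^ 3 * ξ ω) + (8 * Z ω ^ 2 + 3) * ξ ω ^ 2 := by
      intro ω
      have h1 := abs_le.1 (hξ1 ω)
      have h2 : ξ ω ^ 2 ≤ 1 := by nlinarith
      have h3 : Z ω * ξ ω ≤ (Z ω ^ 2 + 1) / 2 := by nlinarith [sq_nonneg (Z ω - ξ ω)]
      nlinarith [mul_le_mul_of_nonneg_right h3 (sq_nonneg (ξ ω)),
        mul_le_mul_of_nonneg_right h2 (sq_nonneg (ξ ω))]
    have i1 : Integrable (fun ω => Z ω ^ 3 * ξ ω) P :=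
      integrable_of_measurable_bounded ((hZm.pow_const 3).mul hξm) (bm (bp Z K 3 hK) hξ1)
    have i2 : Integrable (fun ω => (8 * Z ω ^ 2 + 3) * ξ ω ^ 2) P :=
      integrable_of_measurable_bounded ((hZ2.mono hB le_rfl).mul (hξm.pow_const 2))
        (bm hZ2b (bp ξ 1 2 hξ1))
    have i4 : Integrable (fun ω => (Z ω + ξ ω) ^ 4) P :=
      integrable_of_measurable_bounded ((hZm.add hξm).pow_const 4) (bp _ _ 4 bs)
    have hle := integral_mono i4 (((iZ 4).add (i1.const_mul 4)).add i2) hpt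
    have hsum : ∫ ω, (Z ω ^ 4 + 4 * (Z ω ^ 3 * ξ ω) + (8 * Z ω ^ 2 + 3) * ξ ω ^ 2) ∂P
        = ∫ ω, Z ω ^ 4 ∂P + ∫ ω, (8 * Z ω ^ 2 + 3) * (alive T D i t ω * U ω) ∂P := by
      have i12 : Integrable (fun ω => Z ω ^ 4 + 4 * (Z ω ^ 3 * ξ ω)) P :=
        (iZ 4).add (i1.const_mul 4)
      rw [integral_add i12 i2, integral_add (iZ 4) (i1.const_mul 4),
        integral_const_mul, e1, e2]
      ring
    -- Z and the conditional variance U are dependent through the covariates, so they are separated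
    -- by Young's inequality with weight a; the bound a² on the second moment of U makes both parts
    -- of order a.
    have hpt2 : ∀ ω, (8 * Z ω ^ 2 + 3) * (alive T D i t ω * U ω)
        ≤ 64 * a * Z ω ^ 4 + 9 * a + (2 * a)⁻¹ * U ω ^ 2 := by
      intro ω
      have h1 : (8 * Z ω ^ 2 + 3) * (alive T D i t ω * U ω) ≤ (8 * Z ω ^ 2 + 3) * U ω := by
        gcongr
        exact mul_le_of_le_one_left (hU0 ω) (alive_le_one i t ω)
      refine h1.trans ?_
      have h2 : (8 * Z ω ^ 2 + 3) ^ 2 ≤ 128 * Z ω ^ 4 + 18 := by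
        nlinarith [sq_nonneg (8 * Z ω ^ 2 - 3)]
      have h3 : 0 ≤ (2 * a)⁻¹ * (a * (8 * Z ω ^ 2 + 3) - U ω) ^ 2 := by positivity
      have h4 : (2 * a)⁻¹ * (a * (8 * Z ω ^ 2 + 3) - U ω) ^ 2
          = a / 2 * (8 * Z ω ^ 2 + 3) ^ 2 - (8 * Z ω ^ 2 + 3) * U ω + (2 * a)⁻¹ * U ω ^ 2 := by
        field_simp
        ring
      nlinarith
    have i5 : Integrable (fun ω => (8 * Z ω ^ 2 + 3) * (alive T D i t ω * U ω)) P :=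
      integrable_of_measurable_bounded ((hZ2.mono hB le_rfl).mul (ham.mul hUm))
        (bm hZ2b (bm ha1 hU1))
    have i6 : Integrable (fun ω => U ω ^ 2) P :=
      integrable_of_measurable_bounded (hUm.pow_const 2) (bp U 1 2 hU1)
    have i7 : Integrable (fun ω => 64 * a * Z ω ^ 4 + 9 * a) P :=
      ((iZ 4).const_mul _).add (integrable_const _)
    have hle2 := integral_mono i5 (i7.add (i6.const_mul _)) hpt2
    have hsum2 : ∫ ω, (64 * a * Z ω ^ 4 + 9 * a + (2 * a)⁻¹ * U ω ^ 2) ∂P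
        = 64 * a * ∫ ω, Z ω ^ 4 ∂P + 9 * a + (2 * a)⁻¹ * ∫ ω, U ω ^ 2 ∂P := by
      rw [integral_add i7 (i6.const_mul _), integral_add ((iZ 4).const_mul _) (integrable_const _),
        integral_const_mul, integral_const, integral_const_mul]
      simp
    have h8 : (2 * a)⁻¹ * ∫ ω, U ω ^ 2 ∂P ≤ a := by
      rw [inv_mul_le_iff₀ (by positivity)]
      nlinarith
    simp only [Pi.add_apply] at hle hle2
    rw [hsum] at hle
    rw [hsum2] at hle2
    linarith

/-- Within a period the firms are added one by one, the running sum being measurable for the block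
history of the firms already included. The fourth moment plus one grows by a fixed factor per firm.
-/
lemma moments_add_block (hD : IsDefaultProcess P T p V D) (ht : t < T)
    {Z : Ω → ℝ} {K : ℝ} (hZ : Measurable[history V D t] Z)
    (hK : ∀ ω, |Z ω| ≤ K) {a : ℝ} (ha : 0 < a)
    (hvar : ∀ i, ∫ ω, varWeight w p (V i t ω) ^ 2 ∂P ≤ a ^ 2) (J : Finset (Fin m)) :
    ∫ ω, (Z ω + ∑ i ∈ J, scoreIncr T w p V D i t ω) ^ 2 ∂P
      = ∫ ω, Z ω ^ 2 ∂P + ∑ i ∈ J, ∫ ω, alive T D i t ω * varWeight w p (V i t ω) ∂P ∧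
    ∫ ω, (Z ω + ∑ i ∈ J, scoreIncr T w p V D i t ω) ^ 4 ∂P + 1
      ≤ (1 + 64 * a) ^ J.card * (∫ ω, Z ω ^ 4 ∂P + 1) := by
  classical
  induction J using Finset.induction_on with
  | empty => simp
  | insert i J hi ih =>
    have hm : Measurable[blockHistory V D t J]
        fun ω => Z ω + ∑ i ∈ J, scoreIncr T w p V D i t ω := by
      refine (hZ.mono (history_le_blockHistory t J) le_rfl).add ?_
      exact Finset.measurable_sum _ fun j hj => hD.measurable_block_scoreIncr hp hw ht hj
    have hb : ∀ ω, |Z ω + ∑ i ∈ J, scoreIncr T w p V D i t ω| ≤ K + J.card := by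
      intro ω
      refine (abs_add_le _ _).trans (add_le_add (hK ω) ?_)
      refine (Finset.abs_sum_le_sum_abs _ _).trans ?_
      refine (Finset.sum_le_card_nsmul _ _ 1 fun j _ =>
        abs_scoreIncr_le hD.zero_or_one hw1 hwp j t ω).trans (by simp)
    obtain ⟨h2, h4⟩ := hD.moments_add_scoreIncr hV hp hw hw1 hwp ht hi hm hb ha (hvar i)
    have e : ∀ ω, Z ω + ∑ j ∈ insert i J, scoreIncr T w p V D j t ω
        = Z ω + ∑ i ∈ J, scoreIncr T w p V D i t ω + scoreIncr T w p V D i t ω := by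
      intro ω; rw [Finset.sum_insert hi]; ring
    simp_rw [e]
    rw [h2, ih.1, Finset.sum_insert hi, Finset.card_insert_of_notMem hi]
    refine ⟨by ring, h4.trans ?_⟩
    rw [pow_succ, mul_comm ((1 + 64 * a) ^ J.card), mul_assoc]
    exact mul_le_mul_of_nonneg_left ih.2 (by positivity)

end

variable (hw1 : ∀ v, |w v| ≤ 1) (hwp : ∀ v, w v ≠ 0 → 0 ≤ p v ∧ p v ≤ 1)
include hp hw

omit [IsProbabilityMeasure P] in
lemma measurable_history_scoreSum (hD : IsDefaultProcess P T p V D) {n : ℕ} (hn : n ≤ T) :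
    Measurable[history V D n] (scoreSum T w p V D n) := by
  refine Finset.measurable_fun_sum _ fun t ht => Finset.measurable_fun_sum _ fun i _ => ?_
  have ht' : t < n := Finset.mem_range.1 ht
  exact (hD.measurable_block_scoreIncr hp hw (J := {i}) (ht'.trans_le hn) (by simp)).mono
    ((blockHistory_le t _).trans (history_mono ht')) le_rfl

include hV hw1 hwp

/-- Second moment and a bound for the fourth moment of the sum of compensated indicators. -/
lemma moments_scoreSum (hD : IsDefaultProcess P T p V D) {a : ℝ} (ha : 0 < a)
    (hvar : ∀ i, ∀ t < T, ∫ ω, varWeight w p (V i t ω) ^ 2 ∂P ≤ a ^ 2) {n : ℕ} (hn : n ≤ T) :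
    (∀ ω, |scoreSum T w p V D n ω| ≤ n * m) ∧
    ∫ ω, scoreSum T w p V D n ω ^ 2 ∂P
      = ∑ t ∈ Finset.range n, ∑ i, ∫ ω, alive T D i t ω * varWeight w p (V i t ω) ∂P ∧
    ∫ ω, scoreSum T w p V D n ω ^ 4 ∂P + 1 ≤ (1 + 64 * a) ^ (n * m) := by
  induction n with
  | zero => simp [scoreSum]
  | succ n ih =>
    obtain ⟨hb, h2, h4⟩ := ih (by omega)
    have hm := hD.measurable_history_scoreSum hp hw (n := n) (by omega)
    obtain ⟨g2, g4⟩ := hD.moments_add_block hV hp hw hw1 hwp (t := n) (by omega) hm hb ha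
      (fun i => hvar i n (by omega)) Finset.univ
    have e : ∀ ω, scoreSum T w p V D (n + 1) ω
        = scoreSum T w p V D n ω + ∑ i, scoreIncr T w p V D i n ω := by
      intro ω; simp [scoreSum, Finset.sum_range_succ]
    simp_rw [e]
    refine ⟨fun ω => ?_, ?_, ?_⟩
    · refine (abs_add_le _ _).trans ?_
      have : |∑ i, scoreIncr T w p V D i n ω| ≤ m :=
        (Finset.abs_sum_le_sum_abs _ _).trans ((Finset.sum_le_card_nsmul _ _ 1 fun j _ =>
          abs_scoreIncr_le hD.zero_or_one hw1 hwp j n ω).trans (by simp))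
      push_cast
      linarith [hb ω]
    · rw [g2, h2, Finset.sum_range_succ]
    · refine g4.trans ?_
      rw [Finset.card_univ, Fintype.card_fin, show (n + 1) * m = m + n * m by ring, pow_add]
      exact mul_le_mul_of_nonneg_left h4 (by positivity)

end IsDefaultProcess

end ScoreMoments

/-! ### Exponentially tilted moments of Gaussian vectors -/

section GaussianMoments

variable {ι : Type*} [Fintype ι] [DecidableEq ι] {S : Matrix ι ι ℝ}

/-- The covariance form `aᵀ S b`. -/
def covForm (S : Matrix ι ι ℝ) (a b : EuclideanSpace ℝ ι) : ℝ := a ⬝ᵥ S *ᵥ b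

omit [DecidableEq ι] in
lemma covForm_add_left (a b c : EuclideanSpace ℝ ι) :
    covForm S (a + b) c = covForm S a c + covForm S b c := by
  simp [covForm, add_dotProduct]

omit [DecidableEq ι] in
lemma covForm_add_right (a b c : EuclideanSpace ℝ ι) :
    covForm S a (b + c) = covForm S a b + covForm S a c := by
  simp [covForm, mulVec_add, dotProduct_add]

omit [DecidableEq ι] in
lemma covForm_smul_left (r : ℝ) (a b : EuclideanSpace ℝ ι) :
    covForm S (r • a) b = r * covForm S a b := by
  simp [covForm, smul_dotProduct]

omit [DecidableEq ι] in
lemma covForm_smul_right (r : ℝ) (a b : EuclideanSpace ℝ ι) :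
    covForm S a (r • b) = r * covForm S a b := by
  simp [covForm, mulVec_smul, dotProduct_smul]

omit [DecidableEq ι] in
lemma covForm_comm (hS : S.PosSemidef) (a b : EuclideanSpace ℝ ι) :
    covForm S a b = covForm S b a := by
  have hT : Sᵀ = S := by simpa [IsSymm] using hS.isHermitian
  unfold covForm
  rw [dotProduct_mulVec, ← mulVec_transpose, hT, dotProduct_comm]

omit [DecidableEq ι] in
lemma covForm_self_nonneg (hS : S.PosSemidef) (a : EuclideanSpace ℝ ι) : 0 ≤ covForm S a a := by
  simpa [covForm] using hS.dotProduct_mulVec_nonneg (WithLp.ofLp a)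

/-- Fernique's theorem provides an integrable exp(C‖v‖²), and completing the square gives s‖v‖ ≤
C‖v‖² + s²/(4C). -/
lemma integrable_exp_mul_norm (s : ℝ) :
    Integrable (fun v => Real.exp (s * ‖v‖))
      (multivariateGaussian (0 : EuclideanSpace ℝ ι) S) := by
  obtain ⟨C, hC, hint⟩ := IsGaussian.exists_integrable_exp_sq
    (multivariateGaussian (0 : EuclideanSpace ℝ ι) S)
  refine (hint.const_mul (Real.exp (s ^ 2 / (4 * C)))).mono'
    (by fun_prop) (ae_of_all _ fun v => ?_)
  rw [Real.norm_eq_abs, Real.abs_exp, ← Real.exp_add, Real.exp_le_exp]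
  have : 0 ≤ (2 * C * ‖v‖ - s) ^ 2 / (4 * C) := by positivity
  have e : (2 * C * ‖v‖ - s) ^ 2 / (4 * C) = C * ‖v‖ ^ 2 - s * ‖v‖ + s ^ 2 / (4 * C) := by
    field_simp; ring
  linarith

lemma integrable_of_le_exp_mul_norm {f : EuclideanSpace ℝ ι → ℝ} (hf : Measurable f) {K s : ℝ}
    (hK : ∀ v, |f v| ≤ K * Real.exp (s * ‖v‖)) :
    Integrable f (multivariateGaussian (0 : EuclideanSpace ℝ ι) S) :=
  ((integrable_exp_mul_norm s).const_mul K).mono' hf.aestronglyMeasurable (ae_of_all _ hK)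

omit [DecidableEq ι] in
lemma exp_inner_le (a v : EuclideanSpace ℝ ι) :
    Real.exp (inner ℝ a v) ≤ Real.exp (‖a‖ * ‖v‖) :=
  Real.exp_le_exp.2 (real_inner_le_norm a v)

lemma _root_.RareDefault.pow_le_factorial_mul_exp {x : ℝ} (hx : 0 ≤ x) (n : ℕ) :
    x ^ n ≤ n.factorial * Real.exp x := by
  have := Real.pow_div_factorial_le_exp x hx n
  rwa [div_le_iff₀ (by positivity), mul_comm] at this

lemma integrable_norm_pow_mul_exp_inner (n : ℕ) (b : EuclideanSpace ℝ ι) :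
    Integrable (fun v => ‖v‖ ^ n * Real.exp (inner ℝ b v))
      (multivariateGaussian (0 : EuclideanSpace ℝ ι) S) := by
  refine integrable_of_le_exp_mul_norm (by fun_prop) (K := n.factorial) (s := 1 + ‖b‖) fun v => ?_
  rw [abs_of_nonneg (by positivity), add_mul, Real.exp_add, one_mul, ← mul_assoc]
  exact mul_le_mul (pow_le_factorial_mul_exp (norm_nonneg v) n) (exp_inner_le b v)
    (Real.exp_pos _).le (by positivity)

lemma integrable_of_le_norm_pow_mul_exp_inner {f : EuclideanSpace ℝ ι → ℝ} (hf : Measurable f)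
    {K : ℝ} {n : ℕ} {b : EuclideanSpace ℝ ι}
    (hK : ∀ v, |f v| ≤ K * (‖v‖ ^ n * Real.exp (inner ℝ b v))) :
    Integrable f (multivariateGaussian (0 : EuclideanSpace ℝ ι) S) :=
  ((integrable_norm_pow_mul_exp_inner n b).const_mul K).mono' hf.aestronglyMeasurable
    (ae_of_all _ hK)

lemma integrable_exp_inner (b : EuclideanSpace ℝ ι) :
    Integrable (fun v => Real.exp (inner ℝ b v))
      (multivariateGaussian (0 : EuclideanSpace ℝ ι) S) := by
  simpa using integrable_norm_pow_mul_exp_inner (S := S) 0 b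

lemma integral_exp_inner (hS : S.PosSemidef) (a : EuclideanSpace ℝ ι) :
    ∫ v, Real.exp (inner ℝ a v) ∂(multivariateGaussian 0 S) = Real.exp (covForm S a a / 2) := by
  have := mgf_gaussianReal (map_inner_multivariateGaussian hS a) 1
  simp only [mgf, one_mul, zero_add, mul_one, one_pow] at this
  rw [this]
  change Real.exp (((covForm S a a).toNNReal : ℝ) / 2) = _
  rw [Real.coe_toNNReal _ (covForm_self_nonneg hS a)]

/-- Second moments of linear functionals under exponential tilting. -/
lemma integral_inner_sq_mul_exp_inner (hS : S.PosSemidef) (w b : EuclideanSpace ℝ ι) :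
    ∫ v, inner ℝ w v ^ 2 * Real.exp (inner ℝ b v) ∂(multivariateGaussian 0 S)
      = Real.exp (covForm S b b / 2) * (covForm S w w + covForm S w b ^ 2) := by
  set ν := multivariateGaussian (0 : EuclideanSpace ℝ ι) S
  -- Under the tilted, unnormalised measure the integral becomes a second moment, which is read off
  -- from the second derivative at 0 of an explicit moment generating function.
  set μ : Measure (EuclideanSpace ℝ ι) :=
    ν.withDensity fun v => ENNReal.ofReal (Real.exp (inner ℝ b v))
  have hdm : Measurable fun v : EuclideanSpace ℝ ι =>
    ENNReal.ofReal (Real.exp (inner ℝ b v)) := by fun_prop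
  have htr : ∀ g : EuclideanSpace ℝ ι → ℝ,
      ∫ v, g v ∂μ = ∫ v, Real.exp (inner ℝ b v) * g v ∂ν := by
    intro g
    rw [integral_withDensity_eq_integral_toReal_smul hdm (ae_of_all _ fun _ => by simp)]
    simp [ENNReal.toReal_ofReal (Real.exp_pos _).le]
  have hI : ∀ t : ℝ, Integrable (fun v => Real.exp (t * inner ℝ w v)) μ := by
    intro t
    rw [integrable_withDensity_iff_integrable_smul' hdm (ae_of_all _ fun _ => by simp)]
    refine (integrable_exp_inner (S := S) (b + t • w)).congr (ae_of_all _ fun v => ?_)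
    simp [ENNReal.toReal_ofReal (Real.exp_pos _).le, inner_add_left, real_inner_smul_left,
      Real.exp_add]
  have hint : ∀ t : ℝ, t ∈ interior (integrableExpSet (fun v => inner ℝ w v) μ) := by
    intro t
    have : integrableExpSet (fun v => inner ℝ w v) μ = Set.univ :=
      Set.eq_univ_of_forall fun t => hI t
    simp [this]
  set E := Real.exp (covForm S b b / 2)
  set Q := covForm S w w
  set R := covForm S w b
  -- The zeroth power is kept so that the expression has the form differentiated by
  -- `hasDerivAt_integral_pow_mul_exp_real`.
  have hmgf : (fun t : ℝ => ∫ v, inner ℝ w v ^ 0 * Real.exp (t * inner ℝ w v) ∂μ)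
      = fun t => E * Real.exp (t * R + t ^ 2 * Q / 2) := by
    funext t
    rw [htr]
    have : ∀ v, Real.exp (inner ℝ b v) * (inner ℝ w v ^ 0 * Real.exp (t * inner ℝ w v))
        = Real.exp (inner ℝ (b + t • w) v) := by
      intro v
      rw [pow_zero, one_mul, ← Real.exp_add, inner_add_left, real_inner_smul_left]
    simp_rw [this]
    rw [integral_exp_inner hS, ← Real.exp_add]
    congr 1
    simp only [covForm_add_left, covForm_add_right, covForm_smul_left, covForm_smul_right, Q, R]
    rw [covForm_comm hS b w]
    ring
  have hphi : ∀ t : ℝ, HasDerivAt (fun t => E * Real.exp (t * R + t ^ 2 * Q / 2))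
      (E * (Real.exp (t * R + t ^ 2 * Q / 2) * (R + t * Q))) t := by
    intro t
    have h1 : HasDerivAt (fun t : ℝ => t * R + t ^ 2 * Q / 2) (R + t * Q) t := by
      convert! ((hasDerivAt_id t).mul_const R).add
        ((((hasDerivAt_id t).pow 2).mul_const Q).div_const 2) using 1
      simp; ring
    exact h1.exp.const_mul E
  have hone : (fun t : ℝ => ∫ v, inner ℝ w v ^ 1 * Real.exp (t * inner ℝ w v) ∂μ)
      = fun t => E * (Real.exp (t * R + t ^ 2 * Q / 2) * (R + t * Q)) := by
    funext t
    have h1 := hasDerivAt_integral_pow_mul_exp_real (hint t) 0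
    rw [hmgf] at h1
    exact h1.unique (hphi t)
  have htwo := hasDerivAt_integral_pow_mul_exp_real (hint 0) 1
  rw [hone] at htwo
  have hd : HasDerivAt (fun t => E * (Real.exp (t * R + t ^ 2 * Q / 2) * (R + t * Q)))
      (E * (Q + R ^ 2)) 0 := by
    have h2 : HasDerivAt (fun t : ℝ => Real.exp (t * R + t ^ 2 * Q / 2)) R 0 := by
      have h1 : HasDerivAt (fun t : ℝ => t * R + t ^ 2 * Q / 2) R 0 := by
        convert! ((hasDerivAt_id (0 : ℝ)).mul_const R).add
          ((((hasDerivAt_id (0 : ℝ)).pow 2).mul_const Q).div_const 2) using 1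
        simp
      convert! h1.exp using 1
      simp
    have h3 : HasDerivAt (fun t : ℝ => R + t * Q) Q 0 := by
      simpa using ((hasDerivAt_id (0 : ℝ)).mul_const Q).const_add R
    convert! (h2.mul h3).const_mul E using 1
    simp only [zero_mul, add_zero, ne_eq, OfNat.ofNat_ne_zero, not_false_eq_true, zero_pow,
      zero_div, Real.exp_zero]
    ring
  have := htwo.unique hd
  simp only [htr, zero_mul, Real.exp_zero, mul_one] at this
  rw [← this]
  refine integral_congr_ae (ae_of_all _ fun v => ?_)
  simp only
  ring

/-- Second-order Taylor bound for the symmetric second difference of the exponential. -/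
lemma abs_exp_add_exp_neg_sub_le (z : ℝ) :
    |Real.exp z + Real.exp (-z) - 2 - z ^ 2| ≤ 2 * |z| ^ 3 * Real.exp |z| := by
  have key : ∀ x : ℝ, |Real.exp x - (1 + x + x ^ 2 / 2)| ≤ |x| ^ 3 * Real.exp |x| := by
    intro x
    have := Complex.norm_exp_sub_sum_le_norm_mul_exp (x : ℂ) 3
    simp only [Finset.sum_range_succ, Finset.sum_range_zero, pow_zero, pow_one, Nat.factorial,
      Complex.norm_real, Real.norm_eq_abs] at this
    have e : Complex.exp x - (0 + 1 / ((1 : ℕ) : ℂ) + (x : ℂ) / (((0 + 1) * 1 : ℕ) : ℂ)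
        + (x : ℂ) ^ 2 / (((1 + 1) * ((0 + 1) * 1) : ℕ) : ℂ))
        = ((Real.exp x - (1 + x + x ^ 2 / 2) : ℝ) : ℂ) := by
      push_cast; ring
    rw [e, Complex.norm_real, Real.norm_eq_abs] at this
    exact this
  have h1 := key z
  have h2 := key (-z)
  rw [abs_neg] at h2
  have e : Real.exp z + Real.exp (-z) - 2 - z ^ 2 = (Real.exp z - (1 + z + z ^ 2 / 2))
      + (Real.exp (-z) - (1 + -z + (-z) ^ 2 / 2)) := by ring
  rw [e]
  refine (abs_add_le _ _).trans ?_
  linarith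

end GaussianMoments

/-! ### A law of large numbers uniform over covariate processes -/

/-- Double sums of geometric weights in the distance. -/
lemma sum_sum_pow_dist_le {ρ : ℝ} (hρ : 0 < ρ) (hρ' : ρ < 1) (T : ℕ) :
    ∑ s ∈ Finset.range T, ∑ t ∈ Finset.range T, ρ ^ ((s - t) + (t - s)) ≤ T * (2 / (1 - ρ)) := by
  have hgeom : ∀ n : ℕ, ∑ j ∈ Finset.range n, ρ ^ j ≤ 1 / (1 - ρ) := by
    intro n
    rw [geom_sum_eq hρ'.ne, ← neg_div_neg_eq, neg_sub, neg_sub]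
    have : 0 < ρ ^ n := by positivity
    gcongr
    linarith
  have hrow : ∀ s ∈ Finset.range T,
      ∑ t ∈ Finset.range T, ρ ^ ((s - t) + (t - s)) ≤ 2 / (1 - ρ) := by
    intro s hs
    have hsT : s + 1 ≤ T := Finset.mem_range.1 hs
    -- In truncated subtraction at most one of the two differences is nonzero, so the exponent is |s
    -- - t|; for t ≤ s reversing the order of summation gives a geometric sum.
    have e1 : ∑ t ∈ Finset.range (s + 1), ρ ^ ((s - t) + (t - s)) ≤ 1 / (1 - ρ) := by
      refine le_trans (le_of_eq ?_) (hgeom (s + 1))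
      rw [← Finset.sum_range_reflect]
      refine Finset.sum_congr rfl fun t ht => ?_
      have : t < s + 1 := Finset.mem_range.1 ht
      congr 1
      omega
    have e2 : ∑ t ∈ Finset.Ico (s + 1) T, ρ ^ ((s - t) + (t - s)) ≤ 1 / (1 - ρ) := by
      rw [Finset.sum_Ico_eq_sum_range]
      refine le_trans (Finset.sum_le_sum fun t _ => ?_) (hgeom (T - (s + 1)))
      exact pow_le_pow_of_le_one hρ.le hρ'.le (by omega)
    rw [← Finset.sum_range_add_sum_Ico _ hsT]
    calc _ ≤ 1 / (1 - ρ) + 1 / (1 - ρ) := add_le_add e1 e2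
      _ = _ := by ring
  refine (Finset.sum_le_sum hrow).trans (by simp)

section LawOfLargeNumbers

variable {d₁ d₂ : ℕ} {S : Matrix (Fin d₁ ⊕ Fin d₂) (Fin d₁ ⊕ Fin d₂) ℝ} {K ρ : ℝ}

namespace IsCovariateProcess

variable {Ω : Type*} [MeasurableSpace Ω] {P : Measure Ω} {m : ℕ}
  {Y : ℕ → Ω → EuclideanSpace ℝ (Fin d₁)} {X : Fin m → ℕ → Ω → EuclideanSpace ℝ (Fin d₂)}
  {V : Fin m → ℕ → Ω → Cov d₁ d₂} (hV : IsCovariateProcess P S K ρ Y X V)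

include hV

lemma measurable (i : Fin m) (t : ℕ) : Measurable (V i t) := by
  have : V i t = fun ω => joinCov (Y t ω) (X i t ω) := funext fun ω => hV.eq_join i t ω
  rw [this]
  have hY := hV.measurable_common t
  have hX := hV.measurable_specific i t
  unfold joinCov
  refine (WithLp.measurable_toLp 2 _).comp (measurable_pi_lambda _ ?_)
  rintro (k | k)
  · simp only [Sum.elim_inl]; fun_prop
  · simp only [Sum.elim_inr]; fun_prop

lemma integral_comp (i : Fin m) (t : ℕ) {f : Cov d₁ d₂ → ℝ} (hf : Measurable f) :
    ∫ ω, f (V i t ω) ∂P = ∫ v, f v ∂(multivariateGaussian 0 S) :=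
  (hV.marginal i t).integral_comp hf.aestronglyMeasurable

lemma integrable_comp (i : Fin m) (t : ℕ) {f : Cov d₁ d₂ → ℝ}
    (hf : Integrable f (multivariateGaussian 0 S)) : Integrable (fun ω => f (V i t ω)) P := by
  rw [← (hV.marginal i t).map_eq] at hf
  exact hf.comp_aemeasurable (hV.marginal i t).aemeasurable

lemma memLp_inner (a : Cov d₁ d₂) (i : Fin m) (t : ℕ) :
    MemLp (fun ω => inner ℝ a (V i t ω)) 2 P := by
  have := ((hV.marginal i t).hasGaussianLaw.map (innerSL ℝ a)).memLp_two
  simpa [Function.comp_def] using this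

lemma integral_inner_mul_inner (a : Cov d₁ d₂) (i j : Fin m) (s t : ℕ) :
    ∫ ω, inner ℝ a (V i s ω) * inner ℝ a (V j t ω) ∂P
      = covForm (crossMoment P (V i s) (V j t)) a a := by
  have hmem : ∀ (i : Fin m) (t : ℕ) (k : Fin d₁ ⊕ Fin d₂), MemLp (fun ω => V i t ω k) 2 P := by
    intro i t k
    have := hV.memLp_inner (EuclideanSpace.single k 1) i t
    simpa [EuclideanSpace.inner_single_left] using this
  have hint : ∀ k l, Integrable (fun ω => V i s ω k * V j t ω l) P := fun k l =>
    (hmem i s k).integrable_mul (hmem j t l)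
  have e : ∀ ω, inner ℝ a (V i s ω) * inner ℝ a (V j t ω)
      = ∑ k, ∑ l, a k * a l * (V i s ω k * V j t ω l) := by
    intro ω
    simp only [PiLp.inner_apply, RCLike.inner_apply, conj_trivial, Finset.sum_mul_sum]
    refine Finset.sum_congr rfl fun k _ => Finset.sum_congr rfl fun l _ => by ring
  simp_rw [e]
  rw [integral_finsetSum _ fun k _ => integrable_finsetSum _ fun l _ => (hint k l).const_mul _]
  simp only [covForm, dotProduct, mulVec, crossMoment, of_apply, Finset.mul_sum]
  refine Finset.sum_congr rfl fun k _ => ?_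
  rw [integral_finsetSum _ fun l _ => (hint k l).const_mul _]
  refine Finset.sum_congr rfl fun l _ => ?_
  rw [integral_const_mul]
  ring

lemma abs_covForm_crossMoment_le (a : Cov d₁ d₂) (i j : Fin m) (t k : ℕ) :
    |covForm (crossMoment P (V i t) (V j (t + k))) a a| ≤ ‖a‖ ^ 2 * (K * ρ ^ k) := by
  have h := hV.short_range i j t k
  rw [covForm, ← inner_toEuclideanCLM]
  refine (abs_real_inner_le_norm _ _).trans ?_
  calc _ ≤ ‖a‖ * (‖toEuclideanCLM (𝕜 := ℝ) (crossMoment P (V i t) (V j (t + k)))‖ * ‖a‖) := by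
        gcongr; exact ContinuousLinearMap.le_opNorm _ _
    _ ≤ ‖a‖ * (K * ρ ^ k * ‖a‖) := by gcongr
    _ = _ := by ring

/-- Joint Gaussianity makes the sum of the two linear functionals a centred real Gaussian; its
variance is twice aᵀSa plus twice the cross-covariance. -/
lemma integral_exp_inner_add [IsProbabilityMeasure P] (hS : S.PosSemidef) (a : Cov d₁ d₂) (i j : Fin m) (s t : ℕ) :
    ∫ ω, Real.exp (inner ℝ a (V i s ω)) * Real.exp (inner ℝ a (V j t ω)) ∂P
      = Real.exp (covForm S a a) * Real.exp (covForm (crossMoment P (V i s) (V j t)) a a) := by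
  have hg : HasGaussianLaw (fun ω => inner ℝ a (V i s ω) + inner ℝ a (V j t ω)) P := by
    have := (hV.gaussian.hasGaussianLaw_prodMk (s := (i, s)) (t := (j, t))).map
      ((innerSL ℝ a).comp (ContinuousLinearMap.fst ℝ _ _)
        + (innerSL ℝ a).comp (ContinuousLinearMap.snd ℝ _ _))
    simpa [Function.comp_def] using this
  have hmean : ∀ (i : Fin m) (t : ℕ), ∫ ω, inner ℝ a (V i t ω) ∂P = 0 := by
    intro i t
    rw [hV.integral_comp i t (f := fun v => inner ℝ a v) (by fun_prop),
      integral_inner IsGaussian.integrable_fun_id]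
    simp
  have hvar : ∀ (i : Fin m) (t : ℕ), Var[fun ω => inner ℝ a (V i t ω); P] = covForm S a a := by
    intro i t
    have h0 : HasLaw (fun v => inner ℝ a v) (gaussianReal 0 (covForm S a a).toNNReal)
        (multivariateGaussian 0 S) := ⟨by fun_prop, map_inner_multivariateGaussian hS a⟩
    rw [(h0.fun_comp (hV.marginal i t)).variance_eq, variance_id_gaussianReal,
      Real.coe_toNNReal _ (covForm_self_nonneg hS a)]
  have h2 : Var[fun ω => inner ℝ a (V i s ω) + inner ℝ a (V j t ω); P]
      = 2 * covForm S a a + 2 * covForm (crossMoment P (V i s) (V j t)) a a := by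
    rw [variance_fun_add (hV.memLp_inner a i s) (hV.memLp_inner a j t), hvar, hvar,
      covariance_eq_sub (hV.memLp_inner a i s) (hV.memLp_inner a j t), hmean, hmean]
    simp only [Pi.mul_apply]
    rw [hV.integral_inner_mul_inner a i j s t]
    ring
  have h3 := mgf_gaussianReal hg.map_eq_gaussianReal 1
  rw [h2, integral_add ((hV.memLp_inner a i s).integrable one_le_two)
    ((hV.memLp_inner a j t).integrable one_le_two), hmean, hmean] at h3
  have hn : 0 ≤ 2 * covForm S a a + 2 * covForm (crossMoment P (V i s) (V j t)) a a := by
    rw [← h2]; exact variance_nonneg _ _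
  simp only [mgf, one_mul, add_zero, zero_add, one_pow, mul_one, Real.coe_toNNReal _ hn,
    Real.exp_add] at h3
  rw [h3, ← Real.exp_add]
  congr 1
  ring

end IsCovariateProcess
end LawOfLargeNumbers

section LawOfLargeNumbers

universe u

variable {d₁ d₂ : ℕ} {S : Matrix (Fin d₁ ⊕ Fin d₂) (Fin d₁ ⊕ Fin d₂) ℝ} {K ρ : ℝ}

lemma memLp_two_exp_inner (a : Cov d₁ d₂) :
    MemLp (fun v : Cov d₁ d₂ => Real.exp (inner ℝ a v)) 2 (multivariateGaussian 0 S) := by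
  rw [memLp_two_iff_integrable_sq (by fun_prop)]
  refine (integrable_exp_inner (S := S) ((2 : ℝ) • a)).congr (ae_of_all _ fun v => ?_)
  simp only [real_inner_smul_left, ← Real.exp_nat_mul]
  norm_num

/-- The constant in the decay of correlations of `exp (aᵀ V)`. -/
def expCovConst (S : Matrix (Fin d₁ ⊕ Fin d₂) (Fin d₁ ⊕ Fin d₂) ℝ) (K : ℝ) (a : Cov d₁ d₂) : ℝ :=
  Real.exp (covForm S a a) * (‖a‖ ^ 2 * |K| * Real.exp (‖a‖ ^ 2 * |K|))

lemma expCovConst_nonneg (a : Cov d₁ d₂) : 0 ≤ expCovConst S K a := by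
  unfold expCovConst; positivity

namespace IsCovariateProcess

variable {Ω : Type*} [MeasurableSpace Ω] {P : Measure Ω} [IsProbabilityMeasure P] {m : ℕ}
  {Y : ℕ → Ω → EuclideanSpace ℝ (Fin d₁)} {X : Fin m → ℕ → Ω → EuclideanSpace ℝ (Fin d₂)}
  {V : Fin m → ℕ → Ω → Cov d₁ d₂} (hV : IsCovariateProcess P S K ρ Y X V)

include hV

lemma memLp_exp_sub (a : Cov d₁ d₂) (i : Fin m) (t : ℕ) (c : ℝ) :
    MemLp (fun ω => Real.exp (inner ℝ a (V i t ω)) - c) 2 P := by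
  have h : MemLp (fun v : Cov d₁ d₂ => Real.exp (inner ℝ a v)) 2 (P.map (V i t)) := by
    rw [(hV.marginal i t).map_eq]; exact memLp_two_exp_inner a
  exact (h.comp_of_map (hV.marginal i t).aemeasurable).sub (memLp_const c)

/-- With y = aᵀ E(V Wᵀ) a for the two covariate vectors V and W, the covariance is exp(aᵀSa)(e^y -
1), and e^y - 1 ≤ |y| e^|y| transfers the geometric decay of y. An upper bound suffices, since these
covariances are only summed to bound a variance. -/
lemma integral_centered_exp_le (hS : S.PosSemidef) (hρ : 0 < ρ) (hρ' : ρ < 1) (a : Cov d₁ d₂)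
    (i j : Fin m) (s t : ℕ) :
    ∫ ω, (Real.exp (inner ℝ a (V i s ω)) - Real.exp (covForm S a a / 2))
        * (Real.exp (inner ℝ a (V j t ω)) - Real.exp (covForm S a a / 2)) ∂P
      ≤ expCovConst S K a * ρ ^ ((s - t) + (t - s)) := by
  -- The mixing hypothesis is stated for forward lags only; the pairing is symmetric.
  wlog hst : s ≤ t generalizing i j s t
  · have := this j i t s (by omega)
    simp_rw [mul_comm (Real.exp (inner ℝ a (V i s _)) - _)]
    rwa [add_comm (s - t)]
  obtain ⟨k, rfl⟩ := Nat.exists_eq_add_of_le hst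
  have hk : (s - (s + k)) + (s + k - s) = k := by omega
  rw [hk]
  set c := Real.exp (covForm S a a / 2) with hc
  have m0 := hV.memLp_exp_sub a i s 0
  have m0' := hV.memLp_exp_sub a j (s + k) 0
  simp only [sub_zero] at m0 m0'
  have i1 := m0.integrable one_le_two
  have i2 := m0'.integrable one_le_two
  have i12 : Integrable (fun ω => Real.exp (inner ℝ a (V i s ω))
      * Real.exp (inner ℝ a (V j (s + k) ω))) P := m0.integrable_mul m0'
  have hmean : ∀ (i : Fin m) (t : ℕ), ∫ ω, Real.exp (inner ℝ a (V i t ω)) ∂P = c := by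
    intro i t
    rw [hV.integral_comp i t (f := fun v => Real.exp (inner ℝ a v)) (by fun_prop),
      integral_exp_inner hS]
  have e : ∀ ω, (Real.exp (inner ℝ a (V i s ω)) - c) * (Real.exp (inner ℝ a (V j (s + k) ω)) - c)
      = Real.exp (inner ℝ a (V i s ω)) * Real.exp (inner ℝ a (V j (s + k) ω))
        - (c * Real.exp (inner ℝ a (V i s ω)) + c * Real.exp (inner ℝ a (V j (s + k) ω)) - c * c) :=
    fun ω => by ring
  simp_rw [e]
  have i3 : Integrable (fun ω => c * Real.exp (inner ℝ a (V i s ω))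
      + c * Real.exp (inner ℝ a (V j (s + k) ω))) P := (i1.const_mul c).add (i2.const_mul c)
  have i4 : Integrable (fun ω => c * Real.exp (inner ℝ a (V i s ω))
      + c * Real.exp (inner ℝ a (V j (s + k) ω)) - c * c) P := i3.sub (integrable_const _)
  rw [integral_sub i12 i4, integral_sub i3 (integrable_const _),
    integral_add (i1.const_mul c) (i2.const_mul c), integral_const_mul, integral_const_mul,
    hmean, hmean, hV.integral_exp_inner_add hS]
  have hcc : c * c = Real.exp (covForm S a a) := by
    rw [hc, ← Real.exp_add]; congr 1; ring
  simp only [integral_const, probReal_univ, smul_eq_mul, one_mul]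
  rw [hcc]
  set y := covForm (crossMoment P (V i s) (V j (s + k))) a a
  have hy : |y| ≤ ‖a‖ ^ 2 * (|K| * ρ ^ k) :=
    (hV.abs_covForm_crossMoment_le a i j s k).trans (by gcongr; exact le_abs_self K)
  have hρk : ρ ^ k ≤ 1 := pow_le_one₀ hρ.le hρ'.le
  have hy2 : |y| ≤ ‖a‖ ^ 2 * |K| := hy.trans (by
    rw [← mul_assoc]; exact mul_le_of_le_one_right (by positivity) hρk)
  have hey : Real.exp y - 1 ≤ |y| * Real.exp |y| := by
    have h1 := Real.one_sub_le_exp_neg y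
    have h2 : Real.exp y - 1 ≤ y * Real.exp y := by
      have : Real.exp y * (1 - y) ≤ Real.exp y * Real.exp (-y) := by gcongr
      rw [← Real.exp_add, add_neg_cancel, Real.exp_zero] at this
      linarith
    refine h2.trans ?_
    calc y * Real.exp y ≤ |y| * Real.exp y := by gcongr; exact le_abs_self y
      _ ≤ _ := by gcongr; exact le_abs_self y
  unfold expCovConst
  calc _ = Real.exp (covForm S a a) * (Real.exp y - 1) := by ring
    _ ≤ Real.exp (covForm S a a) * (‖a‖ ^ 2 * (|K| * ρ ^ k) * Real.exp (‖a‖ ^ 2 * |K|)) := by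
        gcongr
        refine hey.trans ?_
        gcongr
    _ = _ := by ring

/-- First absolute moment of centred sums of exponentials of the covariates. -/
lemma integral_abs_sum_exp_le (hS : S.PosSemidef) (hρ : 0 < ρ) (hρ' : ρ < 1) (a : Cov d₁ d₂)
    (T : ℕ) :
    ∫ ω, |∑ t ∈ Finset.range T, ∑ i, (Real.exp (inner ℝ a (V i t ω))
        - Real.exp (covForm S a a / 2))| ∂P
      ≤ m * √T * √(expCovConst S K a * (2 / (1 - ρ))) := by
  set c := Real.exp (covForm S a a / 2)
  set Z : ℕ × Fin m → Ω → ℝ := fun q ω => Real.exp (inner ℝ a (V q.2 q.1 ω)) - c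
  have hZ : ∀ q, MemLp (Z q) 2 P := fun q => hV.memLp_exp_sub a q.2 q.1 c
  have hsum : ∀ ω, ∑ t ∈ Finset.range T, ∑ i, (Real.exp (inner ℝ a (V i t ω)) - c)
      = ∑ q ∈ Finset.range T ×ˢ (Finset.univ : Finset (Fin m)), Z q ω := fun ω => by
    rw [Finset.sum_product]
  simp_rw [hsum]
  set W : Ω → ℝ := fun ω => ∑ q ∈ Finset.range T ×ˢ (Finset.univ : Finset (Fin m)), Z q ω
  have hW : MemLp W 2 P := memLp_finsetSum _ fun q _ => hZ q
  -- Firms share the common factor and may be strongly correlated at a given time, so averaging over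
  -- firms gains nothing: the bound is m² T rather than m T.
  have h2 : ∫ ω, W ω ^ 2 ∂P ≤ m ^ 2 * (T * (expCovConst S K a * (2 / (1 - ρ)))) := by
    have e : ∀ ω, W ω ^ 2 = ∑ q ∈ Finset.range T ×ˢ (Finset.univ : Finset (Fin m)),
        ∑ q' ∈ Finset.range T ×ˢ (Finset.univ : Finset (Fin m)), Z q ω * Z q' ω := fun ω => by
      rw [sq, Finset.sum_mul_sum]
    simp_rw [e]
    have hi : ∀ q q', Integrable (fun ω => Z q ω * Z q' ω) P := fun q q' =>
      (hZ q).integrable_mul (hZ q')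
    rw [integral_finsetSum _ fun q _ => integrable_finsetSum _ fun q' _ => hi q q']
    calc _ ≤ ∑ q ∈ Finset.range T ×ˢ (Finset.univ : Finset (Fin m)),
        ∑ q' ∈ Finset.range T ×ˢ (Finset.univ : Finset (Fin m)),
          expCovConst S K a * ρ ^ ((q.1 - q'.1) + (q'.1 - q.1)) := by
          refine Finset.sum_le_sum fun q _ => ?_
          rw [integral_finsetSum _ fun q' _ => hi q q']
          exact Finset.sum_le_sum fun q' _ =>
            hV.integral_centered_exp_le hS hρ hρ' a q.2 q'.2 q.1 q'.1
      _ = m ^ 2 * (expCovConst S K a *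
          ∑ s ∈ Finset.range T, ∑ t ∈ Finset.range T, ρ ^ ((s - t) + (t - s))) := by
          simp only [Finset.sum_product, Finset.sum_const, Finset.card_univ, Fintype.card_fin,
            nsmul_eq_mul, Finset.mul_sum]
          refine Finset.sum_congr rfl fun s _ => Finset.sum_congr rfl fun t _ => by ring
      _ ≤ m ^ 2 * (expCovConst S K a * (T * (2 / (1 - ρ)))) := by
          gcongr
          · exact expCovConst_nonneg a
          · exact sum_sum_pow_dist_le hρ hρ' T
      _ = _ := by ring
  -- The Cauchy–Schwarz inequality, obtained as nonnegativity of the variance of |W|.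
  have h1 : (∫ ω, |W ω| ∂P) ^ 2 ≤ ∫ ω, W ω ^ 2 ∂P := by
    have hv := variance_nonneg |W| P
    rw [variance_eq_sub hW.abs] at hv
    simp only [Pi.pow_apply, Pi.abs_apply, sq_abs] at hv
    linarith
  have hm : (m : ℝ) * √T * √(expCovConst S K a * (2 / (1 - ρ)))
      = √(m ^ 2 * (T * (expCovConst S K a * (2 / (1 - ρ))))) := by
    rw [Real.sqrt_mul (sq_nonneg (m : ℝ)), Real.sqrt_sq (Nat.cast_nonneg m),
      Real.sqrt_mul (Nat.cast_nonneg T), mul_assoc]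
  rw [hm]
  exact Real.le_sqrt_of_sq_le (h1.trans h2)

end IsCovariateProcess

/-- A uniform law of large numbers for `f` over all covariate processes with given marginal
covariance and mixing rate. -/
structure UniformLLN (S : Matrix (Fin d₁ ⊕ Fin d₂) (Fin d₁ ⊕ Fin d₂) ℝ) (K ρ : ℝ)
    (f : Cov d₁ d₂ → ℝ) : Prop where
  measurable : Measurable f
  integrable : Integrable f (multivariateGaussian 0 S)
  bound : ∀ ε > 0, ∃ B, 0 ≤ B ∧ ∀ (Ω : Type u) [MeasurableSpace Ω] (P : Measure Ω)
    [IsProbabilityMeasure P] (m : ℕ) (Y : ℕ → Ω → EuclideanSpace ℝ (Fin d₁))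
    (X : Fin m → ℕ → Ω → EuclideanSpace ℝ (Fin d₂)) (V : Fin m → ℕ → Ω → Cov d₁ d₂),
    IsCovariateProcess P S K ρ Y X V → ∀ T : ℕ,
    ∫ ω, |∑ t ∈ Finset.range T, ∑ i, (f (V i t ω) - ∫ v, f v ∂(multivariateGaussian 0 S))| ∂P
      ≤ m * T * ε + m * √T * B

namespace UniformLLN

lemma exp_inner (hS : S.PosSemidef) (hρ : 0 < ρ) (hρ' : ρ < 1) (a : Cov d₁ d₂) :
    UniformLLN.{u} S K ρ (fun v => Real.exp (inner ℝ a v)) where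
  measurable := by fun_prop
  integrable := integrable_exp_inner a
  bound := by
    intro ε hε
    refine ⟨√(expCovConst S K a * (2 / (1 - ρ))), by positivity, ?_⟩
    intro Ω _ P _ m Y X V hV T
    rw [integral_exp_inner hS]
    refine (hV.integral_abs_sum_exp_le hS hρ hρ' a T).trans ?_
    have : 0 ≤ (m : ℝ) * T * ε := by positivity
    linarith

lemma _root_.RareDefault.IsCovariateProcess.integrable_centered_sum {Ω : Type*}
    [MeasurableSpace Ω] {P : Measure Ω} [IsProbabilityMeasure P] {m : ℕ}
    {Y : ℕ → Ω → EuclideanSpace ℝ (Fin d₁)} {X : Fin m → ℕ → Ω → EuclideanSpace ℝ (Fin d₂)}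
    {V : Fin m → ℕ → Ω → Cov d₁ d₂} (hV : IsCovariateProcess P S K ρ Y X V) {f : Cov d₁ d₂ → ℝ}
    (hf : Integrable f (multivariateGaussian 0 S)) (T : ℕ) (c : ℝ) :
    Integrable (fun ω => ∑ t ∈ Finset.range T, ∑ i, (f (V i t ω) - c)) P :=
  integrable_finsetSum _ fun t _ => integrable_finsetSum _ fun i _ =>
    (hV.integrable_comp i t hf).sub (integrable_const c)

lemma add {f g : Cov d₁ d₂ → ℝ} (hf : UniformLLN.{u} S K ρ f) (hg : UniformLLN.{u} S K ρ g) :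
    UniformLLN.{u} S K ρ (fun v => f v + g v) where
  measurable := hf.measurable.add hg.measurable
  integrable := hf.integrable.add hg.integrable
  bound := by
    intro ε hε
    obtain ⟨B, hB, h1⟩ := hf.bound (ε / 2) (by positivity)
    obtain ⟨B', hB', h2⟩ := hg.bound (ε / 2) (by positivity)
    refine ⟨B + B', by positivity, ?_⟩
    intro Ω _ P _ m Y X V hV T
    have h3 := h1 Ω P m Y X V hV T
    have h4 := h2 Ω P m Y X V hV T
    rw [integral_add hf.integrable hg.integrable]
    set If := ∫ v, f v ∂(multivariateGaussian (0 : Cov d₁ d₂) S)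
    set Ig := ∫ v, g v ∂(multivariateGaussian (0 : Cov d₁ d₂) S)
    have i1 := (hV.integrable_centered_sum hf.integrable T If).abs
    have i2 := (hV.integrable_centered_sum hg.integrable T Ig).abs
    refine (integral_mono_of_nonneg (ae_of_all _ fun ω => abs_nonneg _) (i1.add i2)
      (ae_of_all _ fun ω => ?_)).trans (le_of_le_of_eq ?_ (by ring : m * T * (ε / 2) + m * √T * B
        + (m * T * (ε / 2) + m * √T * B') = _))
    · refine le_trans (le_of_eq ?_) (abs_add_le _ _)
      simp only [← Finset.sum_add_distrib]
      congr 1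
      exact Finset.sum_congr rfl fun t _ => Finset.sum_congr rfl fun i _ => by ring
    · simp only [Pi.add_apply]
      rw [integral_add i1 i2]
      exact add_le_add h3 h4

lemma const_mul {f : Cov d₁ d₂ → ℝ} (hf : UniformLLN.{u} S K ρ f) (r : ℝ) :
    UniformLLN.{u} S K ρ (fun v => r * f v) where
  measurable := hf.measurable.const_mul r
  integrable := hf.integrable.const_mul r
  bound := by
    intro ε hε
    obtain ⟨B, hB, h1⟩ := hf.bound (ε / (|r| + 1)) (by positivity)
    refine ⟨|r| * B, by positivity, ?_⟩
    intro Ω _ P _ m Y X V hV T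
    have h3 := h1 Ω P m Y X V hV T
    rw [integral_const_mul]
    simp only [← mul_sub, ← Finset.mul_sum, abs_mul]
    rw [integral_const_mul]
    calc _ ≤ |r| * (m * T * (ε / (|r| + 1)) + m * √T * B) := by gcongr
      _ = m * T * ε * (|r| / (|r| + 1)) + m * √T * (|r| * B) := by ring
      _ ≤ m * T * ε * 1 + m * √T * (|r| * B) := by
          gcongr
          rw [div_le_one (by positivity)]
          linarith
      _ = _ := by ring

/-- Replacing f by g costs at most ε/3 per observation and another ε/3 for the centring. The term m
T ε in the definition leaves room for this, and closure under L¹ limits is its purpose. -/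
lemma of_approx {f : Cov d₁ d₂ → ℝ} (hm : Measurable f)
    (hi : Integrable f (multivariateGaussian 0 S))
    (h : ∀ ε > 0, ∃ g, UniformLLN.{u} S K ρ g ∧
      ∫ v, |f v - g v| ∂(multivariateGaussian 0 S) ≤ ε) :
    UniformLLN.{u} S K ρ f where
  measurable := hm
  integrable := hi
  bound := by
    intro ε hε
    obtain ⟨g, hg, hfg⟩ := h (ε / 3) (by positivity)
    obtain ⟨B, hB, h1⟩ := hg.bound (ε / 3) (by positivity)
    refine ⟨B, hB, ?_⟩
    intro Ω _ P _ m Y X V hV T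
    have h3 := h1 Ω P m Y X V hV T
    set If := ∫ v, f v ∂(multivariateGaussian (0 : Cov d₁ d₂) S)
    set Ig := ∫ v, g v ∂(multivariateGaussian (0 : Cov d₁ d₂) S)
    have hII : |If - Ig| ≤ ε / 3 := by
      simp only [If, Ig]
      rw [← integral_sub hi hg.integrable]
      exact abs_integral_le_integral_abs.trans hfg
    have i2 := (hV.integrable_centered_sum hg.integrable T Ig).abs
    have i3 : ∀ i t, Integrable (fun ω => |f (V i t ω) - g (V i t ω)| + |If - Ig|) P := by
      intro i t
      have : Integrable (fun v => |f v - g v|) (multivariateGaussian 0 S) :=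
        (hi.sub hg.integrable).abs
      exact (hV.integrable_comp i t this).add (integrable_const _)
    have i4 : Integrable (fun ω => ∑ t ∈ Finset.range T, ∑ i,
        (|f (V i t ω) - g (V i t ω)| + |If - Ig|)) P :=
      integrable_finsetSum _ fun t _ => integrable_finsetSum _ fun i _ => i3 i t
    have hpt : ∀ ω, |∑ t ∈ Finset.range T, ∑ i, (f (V i t ω) - If)|
        ≤ |∑ t ∈ Finset.range T, ∑ i, (g (V i t ω) - Ig)|
          + ∑ t ∈ Finset.range T, ∑ i, (|f (V i t ω) - g (V i t ω)| + |If - Ig|) := by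
      intro ω
      have e : ∑ t ∈ Finset.range T, ∑ i, (f (V i t ω) - If)
          = ∑ t ∈ Finset.range T, ∑ i, (g (V i t ω) - Ig)
            + ∑ t ∈ Finset.range T, ∑ i, ((f (V i t ω) - g (V i t ω)) - (If - Ig)) := by
        simp only [← Finset.sum_add_distrib]
        refine Finset.sum_congr rfl fun t _ => Finset.sum_congr rfl fun i _ => by ring
      rw [e]
      refine (abs_add_le _ _).trans ?_
      gcongr
      refine (Finset.abs_sum_le_sum_abs _ _).trans (Finset.sum_le_sum fun t _ => ?_)
      refine (Finset.abs_sum_le_sum_abs _ _).trans (Finset.sum_le_sum fun i _ => ?_)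
      exact abs_sub _ _
    have hone : ∀ i t, ∫ ω, (|f (V i t ω) - g (V i t ω)| + |If - Ig|) ∂P ≤ ε / 3 + ε / 3 := by
      intro i t
      have h5 : Integrable (fun v => |f v - g v|) (multivariateGaussian 0 S) :=
        (hi.sub hg.integrable).abs
      rw [integral_add (hV.integrable_comp i t h5) (integrable_const _),
        hV.integral_comp i t (f := fun v => |f v - g v|) (hm.sub hg.measurable).abs]
      simpa using add_le_add hfg hII
    refine (integral_mono_of_nonneg (ae_of_all _ fun ω => abs_nonneg _) (i2.add i4)
      (ae_of_all _ hpt)).trans ?_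
    simp only [Pi.add_apply]
    rw [integral_add i2 i4,
      integral_finsetSum _ fun t _ => integrable_finsetSum _ fun i _ => i3 i t]
    have h6 : ∑ t ∈ Finset.range T, ∫ ω, ∑ i, (|f (V i t ω) - g (V i t ω)| + |If - Ig|) ∂P
        ≤ T * (m * (ε / 3 + ε / 3)) := by
      refine (Finset.sum_le_sum (g := fun _ => (m : ℝ) * (ε / 3 + ε / 3)) fun t _ => ?_).trans
        (by simp)
      rw [integral_finsetSum _ fun i _ => i3 i t]
      exact (Finset.sum_le_sum fun i _ => hone i t).trans (by simp [mul_add])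
    linarith

/-- The symmetric second difference of exp((b ± s w)·v), divided by s², tends in L¹ to (w·v)²
exp(b·v) as s → 0. So the law for exponentials implies this one without computing covariances of
polynomial functionals. -/
lemma inner_sq (hS : S.PosSemidef) (hρ : 0 < ρ) (hρ' : ρ < 1) (w b : Cov d₁ d₂) :
    UniformLLN.{u} S K ρ (fun v => inner ℝ w v ^ 2 * Real.exp (inner ℝ b v)) := by
  have hi : Integrable (fun v => inner ℝ w v ^ 2 * Real.exp (inner ℝ b v))
      (multivariateGaussian 0 S) := by
    refine integrable_of_le_norm_pow_mul_exp_inner (by fun_prop) (K := ‖w‖ ^ 2) (n := 2) (b := b)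
      fun v => ?_
    rw [abs_mul, Real.abs_exp, ← mul_assoc, ← mul_pow, abs_pow]
    gcongr
    exact abs_real_inner_le_norm w v
  refine of_approx (by fun_prop) hi fun ε hε => ?_
  set G : Cov d₁ d₂ → ℝ := fun v => 2 * ‖w‖ ^ 3 * (‖v‖ ^ 3 * Real.exp ((‖w‖ + ‖b‖) * ‖v‖))
  have hG : Integrable G (multivariateGaussian 0 S) := by
    refine Integrable.const_mul (integrable_of_le_exp_mul_norm (by fun_prop)
      (K := Nat.factorial 3) (s := 1 + (‖w‖ + ‖b‖)) fun v => ?_) _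
    rw [abs_of_nonneg (by positivity), one_add_mul (‖w‖ + ‖b‖), Real.exp_add, ← mul_assoc]
    gcongr
    exact pow_le_factorial_mul_exp (norm_nonneg v) 3
  set A := ∫ v, G v ∂(multivariateGaussian 0 S)
  have hA : 0 ≤ A := integral_nonneg fun v => by simp only [G, Pi.zero_apply]; positivity
  -- The approximation error is at most s A; s ≤ 1 allows a dominating function independent of s.
  set s := min 1 (ε / (A + 1))
  have hs : 0 < s := lt_min one_pos (by positivity)
  have hs1 : s ≤ 1 := min_le_left _ _
  refine ⟨_, (((exp_inner hS hρ hρ' (b + s • w)).add (exp_inner hS hρ hρ' (b + (-s) • w))).add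
    ((exp_inner hS hρ hρ' b).const_mul (-2))).const_mul (s ^ 2)⁻¹, ?_⟩
  have hpt : ∀ v, |inner ℝ w v ^ 2 * Real.exp (inner ℝ b v)
      - (s ^ 2)⁻¹ * (Real.exp (inner ℝ (b + s • w) v) + Real.exp (inner ℝ (b + -s • w) v)
        + -2 * Real.exp (inner ℝ b v))| ≤ s * G v := by
    intro v
    set y := inner ℝ w v with hy_def
    have hy : |y| ≤ ‖w‖ * ‖v‖ := abs_real_inner_le_norm w v
    have hk := abs_exp_add_exp_neg_sub_le (s * y)
    have e : inner ℝ w v ^ 2 * Real.exp (inner ℝ b v)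
      - (s ^ 2)⁻¹ * (Real.exp (inner ℝ (b + s • w) v) + Real.exp (inner ℝ (b + -s • w) v)
        + -2 * Real.exp (inner ℝ b v)) = -((s ^ 2)⁻¹ * Real.exp (inner ℝ b v) *
          (Real.exp (s * y) + Real.exp (-(s * y)) - 2 - (s * y) ^ 2)) := by
      simp only [inner_add_left, real_inner_smul_left, Real.exp_add, neg_mul, ← hy_def]
      field_simp
      ring
    rw [e, abs_neg, abs_mul, abs_of_nonneg (by positivity : 0 ≤ (s ^ 2)⁻¹ * Real.exp (inner ℝ b v))]
    have hsy : |s * y| ≤ ‖w‖ * ‖v‖ := by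
      rw [abs_mul, abs_of_pos hs]
      nlinarith [abs_nonneg y]
    calc _ ≤ (s ^ 2)⁻¹ * Real.exp (inner ℝ b v) * (2 * |s * y| ^ 3 * Real.exp |s * y|) := by gcongr
      _ = s * (2 * |y| ^ 3 * (Real.exp (inner ℝ b v) * Real.exp |s * y|)) := by
          rw [abs_mul, abs_of_pos hs]; field_simp
      _ ≤ s * (2 * (‖w‖ * ‖v‖) ^ 3 * (Real.exp (‖b‖ * ‖v‖) * Real.exp (‖w‖ * ‖v‖))) := by
          gcongr
          exact real_inner_le_norm b v
      _ = s * G v := by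
          simp only [G]
          rw [← Real.exp_add, add_comm (‖b‖ * ‖v‖), ← add_mul]
          ring
  refine (integral_mono_of_nonneg (ae_of_all _ fun v => abs_nonneg _) (hG.const_mul s)
    (ae_of_all _ hpt)).trans ?_
  rw [integral_const_mul]
  calc s * A ≤ ε / (A + 1) * A := by gcongr; exact min_le_right _ _
    _ = ε * (A / (A + 1)) := by ring
    _ ≤ ε * 1 := by gcongr; rw [div_le_one (by positivity)]; linarith
    _ = ε := mul_one ε

/-- Polarisation of the quadratic case. -/
lemma inner_mul_inner (hS : S.PosSemidef) (hρ : 0 < ρ) (hρ' : ρ < 1) (w e b : Cov d₁ d₂) :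
    UniformLLN.{u} S K ρ (fun v => inner ℝ w v * inner ℝ e v * Real.exp (inner ℝ b v)) := by
  have := ((inner_sq.{u} (K := K) hS hρ hρ' (w + e) b).add
    ((inner_sq.{u} hS hρ hρ' (w - e) b).const_mul (-1))).const_mul (1 / 4)
  convert! this using 2 with v
  rw [inner_add_left, inner_sub_left]
  ring

end UniformLLN

/-- Mixed second moments of linear functionals under exponential tilting. -/
lemma integral_inner_mul_inner_mul_exp_inner (hS : S.PosSemidef) (w e b : Cov d₁ d₂) :
    ∫ v, inner ℝ w v * inner ℝ e v * Real.exp (inner ℝ b v) ∂(multivariateGaussian 0 S)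
      = Real.exp (covForm S b b / 2) * (covForm S w e + covForm S w b * covForm S e b) := by
  have hsq : ∀ w : Cov d₁ d₂, Integrable (fun v => inner ℝ w v ^ 2 * Real.exp (inner ℝ b v))
      (multivariateGaussian 0 S) := fun w => by
    refine integrable_of_le_norm_pow_mul_exp_inner (by fun_prop) (K := ‖w‖ ^ 2) (n := 2) (b := b)
      fun v => ?_
    rw [abs_mul, Real.abs_exp, ← mul_assoc, ← mul_pow, abs_pow]
    gcongr
    exact abs_real_inner_le_norm w v
  have e1 : ∀ v, inner ℝ w v * inner ℝ e v * Real.exp (inner ℝ b v)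
      = 1 / 2 * (inner ℝ (w + e) v ^ 2 * Real.exp (inner ℝ b v)
        - (inner ℝ w v ^ 2 * Real.exp (inner ℝ b v)
          + inner ℝ e v ^ 2 * Real.exp (inner ℝ b v))) := fun v => by
    rw [inner_add_left]; ring
  simp_rw [e1]
  have hadd : Integrable (fun v => inner ℝ w v ^ 2 * Real.exp (inner ℝ b v)
      + inner ℝ e v ^ 2 * Real.exp (inner ℝ b v)) (multivariateGaussian 0 S) :=
    (hsq w).add (hsq e)
  rw [integral_const_mul, integral_sub (hsq _) hadd,
    integral_add (hsq _) (hsq _), integral_inner_sq_mul_exp_inner hS,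
    integral_inner_sq_mul_exp_inner hS, integral_inner_sq_mul_exp_inner hS]
  simp only [covForm_add_left, covForm_add_right]
  rw [covForm_comm hS e w]
  ring

end LawOfLargeNumbers

/-! ### Truncation and linearisation for a fixed γ -/

section FixedIntensity

variable {d₁ d₂ : ℕ}

/-- The weight of a default indicator in the score in direction `c`, truncated to `‖v‖ ≤ R` and
scaled by `ε`. -/
def scoreCoef (h : ℝ → ℝ) (β : Cov d₁ d₂) (γ R ε : ℝ) (c v : Cov d₁ d₂) : ℝ :=
  Set.indicator {v | ‖v‖ ≤ R}
    (fun v => ε * inner ℝ c v * scoreWeight h (inner ℝ β v - alpha γ)) v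

/-- Covariates of norm at most `R` have default probabilities in the range controlled by
`TailBound h M L`. -/
structure IsCutoff (β : Cov d₁ d₂) (L γ R : ℝ) : Prop where
  pos : 0 < γ
  le_one : γ ≤ 1
  nonneg : 0 ≤ R
  index_le : ∀ v : Cov d₁ d₂, ‖v‖ ≤ R → inner ℝ β v - alpha γ ≤ L - 1
  rate_le : ∀ v : Cov d₁ d₂, ‖v‖ ≤ R → γ * Real.exp (inner ℝ β v) ≤ √γ

variable {h : ℝ → ℝ} {M L : ℝ} {β : Cov d₁ d₂} {γ R ε : ℝ}

lemma exp_index (hγ : 0 < γ) (v : Cov d₁ d₂) :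
    Real.exp (inner ℝ β v - alpha γ) = γ * Real.exp (inner ℝ β v) := by
  rw [alpha, one_div, Real.log_inv, sub_neg_eq_add, Real.exp_add, Real.exp_log hγ, mul_comm]

section
variable (H : TailBound h M L)
include H

lemma TailBound.measurable_link : Measurable (link h) := by
  have := H.diff.continuous.measurable
  unfold link; fun_prop

lemma TailBound.measurable_scoreWeight : Measurable (scoreWeight h) := by
  have h1 := H.diff.continuous.measurable
  have h2 := H.diff_deriv.continuous.measurable
  have h3 := H.measurable_link
  unfold scoreWeight; fun_prop

lemma TailBound.measurable_defaultProb (a : ℝ) :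
    Measurable fun v : Cov d₁ d₂ => defaultProb h v β a := by
  have := H.measurable_link
  unfold defaultProb; fun_prop

lemma TailBound.measurable_scoreCoef (c : Cov d₁ d₂) : Measurable (scoreCoef h β γ R ε c) := by
  have := H.measurable_scoreWeight
  refine Measurable.indicator (by fun_prop) ?_
  exact measurableSet_le (by fun_prop) (by fun_prop)

variable (hc : IsCutoff β L γ R)
include hc

lemma IsCutoff.defaultProb_le {v : Cov d₁ d₂} (hv : ‖v‖ ≤ R) :
    0 ≤ defaultProb h v β (alpha γ) ∧ defaultProb h v β (alpha γ) ≤ 1 ∧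
      defaultProb h v β (alpha γ) ≤ 2 * (γ * Real.exp (inner ℝ β v)) := by
  have hx : inner ℝ β v - alpha γ ≤ L := by linarith [hc.index_le v hv]
  refine ⟨(H.link_pos hx).le, (H.link_le_quarter hx).trans (by norm_num), ?_⟩
  rw [← exp_index hc.pos]
  exact H.link_le hx

lemma IsCutoff.abs_scoreCoef_le (hε : 0 ≤ ε) (c v : Cov d₁ d₂) :
    |scoreCoef h β γ R ε c v| ≤ 2 * ε * ‖c‖ * R := by
  have hR := hc.nonneg
  by_cases hv : ‖v‖ ≤ R
  · have hx : inner ℝ β v - alpha γ ≤ L := by linarith [hc.index_le v hv]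
    rw [scoreCoef, Set.indicator_of_mem (by exact hv), abs_mul, abs_mul, abs_of_nonneg hε]
    calc _ ≤ ε * (‖c‖ * ‖v‖) * 2 := by
          gcongr
          · exact abs_real_inner_le_norm c v
          · exact H.abs_scoreWeight_le hx
      _ ≤ ε * (‖c‖ * R) * 2 := by gcongr
      _ = _ := by ring
  · rw [scoreCoef, Set.indicator_of_notMem (by exact hv), abs_zero]
    positivity

lemma IsCutoff.defaultProb_mem_of_scoreCoef_ne_zero (c v : Cov d₁ d₂)
    (hv : scoreCoef h β γ R ε c v ≠ 0) :
    0 ≤ defaultProb h v β (alpha γ) ∧ defaultProb h v β (alpha γ) ≤ 1 := by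
  have hv' : ‖v‖ ≤ R := by
    by_contra hn
    exact hv (Set.indicator_of_notMem (by exact hn) _)
  exact ⟨(hc.defaultProb_le H hv').1, (hc.defaultProb_le H hv').2.1⟩

/-- Inside the ball the tail expansion has relative error of order γ exp(β·v) ≤ √γ. Outside it the
truncated weight vanishes and the error is the whole intensity. -/
lemma IsCutoff.abs_varWeight_sub_le (c v : Cov d₁ d₂) :
    |varWeight (scoreCoef h β γ R ε c) (fun v => defaultProb h v β (alpha γ)) v
        - ε ^ 2 * γ * (inner ℝ c v ^ 2 * Real.exp (inner ℝ β v))|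
      ≤ ε ^ 2 * γ * (45 * (M + 1) * √γ * (inner ℝ c v ^ 2 * Real.exp (inner ℝ β v))
        + Set.indicator {v | ‖v‖ ≤ R}ᶜ (fun v => inner ℝ c v ^ 2 * Real.exp (inner ℝ β v)) v) := by
  have hγ := hc.pos
  have hM := H.nonneg
  unfold varWeight scoreCoef
  by_cases hv : ‖v‖ ≤ R
  · have hx : inner ℝ β v - alpha γ ≤ L := by linarith [hc.index_le v hv]
    have key := H.abs_variance_weight_sub_le hx
    rw [exp_index hγ] at key
    rw [Set.indicator_of_mem (by exact hv), Set.indicator_of_notMem (by simpa using hv), add_zero]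
    simp only [defaultProb]
    have e : (ε * inner ℝ c v * scoreWeight h (inner ℝ β v - alpha γ)) ^ 2
        * (link h (inner ℝ β v - alpha γ) * (1 - link h (inner ℝ β v - alpha γ)))
        - ε ^ 2 * γ * (inner ℝ c v ^ 2 * Real.exp (inner ℝ β v))
        = (ε * inner ℝ c v) ^ 2 * (scoreWeight h (inner ℝ β v - alpha γ) ^ 2
          * (link h (inner ℝ β v - alpha γ) * (1 - link h (inner ℝ β v - alpha γ)))
          - γ * Real.exp (inner ℝ β v)) := by ring
    rw [e, abs_mul, abs_of_nonneg (sq_nonneg _)]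
    calc _ ≤ (ε * inner ℝ c v) ^ 2 * (45 * (M + 1) * (γ * Real.exp (inner ℝ β v)) ^ 2) := by gcongr
      _ = (ε * inner ℝ c v) ^ 2 * (45 * (M + 1) * ((γ * Real.exp (inner ℝ β v))
          * (γ * Real.exp (inner ℝ β v)))) := by ring
      _ ≤ (ε * inner ℝ c v) ^ 2 * (45 * (M + 1) * (√γ * (γ * Real.exp (inner ℝ β v)))) := by
          gcongr
          exact hc.rate_le v hv
      _ = _ := by ring
  · rw [Set.indicator_of_notMem (by exact hv), Set.indicator_of_mem (by simpa using hv)]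
    have h1 : 0 ≤ inner ℝ c v ^ 2 * Real.exp (inner ℝ β v) := by positivity
    rw [zero_pow two_ne_zero, zero_mul, zero_sub, abs_neg, abs_of_nonneg (by positivity)]
    have h2 : 0 ≤ 45 * (M + 1) * √γ * (inner ℝ c v ^ 2 * Real.exp (inner ℝ β v)) := by positivity
    gcongr
    linarith

lemma IsCutoff.varWeight_le (c v : Cov d₁ d₂) :
    varWeight (scoreCoef h β γ R ε c) (fun v => defaultProb h v β (alpha γ)) v
      ≤ ε ^ 2 * γ * (46 * (M + 1)) * (inner ℝ c v ^ 2 * Real.exp (inner ℝ β v)) := by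
  have hγ := hc.pos
  have hM := H.nonneg
  by_cases hv : ‖v‖ ≤ R
  · have h0 := (abs_le.1 (hc.abs_varWeight_sub_le (ε := ε) H c v)).2
    rw [Set.indicator_of_notMem (by simpa using hv), add_zero] at h0
    have h1 : √γ ≤ 1 := Real.sqrt_le_one.2 hc.le_one
    have h2 : 0 ≤ ε ^ 2 * γ * (inner ℝ c v ^ 2 * Real.exp (inner ℝ β v)) := by positivity
    have h3 : ε ^ 2 * γ * (45 * (M + 1) * √γ * (inner ℝ c v ^ 2 * Real.exp (inner ℝ β v)))
        ≤ 45 * (M + 1) * (ε ^ 2 * γ * (inner ℝ c v ^ 2 * Real.exp (inner ℝ β v))) := by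
      calc _ = 45 * (M + 1) * (ε ^ 2 * γ * (inner ℝ c v ^ 2 * Real.exp (inner ℝ β v))) * √γ := by
            ring
        _ ≤ _ := mul_le_of_le_one_right (by positivity) h1
    nlinarith
  · have : varWeight (scoreCoef h β γ R ε c) (fun v => defaultProb h v β (alpha γ)) v = 0 := by
      unfold varWeight scoreCoef
      rw [Set.indicator_of_notMem (by exact hv)]
      ring
    rw [this]
    positivity

/-- First-order expansion of one summand of the score. -/
lemma IsCutoff.abs_score_term_sub_le {v u : Cov d₁ d₂} (hv : ‖v‖ ≤ R) (hε : 0 ≤ ε)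
    (hu : ε * ‖u‖ * R ≤ 1) {D : ℝ} (hD : 0 ≤ D) :
    |(D - link h (inner ℝ β v - alpha γ)) * scoreWeight h (inner ℝ β v - alpha γ)
      - (D - link h (inner ℝ (β + ε • u) v - alpha γ))
        * scoreWeight h (inner ℝ (β + ε • u) v - alpha γ)
      - ε * inner ℝ u v * (γ * Real.exp (inner ℝ β v))|
    ≤ 270 * (M + 1) * (ε * ‖u‖ * ‖v‖) * (√γ * D
        + (ε * ‖u‖ * R + √γ) * (γ * Real.exp (inner ℝ β v))) := by
  have hγ := hc.pos
  have hM := H.nonneg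
  have hx : inner ℝ β v - alpha γ ≤ L := by linarith [hc.index_le v hv]
  set x := inner ℝ β v - alpha γ with hxdef
  have hy : inner ℝ (β + ε • u) v - alpha γ = x + ε * inner ℝ u v := by
    rw [inner_add_left, real_inner_smul_left]; ring
  rw [hy]
  set y := x + ε * inner ℝ u v
  have hyx : y - x = ε * inner ℝ u v := by ring
  have hη : |y - x| ≤ ε * ‖u‖ * ‖v‖ := by
    rw [hyx, abs_mul, abs_of_nonneg hε, mul_assoc]
    gcongr
    exact abs_real_inner_le_norm u v
  have hη2 : |y - x| ≤ ε * ‖u‖ * R := hη.trans (by gcongr)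
  have hη1 : |y - x| ≤ 1 := hη2.trans hu
  -- The cutoff keeps the index below L - 1, precisely so that a shift by at most one stays in the
  -- controlled range.
  have hyL : y ≤ L := by
    have h1 := (abs_le.1 hη1).2
    have h2 := hc.index_le v hv
    linarith
  have k1 := H.abs_scoreWeight_sub_le hx hyL hη1
  have k2 := H.abs_link_mul_scoreWeight_sub_le hx hyL hη1
  have hex : Real.exp x = γ * Real.exp (inner ℝ β v) := exp_index hγ v
  rw [hex] at k1 k2
  have hrate := hc.rate_le v hv
  set g := γ * Real.exp (inner ℝ β v)
  have hg : 0 < g := by positivity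
  have e : (D - link h x) * scoreWeight h x - (D - link h y) * scoreWeight h y
      - ε * inner ℝ u v * g = -(D * (scoreWeight h y - scoreWeight h x))
        + (link h y * scoreWeight h y - link h x * scoreWeight h x - g * (y - x)) := by
    rw [hyx]; ring
  rw [e]
  set N := ε * ‖u‖ * ‖v‖
  have hN : 0 ≤ N := (abs_nonneg _).trans hη
  calc _ ≤ D * (30 * (M + 1) * g * |y - x|) + 270 * (M + 1) * g * |y - x| * (|y - x| + g) := by
        refine (abs_add_le _ _).trans (add_le_add ?_ k2)
        rw [abs_neg, abs_mul, abs_of_nonneg hD]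
        gcongr
    _ ≤ D * (270 * (M + 1) * √γ * N) + 270 * (M + 1) * g * N * (ε * ‖u‖ * R + √γ) := by
        gcongr
        norm_num
    _ = _ := by ring

end

section Processes

variable {Ω : Type*} {m T : ℕ} {V : Fin m → ℕ → Ω → Cov d₁ d₂} {D : Fin m → ℕ → Ω → ℝ}

/-- This trades the random range of observation for survival indicators on a fixed range. Positivity
of T is needed because the last time is at most T - 1 in truncated subtraction. -/
lemma sum_range_lastTime_eq (hT : 0 < T) (i : Fin m) (ω : Ω) (f : ℕ → ℝ) :
    ∑ t ∈ Finset.range (lastTime T D i ω + 1), f t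
      = ∑ t ∈ Finset.range T, alive T D i t ω * f t := by
  rw [← Finset.sum_subset (range_lastTime_subset (T := T) (D := D) hT i ω)]
  · refine Finset.sum_congr rfl fun t ht => ?_
    have : t ≤ lastTime T D i ω := by simp only [Finset.mem_range] at ht; omega
    rw [alive, Set.indicator_of_mem (by exact this), one_mul]
  · intro t _ ht
    have : ¬ t ≤ lastTime T D i ω := by simp only [Finset.mem_range] at ht; omega
    rw [alive, Set.indicator_of_notMem (by exact this), zero_mul]

/-- Linearisation of the score equation at a maximiser `β + ε u` of the likelihood. -/
lemma IsCutoff.abs_scoreSum_sub_le (H : TailBound h M L) (hc : IsCutoff β L γ R)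
    (hD : ∀ i t ω, D i t ω = 0 ∨ D i t ω = 1) (hT : 0 < T) (hε : 0 ≤ ε) {u : Cov d₁ d₂}
    (hu : ε * ‖u‖ * R ≤ 1) {ω : Ω} (hV : ∀ i, ∀ t < T, ‖V i t ω‖ ≤ R)
    (hmax : ∀ b, likelihood T h V D b (alpha γ) ω ≤ likelihood T h V D (β + ε • u) (alpha γ) ω)
    (c : Cov d₁ d₂) :
    |scoreSum T (scoreCoef h β γ R ε c) (fun v => defaultProb h v β (alpha γ)) V D T ω
      - ε ^ 2 * γ * ∑ t ∈ Finset.range T, ∑ i,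
          inner ℝ c (V i t ω) * inner ℝ u (V i t ω) * Real.exp (inner ℝ β (V i t ω))|
    ≤ ‖c‖ * ‖u‖ * (270 * (M + 1)) * (ε ^ 2 * γ * (∑ t ∈ Finset.range T, ∑ i,
        (1 - alive T D i t ω) * (‖V i t ω‖ ^ 2 * Real.exp (inner ℝ β (V i t ω))))
      + √γ * (ε ^ 2 * ∑ t ∈ Finset.range T, ∑ i,
          Set.indicator {v | ‖v‖ ≤ R} (fun v => ‖v‖ ^ 2) (V i t ω) * D i (t + 1) ω)
      + (ε * ‖u‖ * R + √γ) * (ε ^ 2 * γ * ∑ t ∈ Finset.range T, ∑ i,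
          ‖V i t ω‖ ^ 2 * Real.exp (inner ℝ β (V i t ω)))) := by
  have hM := H.nonneg
  have hγ := hc.pos
  have hR := hc.nonneg
  have hfoc := H.score_eq_zero hD hmax (fun i t ht => by
    have ht' : t < T := Finset.mem_range.1 (range_lastTime_subset hT i ω ht)
    rw [inner_add_left, real_inner_smul_left]
    have h1 := hc.index_le _ (hV i t ht')
    have h2 : ε * inner ℝ u (V i t ω) ≤ 1 := by
      refine le_trans ?_ hu
      rw [mul_assoc]
      gcongr
      exact (real_inner_le_norm _ _).trans (by gcongr; exact hV i t ht')
    linarith) c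
  simp only [sum_range_lastTime_eq hT] at hfoc
  rw [Finset.sum_comm] at hfoc
  set g : Fin m → ℕ → ℝ := fun i t => γ * Real.exp (inner ℝ β (V i t ω)) with hg
  -- Subtracting ε times the vanishing score at the maximiser turns the score at β into an
  -- increment. The Hessian sum runs over all periods, whence the separate terms carrying 1 - alive
  -- for firms already in default.
  have hstart : scoreSum T (scoreCoef h β γ R ε c) (fun v => defaultProb h v β (alpha γ)) V D T ω
      - ε ^ 2 * γ * ∑ t ∈ Finset.range T, ∑ i,
          inner ℝ c (V i t ω) * inner ℝ u (V i t ω) * Real.exp (inner ℝ β (V i t ω))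
      = ∑ t ∈ Finset.range T, ∑ i, (alive T D i t ω * (ε * inner ℝ c (V i t ω)) *
        ((D i (t + 1) ω - link h (inner ℝ β (V i t ω) - alpha γ))
          * scoreWeight h (inner ℝ β (V i t ω) - alpha γ)
        - (D i (t + 1) ω - link h (inner ℝ (β + ε • u) (V i t ω) - alpha γ))
          * scoreWeight h (inner ℝ (β + ε • u) (V i t ω) - alpha γ)
        - ε * inner ℝ u (V i t ω) * g i t)
        - (1 - alive T D i t ω) * (ε ^ 2 * (inner ℝ c (V i t ω) * inner ℝ u (V i t ω)) * g i t)) := by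
    have : scoreSum T (scoreCoef h β γ R ε c) (fun v => defaultProb h v β (alpha γ)) V D T ω
        = scoreSum T (scoreCoef h β γ R ε c) (fun v => defaultProb h v β (alpha γ)) V D T ω
          - ε * ∑ t ∈ Finset.range T, ∑ i, alive T D i t ω *
            ((D i (t + 1) ω - link h (inner ℝ (β + ε • u) (V i t ω) - alpha γ))
              * scoreWeight h (inner ℝ (β + ε • u) (V i t ω) - alpha γ) * inner ℝ c (V i t ω)) := by
      rw [hfoc, mul_zero, sub_zero]
    rw [this]
    simp only [scoreSum, Finset.mul_sum, ← Finset.sum_sub_distrib]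
    refine Finset.sum_congr rfl fun t ht => Finset.sum_congr rfl fun i _ => ?_
    have hvt := hV i t (Finset.mem_range.1 ht)
    rw [scoreIncr, scoreCoef, Set.indicator_of_mem (by exact hvt), defaultProb]
    simp only [hg]
    ring
  rw [hstart]
  simp only [Finset.mul_sum, ← Finset.sum_add_distrib]
  refine (Finset.abs_sum_le_sum_abs _ _).trans (Finset.sum_le_sum fun t ht => ?_)
  refine (Finset.abs_sum_le_sum_abs _ _).trans (Finset.sum_le_sum fun i _ => ?_)
  have hvt := hV i t (Finset.mem_range.1 ht)
  have hD0 : 0 ≤ D i (t + 1) ω := by rcases hD i (t + 1) ω with h0 | h0 <;> simp [h0]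
  have key := hc.abs_score_term_sub_le H hvt hε hu hD0
  rw [Set.indicator_of_mem (by exact hvt)]
  set v := V i t ω
  set B := (D i (t + 1) ω - link h (inner ℝ β v - alpha γ)) * scoreWeight h (inner ℝ β v - alpha γ)
      - (D i (t + 1) ω - link h (inner ℝ (β + ε • u) v - alpha γ))
        * scoreWeight h (inner ℝ (β + ε • u) v - alpha γ)
      - ε * inner ℝ u v * (γ * Real.exp (inner ℝ β v))
  have ha0 := alive_nonneg (T := T) (D := D) i t ω
  have ha1 := alive_le_one (T := T) (D := D) i t ω
  have hcv : |inner ℝ c v| ≤ ‖c‖ * ‖v‖ := abs_real_inner_le_norm c v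
  have huv : |inner ℝ u v| ≤ ‖u‖ * ‖v‖ := abs_real_inner_le_norm u v
  have hE := Real.exp_pos (inner ℝ β v)
  change |alive T D i t ω * (ε * inner ℝ c v) * B
    - (1 - alive T D i t ω) * (ε ^ 2 * (inner ℝ c v * inner ℝ u v) * (γ * Real.exp (inner ℝ β v)))|
      ≤ _
  have hb1 : |alive T D i t ω * (ε * inner ℝ c v) * B| ≤ 1 * (ε * (‖c‖ * ‖v‖)) *
      (270 * (M + 1) * (ε * ‖u‖ * ‖v‖) * (√γ * D i (t + 1) ω
        + (ε * ‖u‖ * R + √γ) * (γ * Real.exp (inner ℝ β v)))) := by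
    rw [abs_mul, abs_mul, abs_mul, abs_of_nonneg ha0, abs_of_nonneg hε]
    gcongr
  have hb2 : |(1 - alive T D i t ω)
      * (ε ^ 2 * (inner ℝ c v * inner ℝ u v) * (γ * Real.exp (inner ℝ β v)))|
      ≤ (1 - alive T D i t ω) * (ε ^ 2 * ((‖c‖ * ‖v‖) * (‖u‖ * ‖v‖))
        * (γ * Real.exp (inner ℝ β v))) := by
    have : 0 ≤ 1 - alive T D i t ω := by linarith
    rw [abs_mul, abs_of_nonneg this, abs_mul, abs_mul, abs_mul, abs_of_nonneg (sq_nonneg ε),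
      abs_of_pos (by positivity : 0 < γ * Real.exp (inner ℝ β v))]
    gcongr
  -- The factor 270 (M + 1) ≥ 1 is inserted only to have one constant in front of all three error
  -- terms.
  have hlast : (1 - alive T D i t ω) * (ε ^ 2 * ((‖c‖ * ‖v‖) * (‖u‖ * ‖v‖))
        * (γ * Real.exp (inner ℝ β v)))
      ≤ 270 * (M + 1) * ((1 - alive T D i t ω) * (ε ^ 2 * ((‖c‖ * ‖v‖) * (‖u‖ * ‖v‖))
        * (γ * Real.exp (inner ℝ β v)))) := by
    have : 0 ≤ 1 - alive T D i t ω := by linarith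
    have h3 : 0 ≤ (1 - alive T D i t ω) * (ε ^ 2 * ((‖c‖ * ‖v‖) * (‖u‖ * ‖v‖))
        * (γ * Real.exp (inner ℝ β v))) := by positivity
    nlinarith
  refine (abs_sub _ _).trans ((add_le_add hb1 (hb2.trans hlast)).trans (le_of_eq ?_))
  ring

end Processes

end FixedIntensity

/-! ### Mean size of the truncation and survival errors -/

section ErrorBounds

/-- Young's inequality with weight √s, together with z² ≤ z on [0, 1]. -/
lemma mul_le_half_sqrt {z f s : ℝ} (hz : 0 ≤ z) (hz1 : z ≤ 1) (hs : 0 < s) :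
    z * f ≤ (√s)⁻¹ * z + √s * f ^ 2 := by
  have hq : 0 < √s := Real.sqrt_pos.2 hs
  have h1 : 2 * (z * f) ≤ (√s)⁻¹ * z ^ 2 + √s * f ^ 2 := by
    have : 0 ≤ √s * ((√s)⁻¹ * z - f) ^ 2 := by positivity
    have e : √s * ((√s)⁻¹ * z - f) ^ 2 = (√s)⁻¹ * z ^ 2 + √s * f ^ 2 - 2 * (z * f) := by
      field_simp
      ring
    linarith
  have h2 : (√s)⁻¹ * z ^ 2 ≤ (√s)⁻¹ * z := by
    have : z ^ 2 ≤ z := by nlinarith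
    gcongr
  have h3 : 0 ≤ (√s)⁻¹ * z := by positivity
  have h4 : 0 ≤ √s * f ^ 2 := by positivity
  linarith

/-- An integral over an event of small probability is small for square integrable integrands. -/
lemma integral_mul_le_sqrt {α : Type*} [MeasurableSpace α] {μ : Measure α} {Z F : α → ℝ} {s : ℝ}
    (hZ0 : ∀ x, 0 ≤ Z x) (hZ1 : ∀ x, Z x ≤ 1) (hZ : Integrable Z μ) (hF0 : ∀ x, 0 ≤ F x)
    (hF : Integrable (fun x => F x ^ 2) μ) (hs : 0 < s) (hZs : ∫ x, Z x ∂μ ≤ s) :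
    ∫ x, Z x * F x ∂μ ≤ √s * (∫ x, F x ^ 2 ∂μ + 1) := by
  have hq : 0 < √s := Real.sqrt_pos.2 hs
  refine (integral_mono_of_nonneg (ae_of_all _ fun x => mul_nonneg (hZ0 x) (hF0 x))
    ((hZ.const_mul (√s)⁻¹).add (hF.const_mul √s))
    (ae_of_all _ fun x => mul_le_half_sqrt (hZ0 x) (hZ1 x) hs)).trans ?_
  simp only [Pi.add_apply]
  rw [integral_add (hZ.const_mul _) (hF.const_mul _), integral_const_mul, integral_const_mul]
  have : (√s)⁻¹ * ∫ x, Z x ∂μ ≤ √s := by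
    rw [inv_mul_le_iff₀ hq, Real.mul_self_sqrt hs.le]
    exact hZs
  linarith

variable {Ω : Type*} [mΩ : MeasurableSpace Ω] {P : Measure Ω} [IsProbabilityMeasure P]
  {m d₁ d₂ T : ℕ} {S : Matrix (Fin d₁ ⊕ Fin d₂) (Fin d₁ ⊕ Fin d₂) ℝ} {K ρ : ℝ}
  {Y : ℕ → Ω → EuclideanSpace ℝ (Fin d₁)} {X : Fin m → ℕ → Ω → EuclideanSpace ℝ (Fin d₂)}
  {V : Fin m → ℕ → Ω → Cov d₁ d₂} {D : Fin m → ℕ → Ω → ℝ}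
  {h : ℝ → ℝ} {M L : ℝ} {β : Cov d₁ d₂} {γ R ε s : ℝ}

/-- A bound for the probability that a given firm defaults before the horizon. -/
def lossBound (S : Matrix (Fin d₁ ⊕ Fin d₂) (Fin d₁ ⊕ Fin d₂) ℝ) (β : Cov d₁ d₂) (γ R : ℝ)
    (T : ℕ) : ℝ :=
  T * (2 * (γ * ∫ v, Real.exp (inner ℝ β v) ∂(multivariateGaussian 0 S))
    + (multivariateGaussian (0 : Cov d₁ d₂) S).real {v | ‖v‖ ≤ R}ᶜ)

lemma measurableSet_norm_le (R : ℝ) : MeasurableSet {v : Cov d₁ d₂ | ‖v‖ ≤ R} :=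
  measurableSet_le measurable_norm measurable_const

omit [IsProbabilityMeasure P] in
lemma IsDefaultProcess.measurable_alive {p : Cov d₁ d₂ → ℝ} (hD : IsDefaultProcess P T p V D)
    (hV : ∀ i t, Measurable (V i t)) {t : ℕ} (ht : t < T) (i : Fin m) :
    Measurable (alive T D i t) :=
  (measurable_history_alive ht i).mono (history_le hV hD.measurable t) le_rfl

-- A firm no longer alive at t has defaulted in some earlier period; this is a union bound in
-- pointwise form.
omit mΩ in
lemma one_sub_alive_le (h01 : ∀ i t ω, D i t ω = 0 ∨ D i t ω = 1) {t : ℕ} (ht : t < T) (i : Fin m)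
    (ω : Ω) : 1 - alive T D i t ω ≤ ∑ u ∈ Finset.range t, D i (u + 1) ω := by
  have hn : ∀ u ∈ Finset.range t, 0 ≤ D i (u + 1) ω := fun u _ => by
    rcases h01 i (u + 1) ω with h | h <;> simp [h]
  by_cases hω : t ≤ lastTime T D i ω
  · rw [alive, Set.indicator_of_mem (by exact hω), sub_self]
    exact Finset.sum_nonneg hn
  · rw [le_lastTime_iff ht] at hω
    push Not at hω
    obtain ⟨u, hu, hu1⟩ := hω
    rw [← hu1]
    refine le_trans ?_ (Finset.single_le_sum hn (Finset.mem_range.2 hu))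
    rw [hu1]
    linarith [alive_nonneg (T := T) (D := D) i t ω]

variable (H : TailBound h M L) (hc : IsCutoff β L γ R) (hV : IsCovariateProcess P S K ρ Y X V)
  (hD : IsDefaultProcess P T (fun v => defaultProb h v β (alpha γ)) V D)

namespace IsCutoff
include H hc hV hD

/-- Conditioning replaces the default by its hazard, which on the ball is at most 2γ exp(β·v). The
truncation also keeps the test function bounded, as the conditioning step requires. -/
lemma integral_indicator_mul_default_le {g : Cov d₁ d₂ → ℝ} (hg : Measurable g)
    (hg0 : ∀ v, 0 ≤ g v) {B : ℝ} (hB : ∀ v, ‖v‖ ≤ R → g v ≤ B)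
    (hint : Integrable (fun v => g v * Real.exp (inner ℝ β v)) (multivariateGaussian 0 S))
    {t : ℕ} (ht : t < T) (i : Fin m) :
    ∫ ω, Set.indicator {v | ‖v‖ ≤ R} g (V i t ω) * D i (t + 1) ω ∂P
      ≤ 2 * (γ * ∫ v, g v * Real.exp (inner ℝ β v) ∂(multivariateGaussian 0 S)) := by
  have hγ := hc.pos
  have hind : Measurable (Set.indicator {v : Cov d₁ d₂ | ‖v‖ ≤ R} g) :=
    hg.indicator (measurableSet_norm_le R)
  have hind0 : ∀ v, 0 ≤ Set.indicator {v : Cov d₁ d₂ | ‖v‖ ≤ R} g v :=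
    fun v => Set.indicator_nonneg (fun v _ => hg0 v) v
  have hB' : ∀ ω, |Set.indicator {v : Cov d₁ d₂ | ‖v‖ ≤ R} g (V i t ω)| ≤ |B| := by
    intro ω
    rw [abs_of_nonneg (hind0 _)]
    by_cases hv : ‖V i t ω‖ ≤ R
    · rw [Set.indicator_of_mem (by exact hv)]
      exact (hB _ hv).trans (le_abs_self B)
    · rw [Set.indicator_of_notMem (by exact hv)]
      exact abs_nonneg B
  rw [hD.integral_mul_default hV.measurable (H.measurable_defaultProb _) ht
    (Finset.notMem_empty i)
    (W := fun ω => Set.indicator {v | ‖v‖ ≤ R} g (V i t ω))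
    (hind.comp ((measurable_history_cov le_rfl i).mono (history_le_blockHistory t ∅) le_rfl)) hB']
  have hpt : ∀ ω, 0 ≤ Set.indicator {v | ‖v‖ ≤ R} g (V i t ω)
        * hazard T (fun v => defaultProb h v β (alpha γ)) V D i t ω ∧
      Set.indicator {v | ‖v‖ ≤ R} g (V i t ω)
        * hazard T (fun v => defaultProb h v β (alpha γ)) V D i t ω
      ≤ 2 * (γ * (g (V i t ω) * Real.exp (inner ℝ β (V i t ω)))) := by
    intro ω
    have h1 := hg0 (V i t ω)
    have ha := alive_nonneg (T := T) (D := D) i t ω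
    have ha1 := alive_le_one (T := T) (D := D) i t ω
    rw [hazard_eq]
    by_cases hv : ‖V i t ω‖ ≤ R
    · obtain ⟨p0, _, p2⟩ := hc.defaultProb_le H hv
      rw [Set.indicator_of_mem (by exact hv)]
      refine ⟨by positivity, ?_⟩
      calc _ ≤ g (V i t ω) * (1 * (2 * (γ * Real.exp (inner ℝ β (V i t ω))))) := by gcongr
        _ = _ := by ring
    · rw [Set.indicator_of_notMem (by exact hv), zero_mul]
      exact ⟨le_rfl, by positivity⟩
  refine (integral_mono_of_nonneg (ae_of_all _ fun ω => (hpt ω).1)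
    (((hV.integrable_comp i t hint).const_mul γ).const_mul 2)
    (ae_of_all _ fun ω => (hpt ω).2)).trans (le_of_eq ?_)
  rw [integral_const_mul, integral_const_mul,
    hV.integral_comp i t (f := fun v => g v * Real.exp (inner ℝ β v)) (by fun_prop)]

/-- Inside the ball the hazard bound applies; outside it the indicator is bounded by one, because
nothing is known about the link there. -/
lemma integral_default_le {t : ℕ} (ht : t < T) (i : Fin m) :
    ∫ ω, D i (t + 1) ω ∂P
      ≤ 2 * (γ * ∫ v, Real.exp (inner ℝ β v) ∂(multivariateGaussian 0 S))
        + (multivariateGaussian (0 : Cov d₁ d₂) S).real {v | ‖v‖ ≤ R}ᶜ := by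
  have h1 := hc.integral_indicator_mul_default_le H hV hD (g := fun _ => 1) measurable_const
    (fun _ => zero_le_one) (fun _ _ => le_rfl) (by simpa using integrable_exp_inner β) ht i
  simp only [one_mul] at h1
  have hG := measurableSet_norm_le (d₁ := d₁) (d₂ := d₂) R
  have m1 : Measurable fun ω => Set.indicator {v | ‖v‖ ≤ R} (fun _ => (1 : ℝ)) (V i t ω) :=
    (measurable_const.indicator hG).comp (hV.measurable i t)
  have m2 : Measurable fun ω => Set.indicator {v | ‖v‖ ≤ R}ᶜ (fun _ => (1 : ℝ)) (V i t ω) :=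
    (measurable_const.indicator hG.compl).comp (hV.measurable i t)
  have hi : ∀ (A : Set (Cov d₁ d₂)) v, |Set.indicator A (fun _ => (1 : ℝ)) v| ≤ 1 := by
    intro A v
    by_cases hv : v ∈ A <;> simp [hv]
  have i1 : Integrable (fun ω => Set.indicator {v | ‖v‖ ≤ R} (fun _ => (1 : ℝ)) (V i t ω)
      * D i (t + 1) ω) P := by
    refine integrable_of_measurable_bounded (m1.mul (hD.measurable i _)) (K := 1) fun ω => ?_
    rw [abs_mul]
    exact mul_le_one₀ (hi _ _) (abs_nonneg _) (hD.abs_le_one i _ ω)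
  have i2 : Integrable (fun ω => Set.indicator {v | ‖v‖ ≤ R}ᶜ (fun _ => (1 : ℝ)) (V i t ω)) P :=
    integrable_of_measurable_bounded m2 fun ω => hi _ _
  have hle : ∀ ω, D i (t + 1) ω ≤ Set.indicator {v | ‖v‖ ≤ R} (fun _ => (1 : ℝ)) (V i t ω)
      * D i (t + 1) ω + Set.indicator {v | ‖v‖ ≤ R}ᶜ (fun _ => (1 : ℝ)) (V i t ω) := by
    intro ω
    by_cases hv : ‖V i t ω‖ ≤ R
    · rw [Set.indicator_of_mem (by exact hv), Set.indicator_of_notMem (by simpa using hv)]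
      linarith
    · rw [Set.indicator_of_notMem (by exact hv), Set.indicator_of_mem (by simpa using hv)]
      linarith [(abs_le.1 (hD.abs_le_one i (t + 1) ω)).2]
  refine (integral_mono (hD.integrable i _) (i1.add i2) hle).trans ?_
  simp only [Pi.add_apply]
  rw [integral_add i1 i2]
  refine add_le_add h1 (le_of_eq ?_)
  rw [hV.integral_comp i t (measurable_const.indicator hG.compl), integral_indicator_const _ hG.compl,
    smul_eq_mul, mul_one]

lemma integral_one_sub_alive_le {t : ℕ} (ht : t < T) (i : Fin m) :
    ∫ ω, (1 - alive T D i t ω) ∂P ≤ lossBound S β γ R T := by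
  have hγ := hc.pos
  have ha := hD.measurable_alive hV.measurable ht i
  have i1 : Integrable (fun ω => 1 - alive T D i t ω) P := by
    refine integrable_of_measurable_bounded (by fun_prop) (K := 1) fun ω => ?_
    rcases alive_eq_zero_or_one (T := T) (D := D) i t ω with h | h <;> simp [h]
  refine (integral_mono i1 (integrable_finsetSum _ fun u _ => hD.integrable i (u + 1))
    (one_sub_alive_le hD.zero_or_one ht i)).trans ?_
  rw [integral_finsetSum _ fun u _ => hD.integrable i (u + 1)]
  refine (Finset.sum_le_sum fun u hu => hc.integral_default_le H hV hD
    ((Finset.mem_range.1 hu).trans ht) i).trans ?_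
  rw [Finset.sum_const, Finset.card_range, nsmul_eq_mul, lossBound]
  have : 0 ≤ ∫ v, Real.exp (inner ℝ β v) ∂(multivariateGaussian 0 S) :=
    integral_nonneg fun v => (Real.exp_pos _).le
  gcongr

lemma integral_one_sub_alive_mul_le (hs : 0 < s) (hls : lossBound S β γ R T ≤ s)
    {F : Cov d₁ d₂ → ℝ} (hF : Measurable F) (hF0 : ∀ v, 0 ≤ F v)
    (hF2 : Integrable (fun v => F v ^ 2) (multivariateGaussian 0 S))
    {t : ℕ} (ht : t < T) (i : Fin m) :
    ∫ ω, (1 - alive T D i t ω) * F (V i t ω) ∂P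
      ≤ √s * (∫ v, F v ^ 2 ∂(multivariateGaussian 0 S) + 1) := by
  have ha := hD.measurable_alive hV.measurable ht i
  rw [← hV.integral_comp i t (f := fun v => F v ^ 2) (by fun_prop)]
  refine integral_mul_le_sqrt (fun ω => ?_) (fun ω => ?_) ?_ (fun ω => hF0 _)
    (hV.integrable_comp i t hF2) hs ((hc.integral_one_sub_alive_le H hV hD ht i).trans hls)
  · linarith [alive_le_one (T := T) (D := D) i t ω]
  · linarith [alive_nonneg (T := T) (D := D) i t ω]
  · refine integrable_of_measurable_bounded (by fun_prop) (K := 1) fun ω => ?_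
    rcases alive_eq_zero_or_one (T := T) (D := D) i t ω with h | h <;> simp [h]

end IsCutoff

end ErrorBounds

/-! ### Moments of the truncated score -/

section ErrorBounds

variable {Ω : Type*} [mΩ : MeasurableSpace Ω] {P : Measure Ω} [IsProbabilityMeasure P]
  {m d₁ d₂ T : ℕ} {S : Matrix (Fin d₁ ⊕ Fin d₂) (Fin d₁ ⊕ Fin d₂) ℝ} {K ρ : ℝ}
  {Y : ℕ → Ω → EuclideanSpace ℝ (Fin d₁)} {X : Fin m → ℕ → Ω → EuclideanSpace ℝ (Fin d₂)}
  {V : Fin m → ℕ → Ω → Cov d₁ d₂} {D : Fin m → ℕ → Ω → ℝ}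
  {h : ℝ → ℝ} {M L : ℝ} {β : Cov d₁ d₂} {γ R ε s : ℝ}

/-- The intensity of the squared score in direction `c`. -/
def scoreIntensity (β c v : Cov d₁ d₂) : ℝ := inner ℝ c v ^ 2 * Real.exp (inner ℝ β v)

lemma measurable_scoreIntensity (β c : Cov d₁ d₂) : Measurable (scoreIntensity β c) := by
  unfold scoreIntensity; fun_prop

lemma scoreIntensity_nonneg (β c v : Cov d₁ d₂) : 0 ≤ scoreIntensity β c v := by
  unfold scoreIntensity; positivity

lemma integrable_scoreIntensity (β c : Cov d₁ d₂) :
    Integrable (scoreIntensity β c) (multivariateGaussian 0 S) := by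
  refine integrable_of_le_norm_pow_mul_exp_inner (measurable_scoreIntensity β c)
    (K := ‖c‖ ^ 2) (n := 2) (b := β) fun v => ?_
  rw [scoreIntensity, abs_mul, Real.abs_exp, ← mul_assoc, ← mul_pow, abs_pow]
  gcongr
  exact abs_real_inner_le_norm c v

lemma integrable_scoreIntensity_sq (β c : Cov d₁ d₂) :
    Integrable (fun v => scoreIntensity β c v ^ 2) (multivariateGaussian 0 S) := by
  have := measurable_scoreIntensity β c
  refine integrable_of_le_norm_pow_mul_exp_inner (by fun_prop)
    (K := ‖c‖ ^ 4) (n := 4) (b := (2 : ℝ) • β) fun v => ?_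
  rw [scoreIntensity, abs_of_nonneg (by positivity), mul_pow, ← pow_mul, ← Real.exp_nat_mul,
    real_inner_smul_left, ← mul_assoc, ← mul_pow]
  norm_num
  have h1 := abs_real_inner_le_norm c v
  gcongr ?_ * _
  calc inner ℝ c v ^ 4 = |inner ℝ c v| ^ 4 := by rw [← abs_pow, abs_of_nonneg (by positivity)]
    _ ≤ _ := by gcongr

lemma integrable_norm_sq_mul_exp_sq (β : Cov d₁ d₂) :
    Integrable (fun v => (‖v‖ ^ 2 * Real.exp (inner ℝ β v)) ^ 2) (multivariateGaussian 0 S) := by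
  refine integrable_of_le_norm_pow_mul_exp_inner (by fun_prop)
    (K := 1) (n := 4) (b := (2 : ℝ) • β) fun v => ?_
  rw [abs_of_nonneg (by positivity), mul_pow, ← pow_mul, ← Real.exp_nat_mul, real_inner_smul_left]
  norm_num

variable (H : TailBound h M L) (hc : IsCutoff β L γ R) (hV : IsCovariateProcess P S K ρ Y X V)
  (hD : IsDefaultProcess P T (fun v => defaultProb h v β (alpha γ)) V D)

lemma abs_sum_sum_le {m T : ℕ} {f : Fin m → ℕ → ℝ} {B : ℝ} (hf : ∀ i, ∀ t < T, |f i t| ≤ B) :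
    |∑ t ∈ Finset.range T, ∑ i, f i t| ≤ T * m * B := by
  refine (Finset.abs_sum_le_sum_abs _ _).trans ((Finset.sum_le_sum fun t ht =>
    (Finset.abs_sum_le_sum_abs _ _).trans (Finset.sum_le_sum fun i _ =>
      hf i t (Finset.mem_range.1 ht))).trans (le_of_eq ?_))
  simp [mul_assoc]

namespace IsCutoff
include H hc hV hD

/-- Three sources of error: the expansion of the link (the √γ term), the mass outside the ball, and
firms that have already defaulted. The last two are integrals over improbable events and cost √s
each. -/
lemma abs_integral_alive_mul_varWeight_sub_le (hs : 0 < s) (hls : lossBound S β γ R T ≤ s)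
    (hνs : (multivariateGaussian (0 : Cov d₁ d₂) S).real {v | ‖v‖ ≤ R}ᶜ ≤ s)
    (hε : 0 < ε) (c : Cov d₁ d₂) (hεc : 2 * ε * ‖c‖ * R ≤ 1) {t : ℕ} (ht : t < T) (i : Fin m) :
    |∫ ω, alive T D i t ω * varWeight (scoreCoef h β γ R ε c)
        (fun v => defaultProb h v β (alpha γ)) (V i t ω) ∂P
      - ε ^ 2 * γ * ∫ v, scoreIntensity β c v ∂(multivariateGaussian 0 S)|
    ≤ ε ^ 2 * γ * (45 * (M + 1) * √γ * ∫ v, scoreIntensity β c v ∂(multivariateGaussian 0 S)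
      + 2 * √s * (∫ v, scoreIntensity β c v ^ 2 ∂(multivariateGaussian 0 S) + 1)) := by
  have hγ := hc.pos
  have hM := H.nonneg
  set ν := multivariateGaussian (0 : Cov d₁ d₂) S
  set F := scoreIntensity β c with hFdef
  have hFm : Measurable F := measurable_scoreIntensity β c
  have hF0 : ∀ v, 0 ≤ F v := scoreIntensity_nonneg β c
  have hFi : Integrable F ν := integrable_scoreIntensity β c
  have hF2 : Integrable (fun v => F v ^ 2) ν := integrable_scoreIntensity_sq β c
  set w := scoreCoef h β γ R ε c
  set p : Cov d₁ d₂ → ℝ := fun v => defaultProb h v β (alpha γ)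
  have hp : Measurable p := H.measurable_defaultProb _
  have hw : Measurable w := H.measurable_scoreCoef c
  have hw1 : ∀ v, |w v| ≤ 1 := fun v => (hc.abs_scoreCoef_le H hε.le c v).trans hεc
  have hwp : ∀ v, w v ≠ 0 → 0 ≤ p v ∧ p v ≤ 1 := hc.defaultProb_mem_of_scoreCoef_ne_zero H c
  have hvw : Measurable (varWeight w p) := by unfold varWeight; fun_prop
  have hvm := hV.measurable i t
  have ha := hD.measurable_alive hV.measurable ht i
  have hG : MeasurableSet ({v : Cov d₁ d₂ | ‖v‖ ≤ R}ᶜ) := (measurableSet_norm_le R).compl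
  have i1 : Integrable (fun ω => alive T D i t ω * varWeight w p (V i t ω)) P := by
    refine integrable_of_measurable_bounded (by fun_prop) (K := 1) fun ω => ?_
    rw [abs_mul, abs_of_nonneg (alive_nonneg i t ω), abs_of_nonneg (varWeight_nonneg hwp _)]
    exact mul_le_one₀ (alive_le_one i t ω) (varWeight_nonneg hwp _) (varWeight_le_one hw1 hwp _)
  have i2 : Integrable (fun ω => F (V i t ω)) P := hV.integrable_comp i t hFi
  have i3 : Integrable (fun v => Set.indicator {v : Cov d₁ d₂ | ‖v‖ ≤ R}ᶜ F v) ν :=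
    hFi.indicator hG
  have i3' := hV.integrable_comp i t i3
  have i4 : Integrable (fun ω => (1 - alive T D i t ω) * F (V i t ω)) P := by
    refine i2.bdd_mul (c := 1) (by fun_prop) (ae_of_all _ fun ω => ?_)
    rcases alive_eq_zero_or_one (T := T) (D := D) i t ω with h | h <;> simp [h]
  have eF : ∫ v, F v ∂ν = ∫ ω, F (V i t ω) ∂P := (hV.integral_comp i t hFm).symm
  have hpt : ∀ ω, |alive T D i t ω * varWeight w p (V i t ω) - ε ^ 2 * γ * F (V i t ω)|
      ≤ ε ^ 2 * γ * (45 * (M + 1) * √γ * F (V i t ω)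
        + Set.indicator {v : Cov d₁ d₂ | ‖v‖ ≤ R}ᶜ F (V i t ω)
        + (1 - alive T D i t ω) * F (V i t ω)) := by
    intro ω
    have h1 := hc.abs_varWeight_sub_le (ε := ε) H c (V i t ω)
    change |varWeight w p (V i t ω) - ε ^ 2 * γ * F (V i t ω)| ≤ ε ^ 2 * γ *
      (45 * (M + 1) * √γ * F (V i t ω) + Set.indicator {v : Cov d₁ d₂ | ‖v‖ ≤ R}ᶜ F (V i t ω)) at h1
    have hx := hF0 (V i t ω)
    rcases alive_eq_zero_or_one (T := T) (D := D) i t ω with h0 | h0 <;> rw [h0]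
    · rw [zero_mul, zero_sub, abs_neg, abs_of_nonneg (by positivity)]
      have h2 := (abs_nonneg _).trans h1
      linarith
    · rw [one_mul, sub_self, zero_mul, add_zero]
      exact h1
  have eind : ∫ ω, Set.indicator {v : Cov d₁ d₂ | ‖v‖ ≤ R}ᶜ F (V i t ω) ∂P
      = ∫ v, Set.indicator {v : Cov d₁ d₂ | ‖v‖ ≤ R}ᶜ F v ∂ν :=
    hV.integral_comp i t (hFm.indicator hG)
  rw [eF]
  have i5 : Integrable (fun ω => 45 * (M + 1) * √γ * F (V i t ω)
      + Set.indicator {v : Cov d₁ d₂ | ‖v‖ ≤ R}ᶜ F (V i t ω)) P := (i2.const_mul _).add i3'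
  have i6 : Integrable (fun ω => 45 * (M + 1) * √γ * F (V i t ω)
      + Set.indicator {v : Cov d₁ d₂ | ‖v‖ ≤ R}ᶜ F (V i t ω)
      + (1 - alive T D i t ω) * F (V i t ω)) P := i5.add i4
  rw [← integral_const_mul, ← integral_sub i1 (i2.const_mul _)]
  refine abs_integral_le_integral_abs.trans ((integral_mono (i1.sub (i2.const_mul _)).abs
    (i6.const_mul _) hpt).trans ?_)
  rw [integral_const_mul, integral_add i5 i4, integral_add (i2.const_mul _) i3', integral_const_mul, eind]
  have b1 : ∫ ω, (1 - alive T D i t ω) * F (V i t ω) ∂P ≤ √s * (∫ v, F v ^ 2 ∂ν + 1) := hc.integral_one_sub_alive_mul_le H hV hD hs hls hFm hF0 hF2 ht i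
  have b2 : ∫ v, Set.indicator {v : Cov d₁ d₂ | ‖v‖ ≤ R}ᶜ F v ∂ν
      ≤ √s * (∫ v, F v ^ 2 ∂ν + 1) := by
    have e : ∀ v, Set.indicator {v : Cov d₁ d₂ | ‖v‖ ≤ R}ᶜ F v
        = Set.indicator {v : Cov d₁ d₂ | ‖v‖ ≤ R}ᶜ (fun _ => (1 : ℝ)) v * F v := by
      intro v
      by_cases hv : v ∈ {v : Cov d₁ d₂ | ‖v‖ ≤ R}ᶜ
      · rw [Set.indicator_of_mem hv, Set.indicator_of_mem hv, one_mul]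
      · rw [Set.indicator_of_notMem hv, Set.indicator_of_notMem hv, zero_mul]
    simp_rw [e]
    refine integral_mul_le_sqrt (fun v => Set.indicator_nonneg (fun _ _ => zero_le_one) v)
      (fun v => Set.indicator_le_self' (fun _ _ => zero_le_one) v)
      ((integrable_const _).indicator hG) hF0 hF2 hs ?_
    rw [integral_indicator_const _ hG, smul_eq_mul, mul_one]
    exact hνs
  refine mul_le_mul_of_nonneg_left ?_ (by positivity)
  linarith

/-- Second and fourth moments of the truncated score. -/
lemma moments_scoreSum (hs : 0 < s) (hls : lossBound S β γ R T ≤ s)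
    (hνs : (multivariateGaussian (0 : Cov d₁ d₂) S).real {v | ‖v‖ ≤ R}ᶜ ≤ s)
    (hε : 0 < ε) (c : Cov d₁ d₂) (hεc : 2 * ε * ‖c‖ * R ≤ 1) :
    (∀ ω, |scoreSum T (scoreCoef h β γ R ε c) (fun v => defaultProb h v β (alpha γ)) V D T ω|
      ≤ T * m) ∧
    |∫ ω, scoreSum T (scoreCoef h β γ R ε c) (fun v => defaultProb h v β (alpha γ)) V D T ω ^ 2 ∂P
      - ε ^ 2 * γ * (T * m) * ∫ v, scoreIntensity β c v ∂(multivariateGaussian 0 S)|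
    ≤ ε ^ 2 * γ * (T * m) *
      (45 * (M + 1) * √γ * ∫ v, scoreIntensity β c v ∂(multivariateGaussian 0 S)
      + 2 * √s * (∫ v, scoreIntensity β c v ^ 2 ∂(multivariateGaussian 0 S) + 1)) ∧
    ∫ ω, scoreSum T (scoreCoef h β γ R ε c) (fun v => defaultProb h v β (alpha γ)) V D T ω ^ 4 ∂P
      ≤ Real.exp (ε ^ 2 * γ * (T * m) * (64 * (46 * (M + 1)
        * √(∫ v, scoreIntensity β c v ^ 2 ∂(multivariateGaussian 0 S) + 1)))) := by
  have hγ := hc.pos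
  have hM := H.nonneg
  set ν := multivariateGaussian (0 : Cov d₁ d₂) S
  set F := scoreIntensity β c with hFdef
  have hFm : Measurable F := measurable_scoreIntensity β c
  have hF2 : Integrable (fun v => F v ^ 2) ν := integrable_scoreIntensity_sq β c
  set w := scoreCoef h β γ R ε c
  set p : Cov d₁ d₂ → ℝ := fun v => defaultProb h v β (alpha γ)
  have hp : Measurable p := H.measurable_defaultProb _
  have hw : Measurable w := H.measurable_scoreCoef c
  have hw1 : ∀ v, |w v| ≤ 1 := fun v => (hc.abs_scoreCoef_le H hε.le c v).trans hεc
  have hwp : ∀ v, w v ≠ 0 → 0 ≤ p v ∧ p v ≤ 1 := hc.defaultProb_mem_of_scoreCoef_ne_zero H c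
  have hF2n : 0 ≤ ∫ v, F v ^ 2 ∂ν := integral_nonneg fun v => sq_nonneg _
  -- A bound on the root mean square of one conditional variance; the added 1 makes it strictly
  -- positive.
  set a := ε ^ 2 * γ * (46 * (M + 1)) * √(∫ v, F v ^ 2 ∂ν + 1) with hadef
  have ha : 0 < a := by positivity
  have hvar : ∀ i, ∀ t < T, ∫ ω, varWeight w p (V i t ω) ^ 2 ∂P ≤ a ^ 2 := by
    intro i t _
    have hpt : ∀ ω, varWeight w p (V i t ω) ^ 2
        ≤ (ε ^ 2 * γ * (46 * (M + 1))) ^ 2 * F (V i t ω) ^ 2 := by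
      intro ω
      rw [← mul_pow]
      exact pow_le_pow_left₀ (varWeight_nonneg hwp _) (hc.varWeight_le H c _) 2
    refine (integral_mono_of_nonneg (ae_of_all _ fun ω => sq_nonneg _)
      ((hV.integrable_comp i t hF2).const_mul _) (ae_of_all _ hpt)).trans ?_
    have eF : ∫ ω, F (V i t ω) ^ 2 ∂P = ∫ v, F v ^ 2 ∂ν :=
      hV.integral_comp i t (f := fun v => F v ^ 2) (by fun_prop)
    rw [integral_const_mul, eF, hadef, mul_pow _ (√_), Real.sq_sqrt (by positivity)]
    refine mul_le_mul_of_nonneg_left ?_ (by positivity)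
    linarith
  obtain ⟨h1, h2, h4⟩ := hD.moments_scoreSum hV.measurable hp hw hw1 hwp ha hvar le_rfl
  refine ⟨h1, ?_, ?_⟩
  · rw [h2]
    have e : ε ^ 2 * γ * (T * m) * ∫ v, F v ∂ν
        = ∑ t ∈ Finset.range T, ∑ _i : Fin m, ε ^ 2 * γ * ∫ v, F v ∂ν := by
      simp; ring
    rw [e]
    simp only [← Finset.sum_sub_distrib]
    refine (abs_sum_sum_le fun i t ht => hc.abs_integral_alive_mul_varWeight_sub_le H hV hD hs hls
      hνs hε c hεc ht i).trans (le_of_eq ?_)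
    ring
  · have h5 : (1 + 64 * a) ^ (T * m) ≤ Real.exp (64 * a) ^ (T * m) := by
      gcongr
      linarith [Real.add_one_le_exp (64 * a)]
    rw [← Real.exp_nat_mul] at h5
    refine ((le_add_of_nonneg_right zero_le_one).trans (h4.trans h5)).trans (le_of_eq ?_)
    congr 1
    rw [hadef]
    push_cast
    ring

end IsCutoff

end ErrorBounds

/-! ### The remainder in the linearised score equation -/

section Linearisation

universe u

variable {d₁ d₂ : ℕ} {S : Matrix (Fin d₁ ⊕ Fin d₂) (Fin d₁ ⊕ Fin d₂) ℝ} {K ρ : ℝ}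

/-- The `c, b` entry of the Hessian density of the log-likelihood. -/
def hessianDensity (β c : Cov d₁ d₂) (b : Fin d₁ ⊕ Fin d₂) (v : Cov d₁ d₂) : ℝ :=
  inner ℝ c v * inner ℝ (EuclideanSpace.single b (1 : ℝ)) v * Real.exp (inner ℝ β v)

/-- The normalised law of large numbers. -/
lemma UniformLLN.integral_abs_le {f : Cov d₁ d₂ → ℝ} (hf : UniformLLN.{u} S K ρ f) {η : ℝ}
    (hη : 0 < η) : ∃ B, 0 ≤ B ∧ ∀ (Ω : Type u) [MeasurableSpace Ω] (P : Measure Ω)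
      [IsProbabilityMeasure P] (m : ℕ) (Y : ℕ → Ω → EuclideanSpace ℝ (Fin d₁))
      (X : Fin m → ℕ → Ω → EuclideanSpace ℝ (Fin d₂)) (V : Fin m → ℕ → Ω → Cov d₁ d₂),
      IsCovariateProcess P S K ρ Y X V → ∀ (T : ℕ) (θ : ℝ), 0 ≤ θ →
      ∫ ω, |θ * ∑ t ∈ Finset.range T, ∑ i, f (V i t ω) - ∫ v, f v ∂(multivariateGaussian 0 S)| ∂P
        ≤ θ * (m * T * η + m * √T * B)
          + |θ * (T * m) - 1| * |∫ v, f v ∂(multivariateGaussian 0 S)| := by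
  obtain ⟨B, hB, hb⟩ := hf.bound η hη
  refine ⟨B, hB, fun Ω _ P _ m Y X V hV T θ hθ => ?_⟩
  have hint := hV.integrable_centered_sum hf.integrable T (∫ v, f v ∂(multivariateGaussian 0 S))
  set I := ∫ v, f v ∂(multivariateGaussian 0 S)
  have hpt : ∀ ω, |θ * ∑ t ∈ Finset.range T, ∑ i, f (V i t ω) - I|
      ≤ θ * |∑ t ∈ Finset.range T, ∑ i, (f (V i t ω) - I)| + |θ * (T * m) - 1| * |I| := by
    intro ω
    have e : θ * ∑ t ∈ Finset.range T, ∑ i, f (V i t ω) - I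
        = θ * ∑ t ∈ Finset.range T, ∑ i, (f (V i t ω) - I) + (θ * (T * m) - 1) * I := by
      simp only [Finset.sum_sub_distrib, Finset.sum_const, Finset.card_range, Finset.card_univ,
        Fintype.card_fin, nsmul_eq_mul]
      ring
    rw [e]
    refine (abs_add_le _ _).trans (le_of_eq ?_)
    rw [abs_mul, abs_mul, abs_of_nonneg hθ]
  refine (integral_mono_of_nonneg (ae_of_all _ fun ω => abs_nonneg _)
    ((hint.abs.const_mul θ).add (integrable_const _)) (ae_of_all _ hpt)).trans ?_
  simp only [Pi.add_apply]
  rw [integral_add (hint.abs.const_mul θ) (integrable_const _), integral_const_mul, integral_const]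
  simp only [probReal_univ, one_smul]
  gcongr
  exact hb Ω P m Y X V hV T

variable {Ω : Type*} {m T : ℕ} {V : Fin m → ℕ → Ω → Cov d₁ d₂} {D : Fin m → ℕ → Ω → ℝ}
  {h : ℝ → ℝ} {M L : ℝ} {β : Cov d₁ d₂} {γ R ε s : ℝ}

/-- The deviation of the `c, b` entry of the normalised Hessian from its limit. -/
def hessianError (S : Matrix (Fin d₁ ⊕ Fin d₂) (Fin d₁ ⊕ Fin d₂) ℝ) (T : ℕ)
    (V : Fin m → ℕ → Ω → Cov d₁ d₂) (β : Cov d₁ d₂) (θ : ℝ) (c : Cov d₁ d₂) (b : Fin d₁ ⊕ Fin d₂)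
    (ω : Ω) : ℝ :=
  |θ * ∑ t ∈ Finset.range T, ∑ i, hessianDensity β c b (V i t ω)
    - ∫ v, hessianDensity β c b v ∂(multivariateGaussian 0 S)|

/-- The second-order remainder in the score equation, without its constant. -/
def taylorError (T : ℕ) (V : Fin m → ℕ → Ω → Cov d₁ d₂) (D : Fin m → ℕ → Ω → ℝ) (β : Cov d₁ d₂)
    (γ R ε B : ℝ) (ω : Ω) : ℝ :=
  ε ^ 2 * γ * (∑ t ∈ Finset.range T, ∑ i,
        (1 - alive T D i t ω) * (‖V i t ω‖ ^ 2 * Real.exp (inner ℝ β (V i t ω))))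
      + √γ * (ε ^ 2 * ∑ t ∈ Finset.range T, ∑ i,
          Set.indicator {v | ‖v‖ ≤ R} (fun v => ‖v‖ ^ 2) (V i t ω) * D i (t + 1) ω)
      + (ε * B * R + √γ) * (ε ^ 2 * γ * ∑ t ∈ Finset.range T, ∑ i,
          ‖V i t ω‖ ^ 2 * Real.exp (inner ℝ β (V i t ω)))

/-- The truncated score at the true parameter approximates a linear functional of the rescaled
estimation error. -/
lemma IsCutoff.abs_sum_mul_sub_scoreSum_le (H : TailBound h M L) (hc : IsCutoff β L γ R)
    (hD : ∀ i t ω, D i t ω = 0 ∨ D i t ω = 1) (hT : 0 < T) (hε : 0 ≤ ε) {u : Cov d₁ d₂} {B : ℝ}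
    (huB : ‖u‖ ≤ B) (hB : ε * B * R ≤ 1) {ω : Ω} (hV : ∀ i, ∀ t < T, ‖V i t ω‖ ≤ R)
    (hmax : ∀ b, likelihood T h V D b (alpha γ) ω ≤ likelihood T h V D (β + ε • u) (alpha γ) ω)
    (c : Cov d₁ d₂) :
    |∑ b, u b * ∫ v, hessianDensity β c b v ∂(multivariateGaussian 0 S)
      - scoreSum T (scoreCoef h β γ R ε c) (fun v => defaultProb h v β (alpha γ)) V D T ω|
    ≤ B * ∑ b, hessianError S T V β (ε ^ 2 * γ) c b ω
      + ‖c‖ * B * (270 * (M + 1)) * taylorError T V D β γ R ε B ω := by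
  have hM := H.nonneg
  have hR := hc.nonneg
  have hγ := hc.pos
  have hB0 : 0 ≤ B := (norm_nonneg u).trans huB
  have hu : ε * ‖u‖ * R ≤ 1 := le_trans (by gcongr) hB
  have key := hc.abs_scoreSum_sub_le H hD hT hε hu hV hmax c
  have hD0 : ∀ i t ω, 0 ≤ D i t ω := fun i t ω => by
    rcases hD i t ω with h0 | h0 <;> simp [h0]
  have ha0 : ∀ i t, 0 ≤ 1 - alive T D i t ω := fun i t => by
    linarith [alive_le_one (T := T) (D := D) i t ω]
  have hn1 : 0 ≤ ∑ t ∈ Finset.range T, ∑ i,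
      (1 - alive T D i t ω) * (‖V i t ω‖ ^ 2 * Real.exp (inner ℝ β (V i t ω))) :=
    Finset.sum_nonneg fun t _ => Finset.sum_nonneg fun i _ => mul_nonneg (ha0 i t) (by positivity)
  have hn2 : 0 ≤ ∑ t ∈ Finset.range T, ∑ i,
      Set.indicator {v | ‖v‖ ≤ R} (fun v => ‖v‖ ^ 2) (V i t ω) * D i (t + 1) ω :=
    Finset.sum_nonneg fun t _ => Finset.sum_nonneg fun i _ =>
      mul_nonneg (Set.indicator_nonneg (fun v _ => sq_nonneg _) _) (hD0 _ _ _)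
  have hn3 : 0 ≤ ∑ t ∈ Finset.range T, ∑ i,
      ‖V i t ω‖ ^ 2 * Real.exp (inner ℝ β (V i t ω)) :=
    Finset.sum_nonneg fun t _ => Finset.sum_nonneg fun i _ => by positivity
  have hrem : ‖c‖ * ‖u‖ * (270 * (M + 1)) * (ε ^ 2 * γ * (∑ t ∈ Finset.range T, ∑ i,
        (1 - alive T D i t ω) * (‖V i t ω‖ ^ 2 * Real.exp (inner ℝ β (V i t ω))))
      + √γ * (ε ^ 2 * ∑ t ∈ Finset.range T, ∑ i,
          Set.indicator {v | ‖v‖ ≤ R} (fun v => ‖v‖ ^ 2) (V i t ω) * D i (t + 1) ω)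
      + (ε * ‖u‖ * R + √γ) * (ε ^ 2 * γ * ∑ t ∈ Finset.range T, ∑ i,
          ‖V i t ω‖ ^ 2 * Real.exp (inner ℝ β (V i t ω))))
      ≤ ‖c‖ * B * (270 * (M + 1)) * taylorError T V D β γ R ε B ω := by
    unfold taylorError
    gcongr
  -- The direction u is random and depends on the sample, so the law of large numbers cannot be
  -- applied to it directly; it is expanded in the standard basis, whose directions are fixed.
  have hsum : ε ^ 2 * γ * ∑ t ∈ Finset.range T, ∑ i,
          inner ℝ c (V i t ω) * inner ℝ u (V i t ω) * Real.exp (inner ℝ β (V i t ω))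
      = ∑ b, u b * (ε ^ 2 * γ * ∑ t ∈ Finset.range T, ∑ i, hessianDensity β c b (V i t ω)) := by
    have hiu : ∀ v : Cov d₁ d₂, inner ℝ u v
        = ∑ b, u b * inner ℝ (EuclideanSpace.single b (1 : ℝ)) v := by
      intro v
      simp [PiLp.inner_apply, mul_comm]
    have hv : ∀ v : Cov d₁ d₂, inner ℝ c v * inner ℝ u v * Real.exp (inner ℝ β v)
        = ∑ b, u b * hessianDensity β c b v := by
      intro v
      rw [hiu, Finset.mul_sum, Finset.sum_mul]
      exact Finset.sum_congr rfl fun b _ => by rw [hessianDensity]; ring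
    simp_rw [hv]
    rw [Finset.sum_congr rfl fun t _ => Finset.sum_comm, Finset.sum_comm, Finset.mul_sum]
    refine Finset.sum_congr rfl fun b _ => ?_
    simp_rw [← Finset.mul_sum]
    ring
  have hdiff : |∑ b, u b * ∫ v, hessianDensity β c b v ∂(multivariateGaussian 0 S)
      - ∑ b, u b * (ε ^ 2 * γ * ∑ t ∈ Finset.range T, ∑ i, hessianDensity β c b (V i t ω))|
      ≤ B * ∑ b, hessianError S T V β (ε ^ 2 * γ) c b ω := by
    rw [← Finset.sum_sub_distrib, Finset.mul_sum]
    refine (Finset.abs_sum_le_sum_abs _ _).trans (Finset.sum_le_sum fun b _ => ?_)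
    rw [← mul_sub, abs_mul, abs_sub_comm, hessianError]
    gcongr
    exact (PiLp.norm_apply_le u b).trans huB
  rw [hsum] at key
  rw [abs_sub_comm] at key
  exact (abs_sub_le _ _ _).trans (add_le_add hdiff (key.trans hrem))

variable [mΩ : MeasurableSpace Ω] {P : Measure Ω} [IsProbabilityMeasure P]
  {Y : ℕ → Ω → EuclideanSpace ℝ (Fin d₁)} {X : Fin m → ℕ → Ω → EuclideanSpace ℝ (Fin d₂)}

lemma measurable_hessianDensity (β c : Cov d₁ d₂) (b : Fin d₁ ⊕ Fin d₂) :
    Measurable (hessianDensity β c b) := by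
  unfold hessianDensity; fun_prop

lemma integrable_hessianDensity (β c : Cov d₁ d₂) (b : Fin d₁ ⊕ Fin d₂) :
    Integrable (hessianDensity β c b) (multivariateGaussian 0 S) := by
  refine integrable_of_le_norm_pow_mul_exp_inner (measurable_hessianDensity β c b)
    (K := ‖c‖) (n := 2) (b := β) fun v => ?_
  rw [hessianDensity, abs_mul, abs_mul, Real.abs_exp]
  have h1 : |inner ℝ (EuclideanSpace.single b (1 : ℝ)) v| ≤ ‖v‖ := by
    simpa using abs_real_inner_le_norm (EuclideanSpace.single b (1 : ℝ)) v
  calc _ ≤ ‖c‖ * ‖v‖ * ‖v‖ * Real.exp (inner ℝ β v) := by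
        gcongr
        exact abs_real_inner_le_norm c v
    _ = _ := by ring

lemma IsCovariateProcess.integrable_hessianError (hV : IsCovariateProcess P S K ρ Y X V) (θ : ℝ)
    (c : Cov d₁ d₂) (b : Fin d₁ ⊕ Fin d₂) : Integrable (hessianError S T V β θ c b) P := by
  unfold hessianError
  refine Integrable.abs (Integrable.sub (Integrable.const_mul ?_ _) (integrable_const _))
  exact integrable_finsetSum _ fun t _ => integrable_finsetSum _ fun i _ =>
    hV.integrable_comp i t (integrable_hessianDensity β c b)

/-- The second-order remainder is small in mean. -/
lemma IsCutoff.integral_taylorError_le (H : TailBound h M L) (hc : IsCutoff β L γ R)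
    (hV : IsCovariateProcess P S K ρ Y X V)
    (hD : IsDefaultProcess P T (fun v => defaultProb h v β (alpha γ)) V D)
    (hs : 0 < s) (hls : lossBound S β γ R T ≤ s) (B : ℝ) :
    Integrable (taylorError T V D β γ R ε B) P ∧
    ∫ ω, taylorError T V D β γ R ε B ω ∂P ≤ ε ^ 2 * γ * (T * m) *
      (√s * (∫ v, (‖v‖ ^ 2 * Real.exp (inner ℝ β v)) ^ 2 ∂(multivariateGaussian 0 S) + 1)
        + (ε * B * R + 3 * √γ)
          * ∫ v, ‖v‖ ^ 2 * Real.exp (inner ℝ β v) ∂(multivariateGaussian 0 S)) := by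
  have hγ := hc.pos
  have hR := hc.nonneg
  set ν := multivariateGaussian (0 : Cov d₁ d₂) S
  set Q : Cov d₁ d₂ → ℝ := fun v => ‖v‖ ^ 2 * Real.exp (inner ℝ β v) with hQ
  have hQm : Measurable Q := by fun_prop
  have hQi : Integrable Q ν := integrable_norm_pow_mul_exp_inner 2 β
  have hQ0 : ∀ v, 0 ≤ Q v := fun v => by positivity
  have hQ2 : Integrable (fun v => Q v ^ 2) ν := integrable_norm_sq_mul_exp_sq β
  have hG := measurableSet_norm_le (d₁ := d₁) (d₂ := d₂) R
  have i3 : ∀ i t, Integrable (fun ω => Q (V i t ω)) P := fun i t => hV.integrable_comp i t hQi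
  have i1 : ∀ i, ∀ t < T, Integrable (fun ω => (1 - alive T D i t ω) * Q (V i t ω)) P := by
    intro i t ht
    have ha := hD.measurable_alive hV.measurable ht i
    refine (i3 i t).bdd_mul (c := 1) (by fun_prop) (ae_of_all _ fun ω => ?_)
    rcases alive_eq_zero_or_one (T := T) (D := D) i t ω with h | h <;> simp [h]
  have i2 : ∀ i t, Integrable (fun ω => Set.indicator {v | ‖v‖ ≤ R} (fun v => ‖v‖ ^ 2) (V i t ω)
      * D i (t + 1) ω) P := by
    intro i t
    have hm : Measurable fun ω =>
        Set.indicator {v : Cov d₁ d₂ | ‖v‖ ≤ R} (fun v => ‖v‖ ^ 2) (V i t ω) :=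
      ((measurable_norm.pow_const 2).indicator hG).comp (hV.measurable i t)
    refine integrable_of_measurable_bounded (hm.mul (hD.measurable i _)) (K := R ^ 2 * 1)
      fun ω => ?_
    rw [abs_mul]
    refine mul_le_mul ?_ (hD.abs_le_one i _ ω) (abs_nonneg _) (by positivity)
    by_cases hv : ‖V i t ω‖ ≤ R
    · rw [Set.indicator_of_mem (by exact hv), abs_of_nonneg (by positivity)]
      gcongr
    · rw [Set.indicator_of_notMem (by exact hv), abs_zero]
      positivity
  have s1 : Integrable (fun ω => ∑ t ∈ Finset.range T, ∑ i,
      (1 - alive T D i t ω) * Q (V i t ω)) P :=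
    integrable_finsetSum _ fun t ht => integrable_finsetSum _ fun i _ =>
      i1 i t (Finset.mem_range.1 ht)
  have s2 : Integrable (fun ω => ∑ t ∈ Finset.range T, ∑ i,
      Set.indicator {v | ‖v‖ ≤ R} (fun v => ‖v‖ ^ 2) (V i t ω) * D i (t + 1) ω) P :=
    integrable_finsetSum _ fun t ht => integrable_finsetSum _ fun i _ => i2 i t
  have s3 : Integrable (fun ω => ∑ t ∈ Finset.range T, ∑ i, Q (V i t ω)) P :=
    integrable_finsetSum _ fun t ht => integrable_finsetSum _ fun i _ => i3 i t
  have b1 : ∫ ω, ∑ t ∈ Finset.range T, ∑ i, (1 - alive T D i t ω) * Q (V i t ω) ∂P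
      ≤ T * m * (√s * (∫ v, Q v ^ 2 ∂ν + 1)) := by
    rw [integral_finsetSum _ fun t ht => integrable_finsetSum _ fun i _ =>
      i1 i t (Finset.mem_range.1 ht)]
    refine (Finset.sum_le_sum fun t ht => ?_).trans (b := ∑ t ∈ Finset.range T, ∑ _i : Fin m,
      √s * (∫ v, Q v ^ 2 ∂ν + 1)) (by simp [mul_assoc])
    rw [integral_finsetSum _ fun i _ => i1 i t (Finset.mem_range.1 ht)]
    exact Finset.sum_le_sum fun i _ => hc.integral_one_sub_alive_mul_le H hV hD hs hls hQm hQ0 hQ2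
      (Finset.mem_range.1 ht) i
  have b2 : ∫ ω, ∑ t ∈ Finset.range T, ∑ i,
      Set.indicator {v | ‖v‖ ≤ R} (fun v => ‖v‖ ^ 2) (V i t ω) * D i (t + 1) ω ∂P
      ≤ T * m * (2 * (γ * ∫ v, Q v ∂ν)) := by
    rw [integral_finsetSum _ fun t ht => integrable_finsetSum _ fun i _ => i2 i t]
    refine (Finset.sum_le_sum fun t ht => ?_).trans (b := ∑ t ∈ Finset.range T, ∑ _i : Fin m,
      2 * (γ * ∫ v, Q v ∂ν)) (by simp [mul_assoc])
    rw [integral_finsetSum _ fun i _ => i2 i t]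
    exact Finset.sum_le_sum fun i _ => hc.integral_indicator_mul_default_le H hV hD
      (g := fun v => ‖v‖ ^ 2) (by fun_prop) (fun v => sq_nonneg _) (B := R ^ 2)
      (fun v hv => by gcongr) hQi (Finset.mem_range.1 ht) i
  have b3 : ∫ ω, ∑ t ∈ Finset.range T, ∑ i, Q (V i t ω) ∂P = T * m * ∫ v, Q v ∂ν := by
    rw [integral_finsetSum _ fun t ht => integrable_finsetSum _ fun i _ => i3 i t]
    simp_rw [fun t => integral_finsetSum Finset.univ fun i (_ : i ∈ Finset.univ) => i3 i t,
      fun i t => hV.integral_comp i t hQm]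
    simp [mul_assoc, ν]
  have hq : 0 ≤ ∫ v, Q v ∂ν := integral_nonneg hQ0
  have s12 := (s1.const_mul (ε ^ 2 * γ)).add ((s2.const_mul (ε ^ 2)).const_mul √γ)
  refine ⟨s12.add ((s3.const_mul (ε ^ 2 * γ)).const_mul (ε * B * R + √γ)), ?_⟩
  have s12' : Integrable (fun ω => ε ^ 2 * γ * (∑ t ∈ Finset.range T, ∑ i,
        (1 - alive T D i t ω) * Q (V i t ω))
      + √γ * (ε ^ 2 * ∑ t ∈ Finset.range T, ∑ i,
          Set.indicator {v | ‖v‖ ≤ R} (fun v => ‖v‖ ^ 2) (V i t ω) * D i (t + 1) ω)) P := s12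
  have e : ∫ ω, taylorError T V D β γ R ε B ω ∂P
      = ε ^ 2 * γ * ∫ ω, ∑ t ∈ Finset.range T, ∑ i, (1 - alive T D i t ω) * Q (V i t ω) ∂P
        + √γ * (ε ^ 2 * ∫ ω, ∑ t ∈ Finset.range T, ∑ i,
          Set.indicator {v | ‖v‖ ≤ R} (fun v => ‖v‖ ^ 2) (V i t ω) * D i (t + 1) ω ∂P)
        + (ε * B * R + √γ) * (ε ^ 2 * γ * ∫ ω, ∑ t ∈ Finset.range T, ∑ i, Q (V i t ω) ∂P) := by
    unfold taylorError
    rw [integral_add s12' ((s3.const_mul (ε ^ 2 * γ)).const_mul (ε * B * R + √γ)),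
      integral_add (s1.const_mul _) ((s2.const_mul _).const_mul _), integral_const_mul,
      integral_const_mul, integral_const_mul, integral_const_mul, integral_const_mul]
  rw [e, b3]
  -- The defaults contribute 2√γ and the last term √γ, which add up to the factor 3√γ.
  calc _ ≤ ε ^ 2 * γ * (T * m * (√s * (∫ v, Q v ^ 2 ∂ν + 1)))
        + √γ * (ε ^ 2 * (T * m * (2 * (γ * ∫ v, Q v ∂ν))))
        + (ε * B * R + √γ) * (ε ^ 2 * γ * (T * m * ∫ v, Q v ∂ν)) := by gcongr
    _ = _ := by ring

omit [IsProbabilityMeasure P] in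
lemma IsCovariateProcess.measure_exists_norm_gt_le (hV : IsCovariateProcess P S K ρ Y X V) (T : ℕ)
    (R : ℝ) : P {ω | ¬ ∀ i, ∀ t < T, ‖V i t ω‖ ≤ R}
      ≤ ENNReal.ofReal (T * m * (multivariateGaussian (0 : Cov d₁ d₂) S).real {v | ‖v‖ ≤ R}ᶜ) := by
  have hG := (measurableSet_norm_le (d₁ := d₁) (d₂ := d₂) R).compl
  have hsub : {ω | ¬ ∀ i, ∀ t < T, ‖V i t ω‖ ≤ R}
      ⊆ ⋃ t ∈ Finset.range T, ⋃ i ∈ (Finset.univ : Finset (Fin m)), V i t ⁻¹' {v | ‖v‖ ≤ R}ᶜ := by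
    intro ω hω
    simp only [Set.mem_ofPred_eq, not_forall] at hω
    obtain ⟨i, t, ht, hn⟩ := hω
    simp only [Set.mem_iUnion]
    exact ⟨t, Finset.mem_range.2 ht, i, Finset.mem_univ i, hn⟩
  have hp : ∀ i t, P (V i t ⁻¹' {v | ‖v‖ ≤ R}ᶜ)
      = ENNReal.ofReal ((multivariateGaussian (0 : Cov d₁ d₂) S).real {v | ‖v‖ ≤ R}ᶜ) := by
    intro i t
    rw [← Measure.map_apply (hV.measurable i t) hG, (hV.marginal i t).map_eq, ofReal_measureReal]
  refine (measure_mono hsub).trans ((measure_biUnion_finset_le _ _).trans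
    ((Finset.sum_le_sum fun t _ => measure_biUnion_finset_le _ _).trans ?_))
  simp_rw [hp]
  rw [Finset.sum_const, Finset.sum_const, Finset.card_range, Finset.card_univ, Fintype.card_fin,
    nsmul_eq_mul, nsmul_eq_mul, ENNReal.ofReal_mul (by positivity), ENNReal.ofReal_mul (by positivity),
    ENNReal.ofReal_natCast, ENNReal.ofReal_natCast, mul_assoc]

end Linearisation

/-! ### From closeness in probability to closeness of second moments -/

section Probability

variable {Ω : Type*} [mΩ : MeasurableSpace Ω] {P : Measure Ω} [IsProbabilityMeasure P]

section Score

variable {m d₁ d₂ T : ℕ} {S : Matrix (Fin d₁ ⊕ Fin d₂) (Fin d₁ ⊕ Fin d₂) ℝ} {K ρ : ℝ}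
  {V : Fin m → ℕ → Ω → Cov d₁ d₂} {D : Fin m → ℕ → Ω → ℝ}
  {Y : ℕ → Ω → EuclideanSpace ℝ (Fin d₁)} {X : Fin m → ℕ → Ω → EuclideanSpace ℝ (Fin d₂)}
  {h : ℝ → ℝ} {M L : ℝ} {β : Cov d₁ d₂} {γ R ε s : ℝ}

/-- Probability that the truncated score is far from the linear functional of the rescaled
estimation error. -/
lemma IsCutoff.measure_sub_scoreSum_le (H : TailBound h M L) (hc : IsCutoff β L γ R)
    (hV : IsCovariateProcess P S K ρ Y X V)
    (hD : IsDefaultProcess P T (fun v => defaultProb h v β (alpha γ)) V D)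
    (hs : 0 < s) (hls : lossBound S β γ R T ≤ s) (hT : 0 < T) (hε : 0 ≤ ε) {B : ℝ} (hB0 : 0 ≤ B)
    (hB : ε * B * R ≤ 1) (u : Ω → Cov d₁ d₂) (c : Cov d₁ d₂) {η : ℝ} (hη : 0 < η) :
    P {ω | η < |∑ b, u ω b * ∫ v, hessianDensity β c b v ∂(multivariateGaussian 0 S)
      - scoreSum T (scoreCoef h β γ R ε c) (fun v => defaultProb h v β (alpha γ)) V D T ω|}
    ≤ P {ω | ¬ ∀ b, likelihood T h V D b (alpha γ) ω
          ≤ likelihood T h V D (β + ε • u ω) (alpha γ) ω}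
      + P {ω | B < ‖u ω‖}
      + ENNReal.ofReal (T * m * (multivariateGaussian (0 : Cov d₁ d₂) S).real {v | ‖v‖ ≤ R}ᶜ)
      + ENNReal.ofReal ((B * ∑ b, ∫ ω, hessianError S T V β (ε ^ 2 * γ) c b ω ∂P
        + ‖c‖ * B * (270 * (M + 1)) * (ε ^ 2 * γ * (T * m) *
      (√s * (∫ v, (‖v‖ ^ 2 * Real.exp (inner ℝ β v)) ^ 2 ∂(multivariateGaussian 0 S) + 1)
        + (ε * B * R + 3 * √γ)
          * ∫ v, ‖v‖ ^ 2 * Real.exp (inner ℝ β v) ∂(multivariateGaussian 0 S)))) / η) := by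
  have hM := H.nonneg
  have hγ := hc.pos
  have hR := hc.nonneg
  obtain ⟨hti, htb⟩ := hc.integral_taylorError_le H hV hD hs hls B
  set W : Ω → ℝ := fun ω => B * ∑ b, hessianError S T V β (ε ^ 2 * γ) c b ω
      + ‖c‖ * B * (270 * (M + 1)) * taylorError T V D β γ R ε B ω with hW
  have hhi : Integrable (fun ω => ∑ b, hessianError S T V β (ε ^ 2 * γ) c b ω) P :=
    integrable_finsetSum _ fun b _ => hV.integrable_hessianError _ c b
  have hWi : Integrable W P := (hhi.const_mul _).add (hti.const_mul _)
  have hD0 : ∀ i t ω, 0 ≤ D i t ω := fun i t ω => by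
    rcases hD.zero_or_one i t ω with h0 | h0 <;> simp [h0]
  have hW0 : ∀ ω, 0 ≤ W ω := by
    intro ω
    have h1 : 0 ≤ taylorError T V D β γ R ε B ω := by
      unfold taylorError
      refine add_nonneg (add_nonneg ?_ ?_) ?_
      · refine mul_nonneg (by positivity) (Finset.sum_nonneg fun t _ => Finset.sum_nonneg fun i _ =>
          mul_nonneg ?_ (by positivity))
        linarith [alive_le_one (T := T) (D := D) i t ω]
      · refine mul_nonneg (by positivity) (mul_nonneg (by positivity) (Finset.sum_nonneg fun t _ =>
          Finset.sum_nonneg fun i _ => mul_nonneg ?_ (hD0 _ _ _)))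
        exact Set.indicator_nonneg (fun v _ => sq_nonneg _) _
      · positivity
    have h2 : 0 ≤ ∑ b, hessianError S T V β (ε ^ 2 * γ) c b ω :=
      Finset.sum_nonneg fun b _ => abs_nonneg _
    simp only [hW]
    positivity
  have hWint : ∫ ω, W ω ∂P ≤ B * ∑ b, ∫ ω, hessianError S T V β (ε ^ 2 * γ) c b ω ∂P
        + ‖c‖ * B * (270 * (M + 1)) * (ε ^ 2 * γ * (T * m) *
      (√s * (∫ v, (‖v‖ ^ 2 * Real.exp (inner ℝ β v)) ^ 2 ∂(multivariateGaussian 0 S) + 1)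
        + (ε * B * R + 3 * √γ)
          * ∫ v, ‖v‖ ^ 2 * Real.exp (inner ℝ β v) ∂(multivariateGaussian 0 S))) := by
    simp only [hW]
    rw [integral_add (hhi.const_mul _) (hti.const_mul _), integral_const_mul, integral_const_mul,
      integral_finsetSum _ fun b _ => hV.integrable_hessianError _ c b]
    gcongr
  have hmarkov : P {ω | η ≤ W ω} ≤ ENNReal.ofReal ((∫ ω, W ω ∂P) / η) := by
    rw [← ofReal_measureReal]
    refine ENNReal.ofReal_le_ofReal ?_
    rw [le_div_iff₀ hη, mul_comm]
    exact mul_meas_ge_le_integral_of_nonneg (ae_of_all _ hW0) hWi η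
  -- Off the first three exceptional events the linearisation is valid and its error is at most W,
  -- so a large deviation forces W to be large, which Markov's inequality controls.
  have hsub : {ω | η < |∑ b, u ω b * ∫ v, hessianDensity β c b v ∂(multivariateGaussian 0 S)
      - scoreSum T (scoreCoef h β γ R ε c) (fun v => defaultProb h v β (alpha γ)) V D T ω|}
      ⊆ (({ω | ¬ ∀ b, likelihood T h V D b (alpha γ) ω
          ≤ likelihood T h V D (β + ε • u ω) (alpha γ) ω} ∪ {ω | B < ‖u ω‖})
        ∪ {ω | ¬ ∀ i, ∀ t < T, ‖V i t ω‖ ≤ R}) ∪ {ω | η ≤ W ω} := by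
    intro ω hω
    by_contra hn
    simp only [Set.mem_union, Set.mem_ofPred_eq, not_or, not_not, not_lt, not_le] at hn hω
    obtain ⟨⟨⟨h1, h2⟩, h3⟩, h4⟩ := hn
    have := hc.abs_sum_mul_sub_scoreSum_le (S := S) H hD.zero_or_one hT hε h2 hB h3 h1 c
    exact absurd (hω.trans_le this) (not_lt.2 h4.le)
  refine (measure_mono hsub).trans ((measure_union_le _ _).trans (add_le_add
    ((measure_union_le _ _).trans (add_le_add (measure_union_le _ _)
      (hV.measure_exists_norm_gt_le T R))) (hmarkov.trans (ENNReal.ofReal_le_ofReal ?_))))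
  gcongr

end Score

/-- Comparison of second moments of two random variables that are close in probability. -/
lemma abs_integral_sq_sub_le {X S Z : Ω → ℝ} (hX : AEMeasurable X P) (hS : Measurable S)
    {K : ℝ} (hSK : ∀ ω, |S ω| ≤ K) (hXZ : ∀ ω, X ω ^ 2 ≤ Z ω) (hZ : Integrable Z P) {r η : ℝ}
    (hr : 0 < r) (hη : 0 ≤ η) :
    |∫ ω, X ω ^ 2 ∂P - ∫ ω, S ω ^ 2 ∂P| ≤ ∫ ω, Set.indicator {ω | r ^ 2 < Z ω} Z ω ∂P
      + (r ^ 2)⁻¹ * ∫ ω, S ω ^ 4 ∂P + r ^ 2 * P.real {ω | η < |X ω - S ω|} + 2 * r * η := by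
  -- X is only almost everywhere measurable; the exceptional set is replaced by a measurable hull of
  -- the same measure.
  set A := toMeasurable P {ω | η < |X ω - S ω|}
  have hA : MeasurableSet A := measurableSet_toMeasurable _ _
  have hXi : Integrable (fun ω => X ω ^ 2) P :=
    hZ.mono' (hX.pow_const 2).aestronglyMeasurable (ae_of_all _ fun ω => by
      rw [Real.norm_eq_abs, abs_of_nonneg (sq_nonneg _)]; exact hXZ ω)
  have hbd : ∀ n ω, |S ω ^ n| ≤ K ^ n := fun n ω => by rw [abs_pow]; gcongr; exact hSK ω
  have hS2 : Integrable (fun ω => S ω ^ 2) P := integrable_of_measurable_bounded (by fun_prop) (hbd 2)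
  have hS4 : Integrable (fun ω => S ω ^ 4) P := integrable_of_measurable_bounded (by fun_prop) (hbd 4)
  have hZi : Integrable (Set.indicator {ω | r ^ 2 < Z ω} Z) P :=
    hZ.indicator₀ (nullMeasurableSet_lt aemeasurable_const hZ.aemeasurable)
  have hAi : Integrable (Set.indicator A (fun _ => r ^ 2)) P := (integrable_const _).indicator hA
  -- Both absolute values are truncated at r. The truncation error of X is bounded by the tail of Z
  -- and that of S by S⁴/r², while the truncated squares differ by at most 2rη off A and r² on A.
  have hpt : ∀ ω, |X ω ^ 2 - S ω ^ 2| ≤ Set.indicator {ω | r ^ 2 < Z ω} Z ω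
      + (r ^ 2)⁻¹ * S ω ^ 4 + Set.indicator A (fun _ => r ^ 2) ω + 2 * r * η := by
    intro ω
    have t1 : |X ω ^ 2 - min |X ω| r ^ 2| ≤ Set.indicator {ω | r ^ 2 < Z ω} Z ω := by
      have hZ0 : 0 ≤ Z ω := (sq_nonneg _).trans (hXZ ω)
      by_cases hx : |X ω| ≤ r
      · rw [min_eq_left hx, sq_abs, sub_self, abs_zero]
        exact Set.indicator_apply_nonneg fun _ => hZ0
      · push Not at hx
        have h2 : r ^ 2 < X ω ^ 2 := by rw [← sq_abs (X ω)]; gcongr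
        rw [min_eq_right hx.le, Set.indicator_of_mem (by exact h2.trans_le (hXZ ω)),
          abs_of_nonneg (by linarith)]
        linarith [hXZ ω, sq_nonneg r]
    have t2 : |S ω ^ 2 - min |S ω| r ^ 2| ≤ (r ^ 2)⁻¹ * S ω ^ 4 := by
      by_cases hx : |S ω| ≤ r
      · rw [min_eq_left hx, sq_abs, sub_self, abs_zero]
        positivity
      · push Not at hx
        have h2 : r ^ 2 < S ω ^ 2 := by rw [← sq_abs (S ω)]; gcongr
        rw [min_eq_right hx.le, abs_of_nonneg (by linarith), le_inv_mul_iff₀ (by positivity)]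
        nlinarith [sq_nonneg r, sq_nonneg (S ω)]
    have t3 : |min |X ω| r ^ 2 - min |S ω| r ^ 2|
        ≤ Set.indicator A (fun _ => r ^ 2) ω + 2 * r * η := by
      have x0 : 0 ≤ min |X ω| r := le_min (abs_nonneg _) hr.le
      have x1 : min |X ω| r ≤ r := min_le_right _ _
      have s0 : 0 ≤ min |S ω| r := le_min (abs_nonneg _) hr.le
      have s1 : min |S ω| r ≤ r := min_le_right _ _
      by_cases hω : ω ∈ A
      · rw [Set.indicator_of_mem hω]
        have : |min |X ω| r ^ 2 - min |S ω| r ^ 2| ≤ r ^ 2 := by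
          rw [abs_le]; constructor <;> nlinarith
        have h3 : 0 ≤ 2 * r * η := by positivity
        linarith
      · have hle : |X ω - S ω| ≤ η := by
          by_contra hn
          exact hω (subset_toMeasurable _ _ (not_le.1 hn))
        rw [Set.indicator_of_notMem hω, zero_add, sq_sub_sq, abs_mul, abs_of_nonneg (by positivity)]
        have h4 : |min |X ω| r - min |S ω| r| ≤ η := by
          refine (abs_min_sub_min_le_max _ _ _ _).trans (max_le ?_ (by simpa using hη))
          exact (abs_abs_sub_abs_le_abs_sub _ _).trans hle
        gcongr
        linarith
    calc |X ω ^ 2 - S ω ^ 2| = |(X ω ^ 2 - min |X ω| r ^ 2) - (S ω ^ 2 - min |S ω| r ^ 2)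
          + (min |X ω| r ^ 2 - min |S ω| r ^ 2)| := by congr 1; ring
      _ ≤ |X ω ^ 2 - min |X ω| r ^ 2| + |S ω ^ 2 - min |S ω| r ^ 2|
          + |min |X ω| r ^ 2 - min |S ω| r ^ 2| :=
          (abs_add_le _ _).trans (add_le_add (abs_sub _ _) le_rfl)
      _ ≤ _ := by linarith
  have j1 : Integrable (fun ω => Set.indicator {ω | r ^ 2 < Z ω} Z ω + (r ^ 2)⁻¹ * S ω ^ 4) P :=
    hZi.add (hS4.const_mul _)
  have j2 : Integrable (fun ω => Set.indicator {ω | r ^ 2 < Z ω} Z ω + (r ^ 2)⁻¹ * S ω ^ 4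
    + Set.indicator A (fun _ => r ^ 2) ω) P := j1.add hAi
  rw [← integral_sub hXi hS2]
  refine abs_integral_le_integral_abs.trans ((integral_mono (hXi.sub hS2).abs
    (j2.add (integrable_const _)) hpt).trans (le_of_eq ?_))
  simp only [Pi.add_apply]
  rw [integral_add j2 (integrable_const _), integral_add j1 hAi, integral_add hZi (hS4.const_mul _),
    integral_const_mul, integral_indicator_const _ hA, integral_const]
  simp only [probReal_univ, smul_eq_mul]
  have : P.real A = P.real {ω | η < |X ω - S ω|} := by
    simp only [measureReal_def, A, measure_toMeasurable]
  rw [this]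
  ring

end Probability

/-- Uniform integrability bounds the tails of all members of the family. -/
lemma UnifIntegrableFamily.exists_tail_le {Ω : ℝ → Type*} [∀ γ, MeasurableSpace (Ω γ)]
    {P : ∀ γ, Measure (Ω γ)} [∀ γ, IsProbabilityMeasure (P γ)] {I : Set ℝ} {Z : ∀ γ, Ω γ → ℝ}
    (hUI : UnifIntegrableFamily P I Z) (hZ0 : ∀ γ ω, 0 ≤ Z γ ω)
    (hZ : ∀ γ ∈ I, AEMeasurable (Z γ) (P γ)) {η : ℝ} (hη : 0 < η) :
    ∀ᶠ r in atTop, ∀ γ ∈ I, Integrable (Z γ) (P γ) ∧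
      ∫ ω, Set.indicator {ω | r < Z γ ω} (Z γ) ω ∂(P γ) ≤ η ∧
      P γ {ω | r < Z γ ω} ≤ ENNReal.ofReal η := by
  have h1 := (tendsto_order.1 hUI).2 (ENNReal.ofReal η) (by simpa using hη)
  -- Taking r ≥ 1 makes the indicator of {Z > r} at most Z there, so the same tail integral also
  -- bounds the probability.
  filter_upwards [h1, eventually_ge_atTop 1] with r hr hr1 γ hγ
  have hle : ∫⁻ ω, Set.indicator {ω | r < Z γ ω} (fun ω => ENNReal.ofReal (Z γ ω)) ω ∂(P γ)
      ≤ ENNReal.ofReal η :=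
    (le_iSup₂ (f := fun γ (_ : γ ∈ I) => ∫⁻ ω, Set.indicator {ω | r < Z γ ω}
      (fun ω => ENNReal.ofReal (Z γ ω)) ω ∂(P γ)) γ hγ).trans hr.le
  have hms : NullMeasurableSet {ω | r < Z γ ω} (P γ) :=
    nullMeasurableSet_lt aemeasurable_const (hZ γ hγ)
  have hind : ∀ ω, ENNReal.ofReal (Set.indicator {ω | r < Z γ ω} (Z γ) ω)
      = Set.indicator {ω | r < Z γ ω} (fun ω => ENNReal.ofReal (Z γ ω)) ω := by
    intro ω
    by_cases hω : ω ∈ {ω | r < Z γ ω}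
    · rw [Set.indicator_of_mem hω, Set.indicator_of_mem hω]
    · rw [Set.indicator_of_notMem hω, Set.indicator_of_notMem hω, ENNReal.ofReal_zero]
  have hn : 0 ≤ᵐ[P γ] Set.indicator {ω | r < Z γ ω} (Z γ) :=
    ae_of_all _ fun ω => Set.indicator_nonneg (fun ω _ => hZ0 γ ω) ω
  have hint : Integrable (Z γ) (P γ) := by
    refine ⟨(hZ γ hγ).aestronglyMeasurable, ?_⟩
    rw [hasFiniteIntegral_iff_ofReal (ae_of_all _ (hZ0 γ))]
    have hpt : ∀ ω, ENNReal.ofReal (Z γ ω) ≤ ENNReal.ofReal r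
        + Set.indicator {ω | r < Z γ ω} (fun ω => ENNReal.ofReal (Z γ ω)) ω := by
      intro ω
      by_cases hω : r < Z γ ω
      · rw [Set.indicator_of_mem (by exact hω)]; exact le_add_self
      · rw [Set.indicator_of_notMem (by exact hω), add_zero]
        exact ENNReal.ofReal_le_ofReal (not_lt.1 hω)
    refine (lintegral_mono hpt).trans_lt ?_
    rw [lintegral_add_left measurable_const]
    simp only [lintegral_const, measure_univ, mul_one]
    exact ENNReal.add_lt_top.2 ⟨ENNReal.ofReal_lt_top, hle.trans_lt ENNReal.ofReal_lt_top⟩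
  refine ⟨hint, ?_, ?_⟩
  · rw [← ENNReal.ofReal_le_ofReal_iff hη.le, ofReal_integral_eq_lintegral_ofReal
      (hint.indicator₀ hms) hn]
    simp_rw [hind]
    exact hle
  · rw [← lintegral_indicator_one₀ hms]
    refine (lintegral_mono fun ω => ?_).trans hle
    by_cases hω : r < Z γ ω
    · rw [Set.indicator_of_mem (by exact hω), Set.indicator_of_mem (by exact hω)]
      simpa using hr1.trans hω.le
    · rw [Set.indicator_of_notMem (by exact hω), Set.indicator_of_notMem (by exact hω)]

/-! ### Rates as γ tends to zero -/

section Rates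

lemma tendsto_rpow_zero {a : ℝ} (ha : 0 < a) : Tendsto (fun γ : ℝ => γ ^ a) (𝓝[>] 0) (𝓝 0) := by
  have := (Real.continuousAt_rpow_const 0 a (Or.inr ha.le)).tendsto
  rw [Real.zero_rpow ha.ne'] at this
  exact this.mono_left nhdsWithin_le_nhds

lemma tendsto_rpow_neg_atTop_nhdsGT {a : ℝ} (ha : 0 < a) :
    Tendsto (fun γ : ℝ => γ ^ (-a)) (𝓝[>] 0) atTop := by
  refine ((tendsto_rpow_atTop ha).comp tendsto_inv_nhdsGT_zero).congr' ?_
  filter_upwards [self_mem_nhdsWithin] with γ hγ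
  rw [Function.comp_apply, Real.inv_rpow (le_of_lt hγ), Real.rpow_neg (le_of_lt hγ)]

lemma tendsto_mul_floor_rpow {a : ℝ} (ha : 0 < a) :
    Tendsto (fun γ : ℝ => γ ^ a * (⌊γ ^ (-a)⌋₊ : ℝ)) (𝓝[>] 0) (𝓝 1) := by
  refine (tendsto_nat_floor_div_atTop.comp (tendsto_rpow_neg_atTop_nhdsGT ha)).congr' ?_
  filter_upwards [self_mem_nhdsWithin] with γ hγ
  rw [Function.comp_apply, Real.rpow_neg (le_of_lt hγ), div_inv_eq_mul, mul_comm]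

lemma natCast_floor_rpow_le {γ : ℝ} (hγ : 0 < γ) (a : ℝ) : (⌊γ ^ (-a)⌋₊ : ℝ) ≤ γ ^ (-a) :=
  Nat.floor_le (Real.rpow_nonneg hγ.le _)

lemma tendsto_sqrt_zero : Tendsto (fun γ : ℝ => √γ) (𝓝[>] 0) (𝓝 0) := by
  have := Real.continuous_sqrt.tendsto 0
  rw [Real.sqrt_zero] at this
  exact this.mono_left nhdsWithin_le_nhds

lemma tendsto_rpow_mul_alpha {a : ℝ} (ha : 0 < a) :
    Tendsto (fun γ : ℝ => γ ^ a * alpha γ) (𝓝[>] 0) (𝓝 0) := by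
  have := (tendsto_log_mul_rpow_nhdsGT_zero ha).neg
  rw [neg_zero] at this
  refine this.congr fun γ => ?_
  rw [alpha, one_div, Real.log_inv]
  ring

lemma tendsto_alpha : Tendsto alpha (𝓝[>] 0) atTop := by
  have := tendsto_neg_atBot_atTop.comp Real.tendsto_log_nhdsGT_zero
  refine this.congr fun γ => ?_
  rw [Function.comp_apply, alpha, one_div, Real.log_inv]

variable {d₁ d₂ : ℕ} {S : Matrix (Fin d₁ ⊕ Fin d₂) (Fin d₁ ⊕ Fin d₂) ℝ} {β : Cov d₁ d₂}

/-- The truncation radius for the covariates. -/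
def cutoffRadius (β : Cov d₁ d₂) (γ : ℝ) : ℝ := (2 * (‖β‖ + 1))⁻¹ * alpha γ

/-- This explains the factor in the radius: β·v uses up at most half of α(γ), which leaves γ
exp(β·v) ≤ √γ. The shift ‖β‖ + 1 avoids division by zero. -/
lemma inner_le_of_norm_le_cutoffRadius {γ : ℝ} {v : Cov d₁ d₂}
    (hv : ‖v‖ ≤ cutoffRadius β γ) : inner ℝ β v ≤ alpha γ / 2 := by
  calc inner ℝ β v ≤ ‖β‖ * ‖v‖ := real_inner_le_norm β v
    _ ≤ (‖β‖ + 1) * ((2 * (‖β‖ + 1))⁻¹ * alpha γ) := by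
        gcongr
        · linarith
        · exact hv
    _ = alpha γ / 2 := by field_simp

lemma eventually_isCutoff (β : Cov d₁ d₂) (L : ℝ) :
    ∀ᶠ γ in 𝓝[>] (0 : ℝ), IsCutoff β L γ (cutoffRadius β γ) := by
  -- On the ball the index is at most -α/2, which lies below L - 1 once α ≥ 2(1 - L); α ≥ 0 gives γ
  -- ≤ 1 and a nonnegative radius.
  filter_upwards [self_mem_nhdsWithin, tendsto_alpha.eventually_ge_atTop (max 0 (2 * (1 - L)))]
    with γ hγ hα
  have hγ : 0 < γ := hγ
  obtain ⟨hα0, hαL⟩ := max_le_iff.1 hα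
  refine ⟨hγ, ?_, ?_, fun v hv => ?_, fun v hv => ?_⟩
  · rw [alpha, one_div, Real.log_inv] at hα0
    by_contra hn
    linarith [Real.log_pos (not_le.1 hn)]
  · unfold cutoffRadius; positivity
  · linarith [inner_le_of_norm_le_cutoffRadius hv]
  · have h1 := inner_le_of_norm_le_cutoffRadius hv
    have h2 : Real.exp (alpha γ / 2) = (√γ)⁻¹ := by
      rw [alpha, one_div, Real.log_inv, neg_div, Real.exp_neg, ← Real.log_sqrt hγ.le,
        Real.exp_log (Real.sqrt_pos.2 hγ)]
    calc γ * Real.exp (inner ℝ β v) ≤ γ * Real.exp (alpha γ / 2) := by gcongr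
      _ = √γ := by
        rw [h2]
        nth_rewrite 1 [← Real.mul_self_sqrt hγ.le]
        field_simp

/-- The Gaussian tail beyond the truncation radius is of any polynomial order in `γ`. -/
lemma exists_measureReal_cutoff_le (S : Matrix (Fin d₁ ⊕ Fin d₂) (Fin d₁ ⊕ Fin d₂) ℝ)
    (β : Cov d₁ d₂) (q : ℝ) : ∃ C, 0 ≤ C ∧ ∀ γ > 0,
      (multivariateGaussian (0 : Cov d₁ d₂) S).real {v | ‖v‖ ≤ cutoffRadius β γ}ᶜ ≤ C * γ ^ |q| := by
  set ν := multivariateGaussian (0 : Cov d₁ d₂) S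
  -- The exponent is tuned so that exp(a R) = γ^(-|q|) at the cutoff radius R; Markov's inequality
  -- for exp(a‖v‖) then yields the power.
  set a := |q| * (2 * (‖β‖ + 1)) with ha
  refine ⟨∫ v, Real.exp (a * ‖v‖) ∂ν, integral_nonneg fun v => (Real.exp_pos _).le,
    fun γ hγ => ?_⟩
  have ha0 : 0 ≤ a := by positivity
  have hsub : {v : Cov d₁ d₂ | ‖v‖ ≤ cutoffRadius β γ}ᶜ ⊆ {v | γ ^ (-|q|) ≤ Real.exp (a * ‖v‖)} := by
    intro v hv
    have hv' : cutoffRadius β γ < ‖v‖ := by simpa using hv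
    change γ ^ (-|q|) ≤ _
    rw [Real.rpow_def_of_pos hγ, Real.exp_le_exp]
    calc Real.log γ * -|q| = a * cutoffRadius β γ := by
          rw [ha, cutoffRadius, alpha, one_div γ, Real.log_inv]
          field_simp
      _ ≤ a * ‖v‖ := by gcongr
  have h1 := mul_meas_ge_le_integral_of_nonneg
    (ae_of_all ν fun v : Cov d₁ d₂ => (Real.exp_pos (a * ‖v‖)).le) (integrable_exp_mul_norm a)
    (γ ^ (-|q|))
  have h2 : ν.real {v : Cov d₁ d₂ | ‖v‖ ≤ cutoffRadius β γ}ᶜ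
      ≤ ν.real {v | γ ^ (-|q|) ≤ Real.exp (a * ‖v‖)} := measureReal_mono hsub
  have h3 : 0 < γ ^ |q| := Real.rpow_pos_of_pos hγ _
  rw [Real.rpow_neg hγ.le, inv_mul_le_iff₀ h3] at h1
  rw [Real.rpow_neg hγ.le] at h2
  rw [mul_comm]
  exact h2.trans h1

variable {δ ζ : ℝ}

/-- The exponents are arranged so that ε² γ = γ^δ γ^ζ, which balances the numbers of firms and
periods up to integer parts. -/
lemma tendsto_normalisation (hδ : 0 < δ) (hζ : 0 < ζ) :
    Tendsto (fun γ : ℝ => (γ ^ ((δ + ζ - 1) / 2)) ^ 2 * γ * (numPeriods ζ γ * numFirms δ γ))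
      (𝓝[>] 0) (𝓝 1) := by
  have := (tendsto_mul_floor_rpow hδ).mul (tendsto_mul_floor_rpow hζ)
  rw [one_mul] at this
  refine this.congr' ?_
  filter_upwards [self_mem_nhdsWithin] with γ hγ
  have hγ : 0 < γ := hγ
  have e : (γ ^ ((δ + ζ - 1) / 2)) ^ 2 * γ = γ ^ δ * γ ^ ζ := by
    nth_rewrite 2 [← Real.rpow_one γ]
    rw [← Real.rpow_natCast, ← Real.rpow_mul hγ.le, ← Real.rpow_add hγ, ← Real.rpow_add hγ]
    congr 1
    push_cast
    ring
  rw [e, numPeriods, numFirms]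
  ring

lemma tendsto_numPeriods (hζ : 0 < ζ) :
    Tendsto (fun γ : ℝ => numPeriods ζ γ) (𝓝[>] 0) atTop :=
  tendsto_nat_floor_atTop.comp (tendsto_rpow_neg_atTop_nhdsGT hζ)

/-- The condition ζ < 1 means that the expected number of defaults of one firm over the whole
horizon vanishes, so nearly all firms survive. -/
lemma tendsto_numPeriods_mul (hζ' : ζ < 1) :
    Tendsto (fun γ : ℝ => numPeriods ζ γ * γ) (𝓝[>] 0) (𝓝 0) := by
  refine squeeze_zero' ?_ ?_ (tendsto_rpow_zero (a := 1 - ζ) (by linarith))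
  · filter_upwards [self_mem_nhdsWithin] with γ hγ
    have hγ : 0 < γ := hγ
    positivity
  · filter_upwards [self_mem_nhdsWithin] with γ hγ
    have hγ : 0 < γ := hγ
    calc _ ≤ γ ^ (-ζ) * γ ^ (1 : ℝ) := by
          rw [Real.rpow_one]
          gcongr
          exact natCast_floor_rpow_le hγ ζ
      _ = _ := by rw [← Real.rpow_add hγ]; congr 1; ring

lemma tendsto_measureReal_cutoff :
    Tendsto (fun γ : ℝ =>
      (multivariateGaussian (0 : Cov d₁ d₂) S).real {v | ‖v‖ ≤ cutoffRadius β γ}ᶜ)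
      (𝓝[>] 0) (𝓝 0) := by
  obtain ⟨C, _, hC⟩ := exists_measureReal_cutoff_le S β 1
  have h0 := (tendsto_rpow_zero (a := |1|) (by simp)).const_mul C
  rw [mul_zero] at h0
  refine squeeze_zero' (Eventually.of_forall fun γ => measureReal_nonneg) ?_ h0
  filter_upwards [self_mem_nhdsWithin] with γ hγ using hC γ hγ

lemma tendsto_card_mul_measureReal_cutoff (hδ : 0 < δ) (hζ : 0 < ζ) :
    Tendsto (fun γ : ℝ => numPeriods ζ γ * numFirms δ γ *
      (multivariateGaussian (0 : Cov d₁ d₂) S).real {v | ‖v‖ ≤ cutoffRadius β γ}ᶜ)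
      (𝓝[>] 0) (𝓝 0) := by
  -- The power δ + ζ + 1 beats the number γ^(-δ-ζ) of observations and leaves a factor γ.
  obtain ⟨C, hC0, hC⟩ := exists_measureReal_cutoff_le S β (δ + ζ + 1)
  have h0 := (tendsto_rpow_zero one_pos).const_mul C
  rw [mul_zero] at h0
  refine squeeze_zero' (Eventually.of_forall fun γ => by positivity) ?_ h0
  filter_upwards [self_mem_nhdsWithin] with γ hγ
  have hγ : 0 < γ := hγ
  have h1 := hC γ hγ
  rw [abs_of_pos (by linarith)] at h1
  calc _ ≤ γ ^ (-ζ) * γ ^ (-δ) * (C * γ ^ (δ + ζ + 1)) := by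
        gcongr
        · exact natCast_floor_rpow_le hγ ζ
        · exact natCast_floor_rpow_le hγ δ
    _ = C * (γ ^ (-ζ) * γ ^ (-δ) * γ ^ (δ + ζ + 1)) := by ring
    _ = _ := by
        rw [← Real.rpow_add hγ, ← Real.rpow_add hγ]
        congr 2
        ring

lemma tendsto_lossBound (hζ : 0 < ζ) (hζ' : ζ < 1) :
    Tendsto (fun γ : ℝ => lossBound S β γ (cutoffRadius β γ) (numPeriods ζ γ))
      (𝓝[>] 0) (𝓝 0) := by
  set A := ∫ v, Real.exp (inner ℝ β v) ∂(multivariateGaussian (0 : Cov d₁ d₂) S) with hA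
  have h1 := (tendsto_numPeriods_mul hζ').mul_const (2 * A)
  have h2 : Tendsto (fun γ : ℝ => numPeriods ζ γ *
      (multivariateGaussian (0 : Cov d₁ d₂) S).real {v | ‖v‖ ≤ cutoffRadius β γ}ᶜ)
      (𝓝[>] 0) (𝓝 0) := by
    -- Only the number of periods is needed here; the statement with firms is reused with the
    -- auxiliary choice δ = 1 and at least one firm.
    refine squeeze_zero' (Eventually.of_forall fun γ => by positivity) ?_
      (tendsto_card_mul_measureReal_cutoff (S := S) (β := β) one_pos hζ)
    filter_upwards [(tendsto_numPeriods one_pos).eventually_ge_atTop 1] with γ hγ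
    have : (1 : ℝ) ≤ numFirms 1 γ := by exact_mod_cast hγ
    gcongr
    exact le_mul_of_one_le_right (by positivity) this
  have h3 := h1.add h2
  rw [zero_mul, zero_add] at h3
  refine h3.congr fun γ => ?_
  rw [lossBound, ← hA]
  ring

end Rates

/-! ### The limiting information matrix -/

section LimitCovariance

variable {d₁ d₂ : ℕ} {S : Matrix (Fin d₁ ⊕ Fin d₂) (Fin d₁ ⊕ Fin d₂) ℝ} {β : Cov d₁ d₂}

/-- A row of `limitCov S β`, as a direction in the parameter space. -/
def limitCovRow (S : Matrix (Fin d₁ ⊕ Fin d₂) (Fin d₁ ⊕ Fin d₂) ℝ) (β : Cov d₁ d₂)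
    (k : Fin d₁ ⊕ Fin d₂) : Cov d₁ d₂ := WithLp.toLp 2 (limitCov S β k)

lemma isUnit_det_add_mul_vecMulVec (hS : S.PosDef) (b : Fin d₁ ⊕ Fin d₂ → ℝ) :
    IsUnit (S + S * vecMulVec b b * S).det := by
  have h1 : (S * vecMulVec b b * S).PosSemidef := by
    have h2 : (vecMulVec b b).PosSemidef := by
      simpa using posSemidef_vecMulVec_self_star b
    have h3 := h2.mul_mul_conjTranspose_same S
    rwa [hS.isHermitian.eq] at h3
  exact (Matrix.isUnit_iff_isUnit_det _).1 (hS.add_posSemidef h1).isUnit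

/-- The limit of the normalised Hessian is inverse to `limitCov S β`. -/
lemma integral_hessianDensity_limitCovRow (hS : S.PosDef) (k b : Fin d₁ ⊕ Fin d₂) :
    ∫ v, hessianDensity β (limitCovRow S β k) b v ∂(multivariateGaussian 0 S)
      = (1 : Matrix (Fin d₁ ⊕ Fin d₂) (Fin d₁ ⊕ Fin d₂) ℝ) k b := by
  simp only [hessianDensity]
  rw [integral_inner_mul_inner_mul_exp_inner hS.posSemidef]
  set G := S + S * vecMulVec (WithLp.ofLp β) (WithLp.ofLp β) * S with hG
  have e1 : ∀ c : Cov d₁ d₂, covForm S c (EuclideanSpace.single b (1 : ℝ))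
      + covForm S c β * covForm S (EuclideanSpace.single b (1 : ℝ)) β
      = (WithLp.ofLp c ᵥ* G) b := by
    intro c
    rw [covForm_comm hS.posSemidef (EuclideanSpace.single b 1) β]
    have e2 : ∀ a : Cov d₁ d₂, covForm S a (EuclideanSpace.single b (1 : ℝ))
        = (WithLp.ofLp a ᵥ* S) b := by
      intro a
      rw [covForm, dotProduct_mulVec]
      simp
    rw [e2, e2, hG, vecMul_add, Pi.add_apply, ← vecMul_vecMul, ← vecMul_vecMul, vecMul_vecMulVec,
      smul_vecMul, Pi.smul_apply, smul_eq_mul, ← dotProduct_mulVec]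
    rfl
  rw [e1]
  have e3 : WithLp.ofLp (limitCovRow S β k) ᵥ* G
      = (limitCov S β * G) k := by
    ext j
    simp [limitCovRow, vecMul, dotProduct, Matrix.mul_apply]
  rw [e3, limitCov, ← hG, smul_mul_assoc, nonsing_inv_mul _ (isUnit_det_add_mul_vecMulVec hS _),
    Matrix.smul_apply, smul_eq_mul, ← mul_assoc, ← Real.exp_add]
  have e4 : covForm S β β / 2 + -(1 / 2) * (WithLp.ofLp β ⬝ᵥ S *ᵥ WithLp.ofLp β) = 0 := by
    rw [covForm]; ring
  rw [e4, Real.exp_zero, one_mul]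

/-- With G the limiting Hessian and c the k-th row of its inverse, the limiting variance is cᵀGc,
and Gc = e_k leaves the entry c_k. -/
lemma integral_scoreIntensity_limitCovRow (hS : S.PosDef) (k : Fin d₁ ⊕ Fin d₂) :
    ∫ v, scoreIntensity β (limitCovRow S β k) v ∂(multivariateGaussian 0 S) = limitCov S β k k := by
  have e : ∀ v, scoreIntensity β (limitCovRow S β k) v
      = ∑ b, limitCov S β k b * hessianDensity β (limitCovRow S β k) b v := by
    intro v
    have hi : inner ℝ (limitCovRow S β k) v
        = ∑ b, limitCov S β k b * inner ℝ (EuclideanSpace.single b (1 : ℝ)) v := by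
      simp [PiLp.inner_apply, limitCovRow, mul_comm]
    rw [scoreIntensity, sq]
    nth_rewrite 2 [hi]
    rw [Finset.mul_sum, Finset.sum_mul]
    exact Finset.sum_congr rfl fun b _ => by rw [hessianDensity]; ring
  simp_rw [e]
  rw [integral_finsetSum _ fun b _ => (integrable_hessianDensity β _ b).const_mul _]
  simp_rw [integral_const_mul, integral_hessianDensity_limitCovRow hS]
  simp [Matrix.one_apply]

end LimitCovariance

/-! ### Convergence of the normalised Hessian -/

section Asymptotics

universe u

variable {d₁ d₂ : ℕ} {β : Cov d₁ d₂} {S : Matrix (Fin d₁ ⊕ Fin d₂) (Fin d₁ ⊕ Fin d₂) ℝ}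
  {δ ζ γ₀ K ρ : ℝ} {h : ℝ → ℝ} {M L : ℝ}
  {Ω : ℝ → Type u} [∀ γ, MeasurableSpace (Ω γ)] {P : ∀ γ, Measure (Ω γ)}
  [∀ γ, IsProbabilityMeasure (P γ)]
  {Y : ∀ γ, ℕ → Ω γ → EuclideanSpace ℝ (Fin d₁)}
  {X : ∀ γ, Fin (numFirms δ γ) → ℕ → Ω γ → EuclideanSpace ℝ (Fin d₂)}
  {V : ∀ γ, Fin (numFirms δ γ) → ℕ → Ω γ → Cov d₁ d₂}
  {D : ∀ γ, Fin (numFirms δ γ) → ℕ → Ω γ → ℝ}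
  (hS : S.PosDef) (hδ : 0 < δ) (hζ : 0 < ζ) (hζ' : ζ < 1) (hδζ : 1 < δ + ζ) (hγ₀ : 0 < γ₀)
  (hρ : 0 < ρ) (hρ' : ρ < 1)
  (hV : ∀ γ ∈ Set.Ioo 0 γ₀, IsCovariateProcess (P γ) S K ρ (Y γ) (X γ) (V γ))
  (hD : ∀ γ ∈ Set.Ioo 0 γ₀, IsDefaultProcess (P γ) (numPeriods ζ γ)
    (fun v => defaultProb h v β (alpha γ)) (V γ) (D γ))

/-- The order of magnitude of the estimation error. -/
def errorScale (δ ζ γ : ℝ) : ℝ := γ ^ ((δ + ζ - 1) / 2)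

lemma errorScale_pos {γ : ℝ} (hγ : 0 < γ) : 0 < errorScale δ ζ γ := Real.rpow_pos_of_pos hγ _

include hS hδ hζ hγ₀ hρ hρ' hV in
/-- The normalised Hessian converges in mean. -/
lemma tendsto_integral_hessianError (c : Cov d₁ d₂) (b : Fin d₁ ⊕ Fin d₂) :
    Tendsto (fun γ => ∫ ω, hessianError S (numPeriods ζ γ) (V γ) β
      (errorScale δ ζ γ ^ 2 * γ) c b ω ∂(P γ)) (𝓝[>] 0) (𝓝 0) := by
  have hlln : UniformLLN.{u} S K ρ (hessianDensity β c b) :=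
    UniformLLN.inner_mul_inner hS.posSemidef hρ hρ' c (EuclideanSpace.single b 1) β
  have hN := tendsto_normalisation (δ := δ) hδ hζ
  set I := ∫ v, hessianDensity β c b v ∂(multivariateGaussian (0 : Cov d₁ d₂) S) with hI
  refine tendsto_order.2 ⟨fun e he => Eventually.of_forall fun γ =>
    he.trans_le (integral_nonneg fun ω => abs_nonneg _), fun e he => ?_⟩
  -- Half of the tolerance goes to the law of large numbers; the other contributions, B/√T and the
  -- deviation of the normalisation from 1, vanish.
  obtain ⟨B, hB, hb⟩ := hlln.integral_abs_le (half_pos he)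
  have hT : Tendsto (fun γ => (√(numPeriods ζ γ : ℝ))⁻¹) (𝓝[>] 0) (𝓝 0) :=
    tendsto_inv_atTop_zero.comp (Real.tendsto_sqrt_atTop.comp
      (tendsto_natCast_atTop_atTop.comp (tendsto_numPeriods hζ)))
  have hlim := ((hN.mul_const (e / 2)).add ((hN.mul hT).mul_const B)).add
    (((hN.sub_const 1).abs).mul_const |I|)
  simp only [one_mul, mul_zero, zero_mul, sub_self, abs_zero, add_zero] at hlim
  filter_upwards [(tendsto_order.1 hlim).2 e (half_lt_self he), Ioo_mem_nhdsGT hγ₀,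
    (tendsto_numPeriods hζ).eventually_ge_atTop 1] with γ h1 hγ hT1
  have hγ0 : 0 < γ := hγ.1
  have hT0 : 0 < √(numPeriods ζ γ : ℝ) := Real.sqrt_pos.2 (by exact_mod_cast hT1)
  have h2 := hb (Ω γ) (P γ) _ (Y γ) (X γ) (V γ) (hV γ hγ) (numPeriods ζ γ)
    (errorScale δ ζ γ ^ 2 * γ) (by positivity)
  refine h2.trans_lt (lt_of_le_of_lt (le_of_eq ?_) h1)
  have e1 : √(numPeriods ζ γ : ℝ) = numPeriods ζ γ * (√(numPeriods ζ γ : ℝ))⁻¹ := by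
    rw [eq_mul_inv_iff_mul_eq₀ hT0.ne', Real.mul_self_sqrt (by positivity)]
  nth_rewrite 1 [e1]
  rw [errorScale]
  ring

/-- A vanishing bound for all tail probabilities. -/
def tailLevel (S : Matrix (Fin d₁ ⊕ Fin d₂) (Fin d₁ ⊕ Fin d₂) ℝ) (β : Cov d₁ d₂) (ζ γ : ℝ) : ℝ :=
  lossBound S β γ (cutoffRadius β γ) (numPeriods ζ γ)
    + (multivariateGaussian (0 : Cov d₁ d₂) S).real {v | ‖v‖ ≤ cutoffRadius β γ}ᶜ + γ

lemma lossBound_nonneg {γ : ℝ} (hγ : 0 < γ) (R : ℝ) (T : ℕ) : 0 ≤ lossBound S β γ R T := by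
  have : 0 ≤ ∫ v, Real.exp (inner ℝ β v) ∂(multivariateGaussian 0 S) :=
    integral_nonneg fun v => (Real.exp_pos _).le
  unfold lossBound
  positivity

/-- The extra summand γ in the level guarantees strict positivity, which the estimates by √s
require. -/
lemma tailLevel_spec {γ : ℝ} (hγ : 0 < γ) : 0 < tailLevel S β ζ γ ∧
    lossBound S β γ (cutoffRadius β γ) (numPeriods ζ γ) ≤ tailLevel S β ζ γ ∧
    (multivariateGaussian (0 : Cov d₁ d₂) S).real {v | ‖v‖ ≤ cutoffRadius β γ}ᶜ
      ≤ tailLevel S β ζ γ := by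
  have h1 := lossBound_nonneg (S := S) (β := β) hγ (cutoffRadius β γ) (numPeriods ζ γ)
  have h2 : 0 ≤ (multivariateGaussian (0 : Cov d₁ d₂) S).real {v | ‖v‖ ≤ cutoffRadius β γ}ᶜ :=
    measureReal_nonneg
  unfold tailLevel
  exact ⟨by linarith, by linarith, by linarith⟩

include hζ hζ' in
lemma tendsto_sqrt_tailLevel :
    Tendsto (fun γ => √(tailLevel S β ζ γ)) (𝓝[>] 0) (𝓝 0) := by
  have h1 := ((tendsto_lossBound (S := S) (β := β) hζ hζ').add
    (tendsto_measureReal_cutoff (S := S) (β := β))).add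
    (tendsto_id.mono_left (nhdsWithin_le_nhds (a := (0 : ℝ)) (s := Set.Ioi 0)))
  simp only [add_zero] at h1
  have h2 := (Real.continuous_sqrt.tendsto 0).comp h1
  rw [Real.sqrt_zero] at h2
  exact h2

-- The cutoff radius grows only like log(1/γ), so any positive power wins; this is where δ + ζ > 1
-- is used.
include hδζ in
lemma tendsto_errorScale_mul_cutoffRadius :
    Tendsto (fun γ => errorScale δ ζ γ * cutoffRadius β γ) (𝓝[>] 0) (𝓝 0) := by
  have := (tendsto_rpow_mul_alpha (a := (δ + ζ - 1) / 2) (by linarith)).const_mul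
    (2 * (‖β‖ + 1))⁻¹
  rw [mul_zero] at this
  refine this.congr fun γ => ?_
  rw [errorScale, cutoffRadius]
  ring

end Asymptotics

/-! ### Convergence of the second moments of the rescaled error -/

section Asymptotics

universe u

variable {d₁ d₂ : ℕ} {β : Cov d₁ d₂} {S : Matrix (Fin d₁ ⊕ Fin d₂) (Fin d₁ ⊕ Fin d₂) ℝ}
  {δ ζ γ₀ K ρ : ℝ} {h : ℝ → ℝ} {M L : ℝ}
  {Ω : ℝ → Type u} [∀ γ, MeasurableSpace (Ω γ)] {P : ∀ γ, Measure (Ω γ)}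
  [∀ γ, IsProbabilityMeasure (P γ)]
  {Y : ∀ γ, ℕ → Ω γ → EuclideanSpace ℝ (Fin d₁)}
  {X : ∀ γ, Fin (numFirms δ γ) → ℕ → Ω γ → EuclideanSpace ℝ (Fin d₂)}
  {V : ∀ γ, Fin (numFirms δ γ) → ℕ → Ω γ → Cov d₁ d₂}
  {D : ∀ γ, Fin (numFirms δ γ) → ℕ → Ω γ → ℝ}
  (hS : S.PosDef) (hδ : 0 < δ) (hζ : 0 < ζ) (hζ' : ζ < 1) (hδζ : 1 < δ + ζ) (hγ₀ : 0 < γ₀)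
  (H : TailBound h M L) (hρ : 0 < ρ) (hρ' : ρ < 1)
  (hV : ∀ γ ∈ Set.Ioo 0 γ₀, IsCovariateProcess (P γ) S K ρ (Y γ) (X γ) (V γ))
  (hD : ∀ γ ∈ Set.Ioo 0 γ₀, IsDefaultProcess (P γ) (numPeriods ζ γ)
    (fun v => defaultProb h v β (alpha γ)) (V γ) (D γ))

/-- The truncated, normalised score in the direction of a row of `limitCov S β`. -/
def limitScore (S : Matrix (Fin d₁ ⊕ Fin d₂) (Fin d₁ ⊕ Fin d₂) ℝ) (β : Cov d₁ d₂) (δ ζ : ℝ)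
    (h : ℝ → ℝ) {Ω : Type*} {m : ℕ} (V : Fin m → ℕ → Ω → Cov d₁ d₂) (D : Fin m → ℕ → Ω → ℝ)
    (γ : ℝ) (k : Fin d₁ ⊕ Fin d₂) (ω : Ω) : ℝ :=
  scoreSum (numPeriods ζ γ)
    (scoreCoef h β γ (cutoffRadius β γ) (errorScale δ ζ γ) (limitCovRow S β k))
    (fun v => defaultProb h v β (alpha γ)) V D (numPeriods ζ γ) ω

include hδζ in
lemma eventually_errorScale_mul_cutoffRadius_le (β : Cov d₁ d₂) (B : ℝ) :
    ∀ᶠ γ in 𝓝[>] (0 : ℝ), errorScale δ ζ γ * B * cutoffRadius β γ ≤ 1 := by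
  have := (tendsto_errorScale_mul_cutoffRadius (β := β) hδζ).const_mul B
  rw [mul_zero] at this
  filter_upwards [(tendsto_order.1 this).2 1 one_pos] with γ hγ
  linarith

include hS hδ hζ hζ' hδζ hγ₀ H hρ hρ' hV hD in
/-- The rescaled error of the maximum likelihood estimator is close to the score in probability. -/
lemma eventually_measure_sub_limitScore_le {u : ∀ γ, Ω γ → Cov d₁ d₂}
    (hmax : Tendsto (fun γ => P γ {ω | ¬ ∀ b : Cov d₁ d₂,
        likelihood (numPeriods ζ γ) h (V γ) (D γ) b (alpha γ) ω
          ≤ likelihood (numPeriods ζ γ) h (V γ) (D γ) (β + errorScale δ ζ γ • u γ ω) (alpha γ) ω})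
      (𝓝[>] (0 : ℝ)) (𝓝 0))
    (htight : ∀ e > 0, ∃ B, 0 ≤ B ∧ ∀ γ ∈ Set.Ioo 0 γ₀,
      P γ {ω | B < ‖u γ ω‖} ≤ ENNReal.ofReal e)
    (k : Fin d₁ ⊕ Fin d₂) {η e : ℝ} (hη : 0 < η) (he : 0 < e) :
    ∀ᶠ γ in 𝓝[>] (0 : ℝ),
      P γ {ω | η < |u γ ω k - limitScore S β δ ζ h (V γ) (D γ) γ k ω|} ≤ ENNReal.ofReal e := by
  -- Four exceptional events share the probability: failure to maximise, a large rescaled error, a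
  -- covariate outside the ball, and a large linearisation error.
  have he4 : 0 < e / 4 := by positivity
  obtain ⟨B, hB0, hB⟩ := htight (e / 4) he4
  set c := limitCovRow S β k
  set q1 := ∫ v, ‖v‖ ^ 2 * Real.exp (inner ℝ β v) ∂(multivariateGaussian (0 : Cov d₁ d₂) S)
  set q2 := ∫ v, (‖v‖ ^ 2 * Real.exp (inner ℝ β v)) ^ 2
    ∂(multivariateGaussian (0 : Cov d₁ d₂) S)
  have t1 := (tendsto_order.1 hmax).2 (ENNReal.ofReal (e / 4)) (by simpa using he4)
  have t2 := (tendsto_order.1 (tendsto_card_mul_measureReal_cutoff (S := S) (β := β) hδ hζ)).2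
    (e / 4) he4
  have t3 : Tendsto (fun γ => (B * ∑ b, ∫ ω, hessianError S (numPeriods ζ γ) (V γ) β
        (errorScale δ ζ γ ^ 2 * γ) c b ω ∂(P γ)
        + ‖c‖ * B * (270 * (M + 1)) * (errorScale δ ζ γ ^ 2 * γ
          * (numPeriods ζ γ * numFirms δ γ) * (√(tailLevel S β ζ γ) * (q2 + 1)
        + (errorScale δ ζ γ * B * cutoffRadius β γ + 3 * √γ) * q1))) / η) (𝓝[>] 0) (𝓝 0) := by
    have a1 := (tendsto_finsetSum Finset.univ fun b (_ : b ∈ Finset.univ) =>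
      tendsto_integral_hessianError (β := β) hS hδ hζ hγ₀ hρ hρ' hV c b).const_mul B
    have a2 := (tendsto_sqrt_tailLevel (S := S) (β := β) hζ hζ').mul_const (q2 + 1)
    have a3 := (((tendsto_errorScale_mul_cutoffRadius (β := β) hδζ).const_mul B).add
      (tendsto_sqrt_zero.const_mul 3)).mul_const q1
    have a4 := (a1.add (((tendsto_normalisation (δ := δ) hδ hζ).mul (a2.add a3)).const_mul
      (‖c‖ * B * (270 * (M + 1))))).div_const η
    simp only [Finset.sum_const_zero, mul_zero, zero_mul, add_zero, zero_div] at a4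
    refine a4.congr fun γ => ?_
    rw [errorScale]
    ring
  filter_upwards [t1, t2, (tendsto_order.1 t3).2 (e / 4) he4, Ioo_mem_nhdsGT hγ₀,
    eventually_isCutoff β L, eventually_errorScale_mul_cutoffRadius_le hδζ β B,
    (tendsto_numPeriods hζ).eventually_ge_atTop 1] with γ h1 h2 h3 hγ hc hεB hT
  have hγ0 : 0 < γ := hγ.1
  obtain ⟨s1, s2, _⟩ := tailLevel_spec (S := S) (β := β) (ζ := ζ) hγ0
  have key := hc.measure_sub_scoreSum_le H (hV γ hγ) (hD γ hγ) s1 s2 hT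
    (errorScale_pos (δ := δ) (ζ := ζ) hγ0).le hB0 hεB (u γ) c hη
  -- In the direction of a row of Γ the limiting Hessian acts as a coordinate vector, so the linear
  -- functional of u reduces to its k-th coordinate.
  have hsum : ∀ ω, ∑ b, u γ ω b * ∫ v, hessianDensity β c b v ∂(multivariateGaussian 0 S)
      = u γ ω k := by
    intro ω
    simp_rw [c, integral_hessianDensity_limitCovRow hS]
    simp [Matrix.one_apply]
  simp only [hsum] at key
  refine key.trans ((add_le_add (add_le_add (add_le_add h1.le (hB γ hγ))
    (ENNReal.ofReal_le_ofReal h2.le)) (ENNReal.ofReal_le_ofReal h3.le)).trans (le_of_eq ?_))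
  rw [← ENNReal.ofReal_add he4.le he4.le, ← ENNReal.ofReal_add (by positivity) he4.le,
    ← ENNReal.ofReal_add (by positivity) he4.le]
  congr 1
  ring

include hS hδ hζ hζ' hδζ hγ₀ H hV hD in
/-- Moments of the limiting score. -/
lemma limitScore_moments (k : Fin d₁ ⊕ Fin d₂) :
    Tendsto (fun γ => ∫ ω, limitScore S β δ ζ h (V γ) (D γ) γ k ω ^ 2 ∂(P γ)) (𝓝[>] 0)
      (𝓝 (limitCov S β k k)) ∧
    ∃ C, ∀ᶠ γ in 𝓝[>] (0 : ℝ), ∫ ω, limitScore S β δ ζ h (V γ) (D γ) γ k ω ^ 4 ∂(P γ) ≤ C := by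
  have hM := H.nonneg
  set c := limitCovRow S β k
  set q2 := ∫ v, scoreIntensity β c v ^ 2 ∂(multivariateGaussian (0 : Cov d₁ d₂) S)
  have hN := tendsto_normalisation (δ := δ) hδ hζ
  have hmom : ∀ᶠ γ in 𝓝[>] (0 : ℝ),
      |∫ ω, limitScore S β δ ζ h (V γ) (D γ) γ k ω ^ 2 ∂(P γ)
        - errorScale δ ζ γ ^ 2 * γ * (numPeriods ζ γ * numFirms δ γ) * limitCov S β k k|
      ≤ errorScale δ ζ γ ^ 2 * γ * (numPeriods ζ γ * numFirms δ γ) *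
        (45 * (M + 1) * √γ * limitCov S β k k + 2 * √(tailLevel S β ζ γ) * (q2 + 1)) ∧
      ∫ ω, limitScore S β δ ζ h (V γ) (D γ) γ k ω ^ 4 ∂(P γ)
        ≤ Real.exp (errorScale δ ζ γ ^ 2 * γ * (numPeriods ζ γ * numFirms δ γ)
          * (64 * (46 * (M + 1) * √(q2 + 1)))) := by
    filter_upwards [Ioo_mem_nhdsGT hγ₀, eventually_isCutoff β L,
      eventually_errorScale_mul_cutoffRadius_le (δ := δ) (ζ := ζ) hδζ β (2 * ‖c‖)]
      with γ hγ hc hεB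
    obtain ⟨s1, s2, s3⟩ := tailLevel_spec (S := S) (β := β) (ζ := ζ) hγ.1
    have := hc.moments_scoreSum H (hV γ hγ) (hD γ hγ) s1 s2 s3
      (errorScale_pos (δ := δ) (ζ := ζ) hγ.1) c (by linarith)
    rw [integral_scoreIntensity_limitCovRow hS] at this
    exact this.2
  constructor
  · have a1 := hN.mul_const (limitCov S β k k)
    have a2 := hN.mul ((((tendsto_sqrt_zero.const_mul (45 * (M + 1))).mul_const
      (limitCov S β k k))).add (((tendsto_sqrt_tailLevel (S := S) (β := β) hζ hζ').const_mul
        2).mul_const (q2 + 1)))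
    simp only [mul_zero, zero_mul, add_zero, one_mul] at a1 a2
    have a3 : Tendsto (fun γ => ∫ ω, limitScore S β δ ζ h (V γ) (D γ) γ k ω ^ 2 ∂(P γ)
        - errorScale δ ζ γ ^ 2 * γ * (numPeriods ζ γ * numFirms δ γ) * limitCov S β k k)
        (𝓝[>] 0) (𝓝 0) :=
      squeeze_zero_norm' (hmom.mono fun γ hγ => hγ.1) a2
    have a4 := a3.add a1
    rw [zero_add] at a4
    refine a4.congr fun γ => ?_
    rw [errorScale]
    ring
  -- The normalisation tends to 1 and is therefore eventually at most 2.
  · refine ⟨Real.exp (2 * (64 * (46 * (M + 1) * √(q2 + 1)))), ?_⟩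
    filter_upwards [hmom, (tendsto_order.1 hN).2 2 one_lt_two] with γ h1 h2
    refine h1.2.trans (Real.exp_le_exp.2 ?_)
    gcongr
    exact h2.le

include hS hδ hζ hζ' hδζ hγ₀ H hρ hρ' hV hD in
/-- Convergence of the second moments of the coordinates of the rescaled error. -/
lemma tendsto_integral_coord_sq {u : ∀ γ, Ω γ → Cov d₁ d₂}
    (hu : ∀ γ ∈ Set.Ioo 0 γ₀, AEMeasurable (u γ) (P γ))
    (hmax : Tendsto (fun γ => P γ {ω | ¬ ∀ b : Cov d₁ d₂,
        likelihood (numPeriods ζ γ) h (V γ) (D γ) b (alpha γ) ω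
          ≤ likelihood (numPeriods ζ γ) h (V γ) (D γ) (β + errorScale δ ζ γ • u γ ω) (alpha γ) ω})
      (𝓝[>] (0 : ℝ)) (𝓝 0))
    (hUI : UnifIntegrableFamily P (Set.Ioo 0 γ₀) (fun γ ω => ‖u γ ω‖ ^ 2))
    (k : Fin d₁ ⊕ Fin d₂) :
    Tendsto (fun γ => ∫ ω, u γ ω k ^ 2 ∂(P γ)) (𝓝[>] 0) (𝓝 (limitCov S β k k)) := by
  have htail : ∀ e > 0, ∀ᶠ r in atTop, ∀ γ ∈ Set.Ioo 0 γ₀,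
      Integrable (fun ω => ‖u γ ω‖ ^ 2) (P γ) ∧
      ∫ ω, Set.indicator {ω | r < ‖u γ ω‖ ^ 2} (fun ω => ‖u γ ω‖ ^ 2) ω ∂(P γ) ≤ e ∧
      P γ {ω | r < ‖u γ ω‖ ^ 2} ≤ ENNReal.ofReal e := fun e he =>
    hUI.exists_tail_le (fun γ ω => sq_nonneg _) (fun γ hγ => ((hu γ hγ).norm).pow_const 2) he
  have hsq : Tendsto (fun r : ℝ => r ^ 2) atTop atTop := tendsto_pow_atTop two_ne_zero
  -- Tightness of u follows from uniform integrability; it permits a bound B on ‖u‖ in the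
  -- linearisation.
  have htight : ∀ e > 0, ∃ B, 0 ≤ B ∧ ∀ γ ∈ Set.Ioo 0 γ₀,
      P γ {ω | B < ‖u γ ω‖} ≤ ENNReal.ofReal e := by
    intro e he
    obtain ⟨B, hB, hB0⟩ := ((hsq.eventually (htail e he)).and (eventually_ge_atTop 0)).exists
    refine ⟨B, hB0, fun γ hγ => (measure_mono fun ω hω => ?_).trans (hB γ hγ).2.2⟩
    have hω : B < ‖u γ ω‖ := hω
    change B ^ 2 < ‖u γ ω‖ ^ 2
    gcongr
  obtain ⟨hmom2, C, hmom4⟩ := limitScore_moments hS hδ hζ hζ' hδζ hγ₀ H hV hD k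
  suffices hdiff : Tendsto (fun γ => ∫ ω, u γ ω k ^ 2 ∂(P γ)
      - ∫ ω, limitScore S β δ ζ h (V γ) (D γ) γ k ω ^ 2 ∂(P γ)) (𝓝[>] 0) (𝓝 0) by
    have := hdiff.add hmom2
    rw [zero_add] at this
    exact this.congr fun γ => by ring
  rw [Metric.tendsto_nhds]
  intro e he
  have he5 : 0 < e / 5 := by positivity
  have hC : Tendsto (fun r : ℝ => (r ^ 2)⁻¹ * C) atTop (𝓝 0) := by
    simpa using (tendsto_inv_atTop_zero.comp hsq).mul_const C
  -- The truncation level r is fixed first, from the two tail terms; the accuracy η and the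
  -- exceptional probability are then chosen in terms of r. The four errors are at most e/5 each, so
  -- their sum is strictly below e.
  obtain ⟨r, ⟨hr1, hr2⟩, hr0⟩ := (((hsq.eventually (htail (e / 5) he5)).and
    ((tendsto_order.1 hC).2 (e / 5) he5)).and (eventually_gt_atTop 0)).exists
  have hη : 0 < e / 5 / (2 * r) := by positivity
  have he' : 0 < e / 5 / r ^ 2 := by positivity
  filter_upwards [eventually_measure_sub_limitScore_le hS hδ hζ hζ' hδζ hγ₀ H hρ hρ' hV hD hmax
    htight k hη he', hmom4, Ioo_mem_nhdsGT hγ₀, eventually_isCutoff β L,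
    eventually_errorScale_mul_cutoffRadius_le (δ := δ) (ζ := ζ) hδζ β (2 * ‖limitCovRow S β k‖)]
    with γ h1 h4 hγ hc hεB
  obtain ⟨s1, s2, s3⟩ := tailLevel_spec (S := S) (β := β) (ζ := ζ) hγ.1
  have hbd := (hc.moments_scoreSum H (hV γ hγ) (hD γ hγ) s1 s2 s3
      (errorScale_pos (δ := δ) (ζ := ζ) hγ.1) (limitCovRow S β k) (by linarith)).1
  have hSm : Measurable (limitScore S β δ ζ h (V γ) (D γ) γ k) :=
    ((hD γ hγ).measurable_history_scoreSum (H.measurable_defaultProb _)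
      (H.measurable_scoreCoef _) le_rfl).mono
      (history_le (hV γ hγ).measurable (hD γ hγ).measurable _) le_rfl
  have hum : AEMeasurable (fun ω => u γ ω k) (P γ) := by
    have := hu γ hγ
    fun_prop
  have key := abs_integral_sq_sub_le (P := P γ) hum hSm hbd (Z := fun ω => ‖u γ ω‖ ^ 2)
    (fun ω => by
      rw [← sq_abs]
      gcongr
      exact PiLp.norm_apply_le (u γ ω) k) (hr1 γ hγ).1 hr0 hη.le
  have hP : (P γ).real {ω | e / 5 / (2 * r) < |u γ ω k - limitScore S β δ ζ h (V γ) (D γ) γ k ω|}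
      ≤ e / 5 / r ^ 2 := ENNReal.toReal_le_of_le_ofReal he'.le h1
  rw [Real.dist_eq, sub_zero]
  have b1 : r ^ 2 * (P γ).real
      {ω | e / 5 / (2 * r) < |u γ ω k - limitScore S β δ ζ h (V γ) (D γ) γ k ω|} ≤ e / 5 := by
    calc _ ≤ r ^ 2 * (e / 5 / r ^ 2) := by gcongr
      _ = e / 5 := by field_simp
  have b2 : 2 * r * (e / 5 / (2 * r)) = e / 5 := by field_simp
  have b3 : (r ^ 2)⁻¹ * ∫ ω, limitScore S β δ ζ h (V γ) (D γ) γ k ω ^ 4 ∂(P γ)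
      ≤ (r ^ 2)⁻¹ * C := by gcongr
  have b4 := (hr1 γ hγ).2.1
  linarith

end Asymptotics

end RareDefault

end

/-! ### The mean squared error -/

theorem mainTheorem9 {d₁ d₂ : ℕ}
    -- the parameter, the covariance matrix of the covariates, and the asymptotic regime
    (β : RareDefault.Cov d₁ d₂)
    (S : Matrix (Fin d₁ ⊕ Fin d₂) (Fin d₁ ⊕ Fin d₂) ℝ) (hS : S.PosDef)
    (δ ζ : ℝ) (hδ : 0 < δ) (hζ : 0 < ζ) (hζ' : ζ < 1) (hδζ : 1 < δ + ζ)
    (γ₀ : ℝ) (hγ₀ : 0 < γ₀)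
    -- the remainder in `p(γ, v) = exp (βᵀ v - α(γ)) (1 + h (βᵀ v - α(γ)))`
    (h : ℝ → ℝ) (C : ℝ)
    (hC : ∀ γ ∈ Set.Ioo 0 γ₀, ∀ᵐ v ∂(multivariateGaussian (0 : RareDefault.Cov d₁ d₂) S),
      |h (inner ℝ β v - RareDefault.alpha γ)| ≤ C * γ * Real.exp (inner ℝ β v))
    (hreg : RareDefault.RegularRemainder (multivariateGaussian 0 S) β h)
    -- for each `γ`, a sample of `m(γ)` firms over `T(γ)` periods
    (K ρ : ℝ) (hρ : 0 < ρ) (hρ' : ρ < 1)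
    (Ω : ℝ → Type*) [∀ γ, MeasurableSpace (Ω γ)] (P : ∀ γ, Measure (Ω γ))
    [∀ γ, IsProbabilityMeasure (P γ)]
    (Y : ∀ γ, ℕ → Ω γ → EuclideanSpace ℝ (Fin d₁))
    (X : ∀ γ, Fin (RareDefault.numFirms δ γ) → ℕ → Ω γ → EuclideanSpace ℝ (Fin d₂))
    (V : ∀ γ, Fin (RareDefault.numFirms δ γ) → ℕ → Ω γ → RareDefault.Cov d₁ d₂)
    (D : ∀ γ, Fin (RareDefault.numFirms δ γ) → ℕ → Ω γ → ℝ)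
    (hV : ∀ γ ∈ Set.Ioo 0 γ₀, RareDefault.IsCovariateProcess (P γ) S K ρ (Y γ) (X γ) (V γ))
    (hD : ∀ γ ∈ Set.Ioo 0 γ₀,
      RareDefault.IsDefaultProcess (P γ) (RareDefault.numPeriods ζ γ)
        (fun v => RareDefault.defaultProb h v β (RareDefault.alpha γ)) (V γ) (D γ))
    -- the estimator maximises the likelihood in `b`, with probability tending to one
    (βM : ∀ γ, Ω γ → RareDefault.Cov d₁ d₂)
    (hβM : ∀ γ ∈ Set.Ioo 0 γ₀, AEMeasurable (βM γ) (P γ))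
    (hmax : Tendsto (fun γ => P γ {ω | ¬ ∀ b : RareDefault.Cov d₁ d₂,
        RareDefault.likelihood (RareDefault.numPeriods ζ γ) h (V γ) (D γ)
            b (RareDefault.alpha γ) ω
          ≤ RareDefault.likelihood (RareDefault.numPeriods ζ γ) h (V γ) (D γ)
            (βM γ ω) (RareDefault.alpha γ) ω})
      (𝓝[>] (0 : ℝ)) (𝓝 0))
    -- `‖X_γ‖²` is uniformly integrable, where `X_γ = γ^{-(δ+ζ-1)/2} (β_M(γ) - β)`
    (hUI : RareDefault.UnifIntegrableFamily P (Set.Ioo 0 γ₀)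
      (fun γ ω => ‖γ ^ (-((δ + ζ - 1) / 2)) • (βM γ ω - β)‖ ^ 2)) :
    (∀ γ ∈ Set.Ioo 0 γ₀, Integrable (fun ω => ‖βM γ ω - β‖ ^ 2) (P γ)) ∧
    (fun γ : ℝ => (∫ ω, ‖βM γ ω - β‖ ^ 2 ∂(P γ))
        - (RareDefault.limitCov S β).trace * γ ^ (ζ + δ - 1))
      =o[𝓝[>] (0 : ℝ)] (fun γ : ℝ => γ ^ (ζ + δ - 1)) := by
  classical
  obtain ⟨M, L, H⟩ := hreg.exists_tailBound hS
  set u : ∀ γ, Ω γ → RareDefault.Cov d₁ d₂ :=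
    fun γ ω => γ ^ (-((δ + ζ - 1) / 2)) • (βM γ ω - β) with hu_def
  have hu : ∀ γ ∈ Set.Ioo 0 γ₀, AEMeasurable (u γ) (P γ) := fun γ hγ => by
    have := hβM γ hγ
    simp only [hu_def]
    fun_prop
  -- The scaling is inverted only for γ > 0, which is all that the limit at 0 from the right sees.
  have hback : ∀ γ > 0, ∀ ω, RareDefault.errorScale δ ζ γ • u γ ω = βM γ ω - β := by
    intro γ hγ ω
    rw [hu_def, RareDefault.errorScale, smul_smul, ← Real.rpow_add hγ, add_neg_cancel,
      Real.rpow_zero, one_smul]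
  have hnorm : ∀ γ > 0, ∀ ω, ‖βM γ ω - β‖ ^ 2 = γ ^ (ζ + δ - 1) * ‖u γ ω‖ ^ 2 := by
    intro γ hγ ω
    rw [← hback γ hγ ω, norm_smul, mul_pow, Real.norm_eq_abs, sq_abs, RareDefault.errorScale,
      ← Real.rpow_natCast, ← Real.rpow_mul hγ.le]
    congr 2
    push_cast
    ring
  have hui : ∀ γ ∈ Set.Ioo 0 γ₀, Integrable (fun ω => ‖u γ ω‖ ^ 2) (P γ) := fun γ hγ => by
    obtain ⟨r, hr⟩ := (hUI.exists_tail_le (fun γ ω => sq_nonneg _)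
      (fun γ hγ => ((hu γ hγ).norm).pow_const 2) one_pos).exists
    exact (hr γ hγ).1
  refine ⟨fun γ hγ => ?_, ?_⟩
  · simp_rw [hnorm γ hγ.1]
    exact (hui γ hγ).const_mul _
  have hmax' : Tendsto (fun γ => P γ {ω | ¬ ∀ b : RareDefault.Cov d₁ d₂,
      RareDefault.likelihood (RareDefault.numPeriods ζ γ) h (V γ) (D γ) b
        (RareDefault.alpha γ) ω
      ≤ RareDefault.likelihood (RareDefault.numPeriods ζ γ) h (V γ) (D γ)
        (β + RareDefault.errorScale δ ζ γ • u γ ω) (RareDefault.alpha γ) ω})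
      (𝓝[>] (0 : ℝ)) (𝓝 0) := by
    refine hmax.congr' ?_
    filter_upwards [self_mem_nhdsWithin] with γ hγ
    simp_rw [hback γ hγ, add_sub_cancel]
  have hlim : Tendsto (fun γ => ∫ ω, ‖u γ ω‖ ^ 2 ∂(P γ)) (𝓝[>] 0)
      (𝓝 (RareDefault.limitCov S β).trace) := by
    -- The squared Euclidean norm is the sum of the squared coordinates, so the diagonal entries of
    -- Γ add up to its trace.
    have hsum := tendsto_finsetSum Finset.univ fun k (_ : k ∈ Finset.univ) =>
      RareDefault.tendsto_integral_coord_sq hS hδ hζ hζ' hδζ hγ₀ H hρ hρ' hV hD hu hmax' hUI k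
    refine hsum.congr' ?_
    filter_upwards [Ioo_mem_nhdsGT hγ₀] with γ hγ
    rw [← integral_finsetSum]
    · refine integral_congr_ae (ae_of_all _ fun ω => ?_)
      simp [EuclideanSpace.norm_sq_eq]
    · intro k _
      have hum : AEMeasurable (fun ω => u γ ω k) (P γ) := by
        have := hu γ hγ
        fun_prop
      refine (hui γ hγ).mono' (hum.pow_const 2).aestronglyMeasurable (ae_of_all _ fun ω => ?_)
      rw [norm_pow]
      gcongr
      exact PiLp.norm_apply_le (u γ ω) k
  rw [Asymptotics.isLittleO_iff_tendsto']
  · have h0 := hlim.sub_const (RareDefault.limitCov S β).trace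
    rw [sub_self] at h0
    refine h0.congr' ?_
    filter_upwards [self_mem_nhdsWithin] with γ hγ
    have hp : γ ^ (ζ + δ - 1) ≠ 0 := (Real.rpow_pos_of_pos hγ _).ne'
    simp_rw [hnorm γ hγ]
    rw [integral_const_mul]
    field_simp
  · filter_upwards [self_mem_nhdsWithin] with γ hγ h0
    exact absurd h0 (Real.rpow_pos_of_pos hγ _).ne'
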